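/- Let $p$ be a prime, $P$ a finite $p$-group and $\mathbb Z_{(p)}$ the localization of $\mathbb Z$ at $p$; for a $\mathbb Z$-module $M$ write $M_{(p)}=\mathbb Z_{(p)}\otimes_{\mathbb Z}M$. A *divisible $P$-category* $\mathcal F$ is a subcategory of the category of finite groups whose objects are the subgroups of $P$, whose morphisms are injective group homomorphisms, which contains all the homomorphisms between subgroups of $P$ induced by conjugation by elements of $P$, and such that a group homomorphism $\theta\colon R\to Q$ between subgroups of $P$ is an $\mathcal F$-morphism whenever $\varphi$ and $\varphi\circ\theta$ are $\mathcal F$-morphisms for some $\varphi\colon Q\to T$. Write $\mathcal F(P,Q)$ for the set of $\mathcal F$-morphisms $Q\to P$, $\mathcal F(Q)$ for the group of $\mathcal F$-automorphisms of $Q$, and $\mathcal F_P(Q)\subseteq\mathcal F(Q)$ for the subgroup of those induced by conjugation by elements of $N_P(Q)$. $\mathcal F$ is a *Frobenius $P$-category* if $\mathcal F_P(P)$ is a Sylow $p$-subgroup of $\mathcal F(P)$ and if any $\varphi\in\mathcal F(P,Q)$ that satisfies $\zeta\big(C_P(\varphi(Q))\big)=C_P\big(\zeta(\varphi(Q))\big)$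 for all $\mathcal F$-morphisms $\zeta\colon\varphi(Q)\,C_P(\varphi(Q))\to P$ extends to an $\mathcal F$-morphism to $P$ from the group of all $x\in N_P(Q)$ for which there is $y\in N_P(\varphi(Q))$ with $\varphi(xux^{-1})=y\varphi(u)y^{-1}$ for all $u\in Q$. Let $\mathcal B_P$ be the Burnside algebra of $P$ (the free $\mathbb Z$-module over the isomorphism classes of transitive finite $P$-sets, with product induced by the direct product with diagonal action; its unit $1$ is the class of the one-point $P$-set). For finite groups $G,H$, a finite $G\times H$-set $\Omega$ and a finite $H$-set $X$, let $\Omega\times_HX$ be the $G$-set of orbits of $H$ on $\Omega\times X$ under $u\cdot(\omega,x)=((1,u)\omega,ux)$; similarly $\Omega\times_H\Omega'$ is a $G\times K$-set if $\Omega'$ is an $H\times K$-set. Let $\mathcal B_{P\times P}$ be the double Burnside algebra (the free $\mathbb Z$-module over the isomorphism classes of transitive finite $P\times P$-sets, with product induced by $\Omega\times_P\Omega'$); it acts on $\mathcal B_P$ via $\Omega\times_PX$. Let $f\mapsto f^\circ$ be the map on $\mathcal B_{P\times P}$ induced by exchanging the two factors of $P\times P$, and let $m^P\colon\mathcal B_P\to\mathcal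 B_{P\times P}$ be the homomorphism sending the class of a $P$-set $X$ to the class $m_X$ of the $P\times P$-set $X\times P$ with $(a,b)(x,v)=(ax,avb^{-1})$, which acts on $\mathcal B_P$ as multiplication by $X$. For a homomorphism $\varphi\colon Q\to P$ let $\mathrm{res}_\varphi$ be the class of the $Q\times P$-set $P$ with $(q,u)v=\varphi(q)vu^{-1}$. For a divisible $P$-category $\mathcal F$, the *Hecke algebra* $\mathcal H=\mathcal H_{\mathcal F}$ is the $\mathbb Z$-subalgebra of $\mathcal B_{P\times P}$ spanned by the classes of $(P\times P)/\{(\varphi(u),u)\mid u\in Q\}$, where $Q\le P$ and $\varphi\in\mathcal F(P,Q)$; it contains $m^P(\mathcal B_P)$. Let $v_{\mathcal H}\colon\mathcal H\to\mathcal B_P$, $f\mapsto f(1)$, be the evaluation, let $\mathcal K_{\mathcal H}=\ker v_{\mathcal H}$, and, with $\iota_Q^P$ the inclusion of $Q$ in $P$, set $$(\mathcal B_P)^{\mathcal F}=\{s\in\mathcal B_P\mid \mathrm{res}_\varphi(s)=\mathrm{res}_{\iota_Q^P}(s)\ \text{for all } Q\le P,\ \varphi\in\mathcal F(P,Q)\},$$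 $$\mathcal H^{\mathcal F}=\{f\in\mathcal H\mid \mathrm{res}_\varphi\cdot f=\mathrm{res}_{\iota_Q^P}\cdot f,\ \mathrm{res}_\varphi\cdot f^\circ=\mathrm{res}_{\iota_Q^P}\cdot f^\circ\ \text{for all } Q\le P,\ \varphi\in\mathcal F(P,Q)\}.$$ **Theorem.** Let $\mathcal F$ be a Frobenius $P$-category with Hecke algebra $\mathcal H$. Then: 1. $(\mathcal K_{\mathcal H}+\mathcal H^{\mathcal F})_{(p)}$ is a unitary $\mathbb Z_{(p)}$-subalgebra of $\mathcal H_{(p)}$, and it contains $m^P\big((\mathcal B_P)^{\mathcal F}\big)$. 2. $(\mathcal K_{\mathcal H})_{(p)}$ is a left ideal of $\mathcal H_{(p)}$, $\mathcal H^{\mathcal F}_{(p)}$ is closed under multiplication, and addition $(k,f)\mapsto k+f$ is an isomorphism $(\mathcal K_{\mathcal H})_{(p)}\rtimes\mathcal H^{\mathcal F}_{(p)}\cong(\mathcal K_{\mathcal H}+\mathcal H^{\mathcal F})_{(p)}$ of $\mathbb Z_{(p)}$-algebras, where $\rtimes$ denotes the direct product of $\mathbb Z_{(p)}$-modules with the product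 $(k,f)(k',f')=(kk'+fk',ff')$. 3. Every element of $\mathcal H^{\mathcal F}$ commutes with every element of $m^P\big((\mathcal B_P)^{\mathcal F}\big)$. 4. $(\mathcal B_P)^{\mathcal F}_{(p)}$ is a unitary subalgebra of $(\mathcal B_P)_{(p)}$, and $v_{\mathcal H}$ induces a $\mathbb Z_{(p)}$-algebra isomorphism $\mathcal H^{\mathcal F}_{(p)}\cong(\mathcal B_P)^{\mathcal F}_{(p)}$. -/

import Mathlib

open scoped TensorProduct

universe u v

noncomputable section

/-- Isomorphisms of `G`-sets. -/
structure GEquiv (G X Y : Type*) [SMul G X] [SMul G Y] extends X ≃ Y where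
  map_smul' : ∀ (g : G) (x : X), toFun (g • x) = g • toFun x

namespace GEquiv

variable {G X Y Z : Type*} [Group G] [MulAction G X] [MulAction G Y] [MulAction G Z]

theorem map_smul (e : GEquiv G X Y) (g : G) (x : X) : e.toEquiv (g • x) = g • e.toEquiv x :=
  e.map_smul' g x

def refl : GEquiv G X X := ⟨Equiv.refl X, fun _ _ => rfl⟩

def symm (e : GEquiv G X Y) : GEquiv G Y X :=
  ⟨e.toEquiv.symm, fun g y => by
    apply e.toEquiv.injective
    change e.toEquiv (e.toEquiv.symm _) = e.toEquiv (g • e.toEquiv.symm y)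
    rw [e.map_smul]; simp⟩

def trans (e : GEquiv G X Y) (f : GEquiv G Y Z) : GEquiv G X Z :=
  ⟨e.toEquiv.trans f.toEquiv, fun g x => by
    change f.toEquiv (e.toEquiv (g • x)) = g • f.toEquiv (e.toEquiv x)
    rw [e.map_smul, f.map_smul]⟩

end GEquiv

/-- Two subgroups `K`, `L` of `G` are related when the indecomposable `G`-sets `G ⧸ K` and
`G ⧸ L` are isomorphic. -/
def indecSetoid (G : Type u) [Group G] : Setoid (Subgroup G) where
  r K L := Nonempty (GEquiv G (G ⧸ K) (G ⧸ L))
  iseqv := ⟨fun _ => ⟨.refl⟩, fun ⟨e⟩ => ⟨e.symm⟩, fun ⟨e⟩ ⟨f⟩ => ⟨e.trans f⟩⟩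

/-- Isomorphism classes of indecomposable (that is, transitive) `G`-sets; every such `G`-set is
isomorphic to some `G ⧸ K`. -/
abbrev IndecClass (G : Type u) [Group G] : Type u := Quotient (indecSetoid G)

/-- The free `ℤ`-module over the isomorphism classes of indecomposable `G`-sets. -/
def Burn (G : Type u) [Group G] : Type u := IndecClass G →₀ ℤ

namespace Burn

section Basic

variable {G : Type u} [Group G]

instance : AddCommGroup (Burn G) := inferInstanceAs (AddCommGroup (IndecClass G →₀ ℤ))

/-- The basis element given by an isomorphism class of indecomposable `G`-sets. -/
def basisElt (q : IndecClass G) : Burn G := Finsupp.single q 1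

/-- The element of `Burn G` determined by a finite `G`-set `X`: the sum over the orbits of `X` of
the isomorphism class of the orbit, an orbit `G • x` being isomorphic to `G ⧸ stabilizer G x`. -/
def cls (G : Type u) [Group G] (X : Type u) [MulAction G X] : Burn G :=
  ∑ᶠ ω : MulAction.orbitRel.Quotient G X,
    basisElt (Quotient.mk (indecSetoid G) (MulAction.stabilizer G (Quotient.out ω)))

/-- Linear extension to `Burn G` of a function `c` on the indecomposable `G`-sets `G ⧸ K`. -/
def ext1 {M : Type*} [AddCommGroup M] (c : Subgroup G → M) : Burn G →ₗ[ℤ] M :=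
  Finsupp.linearCombination ℤ (fun q : IndecClass G => c (Quotient.out q))

theorem ext1_basisElt {M : Type*} [AddCommGroup M] (c : Subgroup G → M) (q : IndecClass G) :
    ext1 c (basisElt q) = c (Quotient.out q) := by
  unfold ext1 basisElt
  erw [Finsupp.linearCombination_single]
  simp

theorem hom_ext {M : Type*} [AddCommGroup M] {φ ψ : Burn G →ₗ[ℤ] M}
    (h : ∀ q, φ (basisElt q) = ψ (basisElt q)) : φ = ψ :=
  Finsupp.lhom_ext' fun q => LinearMap.ext_ring (h q)

/-- Any point of an orbit gives an isomorphism with the quotient by its stabilizer; so the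
isomorphism class of the quotient depends on the orbit only. -/
theorem mk_stabilizer_smul {X : Type u} [MulAction G X] (g : G) (x : X) :
    Quotient.mk (indecSetoid G) (MulAction.stabilizer G (g • x)) =
      Quotient.mk (indecSetoid G) (MulAction.stabilizer G x) := by
  apply Quotient.sound
  have key : ∀ y : X, Nonempty (GEquiv G (MulAction.orbit G y) (G ⧸ MulAction.stabilizer G y)) := by
    intro y
    refine ⟨GEquiv.symm ⟨(MulAction.orbitEquivQuotientStabilizer G y).symm, ?_⟩⟩
    intro a b
    induction b using Quotient.inductionOn'
    rename_i b
    apply Subtype.ext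
    change (MulAction.orbitEquivQuotientStabilizer G y).symm
      (((a * b : G) : G ⧸ MulAction.stabilizer G y)) = a • (((MulAction.orbitEquivQuotientStabilizer G y).symm (b : G ⧸ MulAction.stabilizer G y)) : X)
    simp only [MulAction.orbitEquivQuotientStabilizer_symm_apply, mul_smul]
  obtain ⟨e₁⟩ := key (g • x)
  obtain ⟨e₂⟩ := key x
  have ho : MulAction.orbit G (g • x) = MulAction.orbit G x := MulAction.orbit_smul g x
  refine ⟨e₁.symm.trans (GEquiv.trans ⟨Equiv.setCongr ho, ?_⟩ e₂)⟩
  intro a b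
  rfl

theorem mk_stabilizer_out {X : Type u} [MulAction G X] (x : X) :
    Quotient.mk (indecSetoid G) (MulAction.stabilizer G
      (Quotient.out (Quotient.mk (MulAction.orbitRel G X) x))) =
      Quotient.mk (indecSetoid G) (MulAction.stabilizer G x) := by
  have h := Quotient.mk_out (s := MulAction.orbitRel G X) x
  obtain ⟨g, hg⟩ := h
  rw [← hg]
  exact mk_stabilizer_smul g x

theorem cls_congr {X Y : Type u} [MulAction G X] [MulAction G Y] (e : GEquiv G X Y) :
    cls G X = cls G Y := by
  unfold cls
  let f : MulAction.orbitRel.Quotient G X ≃ MulAction.orbitRel.Quotient G Y :=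
    Quotient.congr e.toEquiv (by
      intro a b
      constructor
      · rintro ⟨g, hg⟩
        exact ⟨g, by change g • e.toEquiv b = _; rw [← e.map_smul]; exact congrArg _ hg⟩
      · rintro ⟨g, hg⟩
        refine ⟨g, e.toEquiv.injective ?_⟩
        change e.toEquiv (g • b) = _
        rw [e.map_smul]; exact hg)
  refine finsum_eq_of_bijective f f.bijective ?_
  intro ω
  induction ω using Quotient.inductionOn
  rename_i x
  congr 1
  change _ = Quotient.mk (indecSetoid G) (MulAction.stabilizer G
      (Quotient.out (Quotient.mk (MulAction.orbitRel G Y) (e.toEquiv x))))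
  rw [mk_stabilizer_out, mk_stabilizer_out]
  congr 1
  ext g
  simp only [MulAction.mem_stabilizer_iff]
  rw [← e.map_smul, e.toEquiv.injective.eq_iff]

theorem cls_sigma {ι : Type u} [Fintype ι] {X : ι → Type u} [∀ i, MulAction G (X i)]
    [∀ i, Finite (X i)] : cls G (Σ i, X i) = ∑ i, cls G (X i) := by
  classical
  let f : (Σ i, MulAction.orbitRel.Quotient G (X i)) → MulAction.orbitRel.Quotient G (Σ i, X i) :=
    fun a => Quotient.map' (s₁ := MulAction.orbitRel G (X a.1)) (fun x => ⟨a.1, x⟩) (by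
      rintro x y ⟨g, hg⟩
      exact ⟨g, by simp only [Sigma.smul_mk]; exact congrArg _ hg⟩) a.2
  have hf : Function.Bijective f := by
    constructor
    · rintro ⟨i, x⟩ ⟨j, y⟩ h
      induction x using Quotient.inductionOn
      induction y using Quotient.inductionOn
      rename_i x y
      obtain ⟨g, hg⟩ := Quotient.exact h
      simp only [Sigma.smul_mk] at hg
      obtain ⟨rfl, hg⟩ := Sigma.mk.inj hg
      have hg := eq_of_heq hg
      congr 1
      exact Quotient.sound ⟨g, hg⟩
    · intro ω
      induction ω using Quotient.inductionOn
      rename_i x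
      exact ⟨⟨x.1, Quotient.mk _ x.2⟩, rfl⟩
  unfold cls
  rw [← finsum_eq_of_bijective f hf (f := fun a => basisElt (Quotient.mk (indecSetoid G)
    (MulAction.stabilizer G (Quotient.out a.2))))]
  · have : ∀ i, Finite (MulAction.orbitRel.Quotient G (X i)) := fun i => Quotient.finite _
    let : ∀ i, Fintype (MulAction.orbitRel.Quotient G (X i)) := fun i => Fintype.ofFinite _
    rw [finsum_eq_sum_of_fintype, Fintype.sum_sigma]
    simp only [finsum_eq_sum_of_fintype]
  · rintro ⟨i, x⟩
    induction x using Quotient.inductionOn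
    rename_i x
    congr 1
    change _ = Quotient.mk (indecSetoid G) (MulAction.stabilizer G
      (Quotient.out (Quotient.mk (MulAction.orbitRel G (Σ i, X i)) ⟨i, x⟩)))
    rw [mk_stabilizer_out, mk_stabilizer_out]
    congr 1
    ext g
    simp [MulAction.mem_stabilizer_iff, Sigma.smul_mk]

theorem cls_quotient (K : Subgroup G) :
    cls G (G ⧸ K) = basisElt (Quotient.mk (indecSetoid G) K) := by
  unfold cls
  have hs : ∀ ω : MulAction.orbitRel.Quotient G (G ⧸ K),
      ω = Quotient.mk (MulAction.orbitRel G (G ⧸ K)) ((1 : G) : G ⧸ K) := by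
    intro ω
    induction ω using Quotient.inductionOn
    rename_i x
    apply Quotient.sound
    exact MulAction.exists_smul_eq G _ _
  rw [finsum_eq_single _ (Quotient.mk (MulAction.orbitRel G (G ⧸ K)) ((1 : G) : G ⧸ K))
    (fun ω hω => absurd (hs ω) hω)]
  rw [mk_stabilizer_out, MulAction.stabilizer_quotient]

theorem cls_out (q : IndecClass G) : cls G (G ⧸ Quotient.out q) = basisElt q := by
  rw [cls_quotient]; congr 1; exact Quotient.out_eq q

/-- A finite `G`-set is the disjoint union of its orbits. -/
def sigmaOrbits (X : Type u) [MulAction G X] : GEquiv G X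
    (Σ ω : MulAction.orbitRel.Quotient G X, G ⧸ MulAction.stabilizer G (Quotient.out ω)) :=
  GEquiv.symm ⟨Equiv.ofBijective
    (fun a => MulAction.ofQuotientStabilizer G (Quotient.out a.1) a.2) (by
      constructor
      · rintro ⟨ω, y⟩ ⟨ω', y'⟩ h
        induction y using Quotient.inductionOn'
        induction y' using Quotient.inductionOn'
        rename_i y y'
        change y • Quotient.out ω = y' • Quotient.out ω' at h
        have hω : ω = ω' := by
          rw [← Quotient.out_eq ω, ← Quotient.out_eq ω']
          refine Quotient.sound ⟨y⁻¹ * y', ?_⟩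
          change (y⁻¹ * y') • Quotient.out ω' = _
          rw [mul_smul, ← h, inv_smul_smul]
        subst hω
        congr 1
        exact MulAction.injective_ofQuotientStabilizer G (Quotient.out ω) h
      · intro x
        obtain ⟨g, hg⟩ := (MulAction.orbitRel G X).symm
          (Quotient.mk_out (s := MulAction.orbitRel G X) x)
        exact ⟨⟨Quotient.mk _ x, QuotientGroup.mk g⟩, hg⟩), by
    rintro g ⟨ω, y⟩
    exact MulAction.ofQuotientStabilizer_smul G _ g y⟩

theorem ext1_cls [Finite G] {M : Type*} [AddCommGroup M]
    (c : ∀ (X : Type u) [MulAction G X], M)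
    (hiso : ∀ (X Y : Type u) [MulAction G X] [MulAction G Y], GEquiv G X Y → c X = c Y)
    (hsigma : ∀ (ι : Type u) [Fintype ι] (X : ι → Type u) [∀ i, MulAction G (X i)]
      [∀ i, Finite (X i)], c (Σ i, X i) = ∑ i, c (X i))
    (X : Type u) [MulAction G X] [Finite X] :
    ext1 (fun K => c (G ⧸ K)) (cls G X) = c X := by
  have : Finite (MulAction.orbitRel.Quotient G X) := Quotient.finite _
  let : Fintype (MulAction.orbitRel.Quotient G X) := Fintype.ofFinite _
  rw [hiso _ _ (sigmaOrbits X), hsigma, cls, finsum_eq_sum_of_fintype, map_sum]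
  refine Finset.sum_congr rfl fun ω _ => ?_
  rw [ext1_basisElt]
  obtain ⟨e⟩ : (indecSetoid G).r _ _ := Quotient.mk_out (s := indecSetoid G) (MulAction.stabilizer G (Quotient.out ω))
  exact hiso _ _ e

end Basic

section Product

variable {G : Type u} [Group G]

/-- Bilinear extension of a function on pairs of indecomposable sets. -/
def ext2 {H : Type u} [Group H] {M : Type*} [AddCommGroup M] (c : Subgroup G → Subgroup H → M) :
    Burn G →ₗ[ℤ] Burn H →ₗ[ℤ] M :=
  ext1 fun K => ext1 fun L => c K L

theorem ext2_basisElt {H : Type u} [Group H] {M : Type*} [AddCommGroup M]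
    (c : Subgroup G → Subgroup H → M) (q : IndecClass G) (r : IndecClass H) :
    ext2 c (basisElt q) (basisElt r) = c (Quotient.out q) (Quotient.out r) := by
  rw [ext2, ext1_basisElt, ext1_basisElt]

theorem ext2_cls [Finite G] {H : Type u} [Group H] [Finite H] {M : Type*} [AddCommGroup M]
    (c : ∀ (X Y : Type u) [MulAction G X] [MulAction H Y], M)
    (hiso : ∀ (X X' Y Y' : Type u) [MulAction G X] [MulAction G X'] [MulAction H Y]
      [MulAction H Y'], GEquiv G X X' → GEquiv H Y Y' → c X Y = c X' Y')
    (hsigma : ∀ (ι : Type u) [Fintype ι] (X : ι → Type u) [∀ i, MulAction G (X i)]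
      [∀ i, Finite (X i)] (Y : Type u) [MulAction H Y] [Finite Y],
        c (Σ i, X i) Y = ∑ i, c (X i) Y)
    (hsigma' : ∀ (ι : Type u) [Fintype ι] (X : Type u) [MulAction G X] [Finite X]
      (Y : ι → Type u) [∀ i, MulAction H (Y i)] [∀ i, Finite (Y i)],
        c X (Σ i, Y i) = ∑ i, c X (Y i))
    (X Y : Type u) [MulAction G X] [Finite X] [MulAction H Y] [Finite Y] :
    ext2 (fun K L => c (G ⧸ K) (H ⧸ L)) (cls G X) (cls H Y) = c X Y := by
  have h1 : ∀ K : Subgroup G, ext1 (fun L => c (G ⧸ K) (H ⧸ L)) (cls H Y) = c (G ⧸ K) Y :=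
    fun K => ext1_cls (fun Y _ => c (G ⧸ K) Y) (fun Y Y' _ _ e => hiso _ _ _ _ .refl e)
      (fun ι _ Y _ _ => hsigma' ι _ Y) Y
  have h2 : (LinearMap.flip (ext2 (fun K L => c (G ⧸ K) (H ⧸ L)))) (cls H Y) =
      ext1 (fun K => c (G ⧸ K) Y) := by
    refine hom_ext fun q => ?_
    rw [LinearMap.flip_apply, ext2, ext1_basisElt, ext1_basisElt, h1]
  have h3 := LinearMap.congr_fun h2 (cls G X)
  rw [LinearMap.flip_apply] at h3
  rw [h3]
  exact ext1_cls (fun X _ => c X Y) (fun X X' _ _ e => hiso _ _ _ _ e .refl)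
      (fun ι _ X _ _ => hsigma ι X Y) X

/-- The product of `Burn G`, induced by the inner direct product `X × Y` of `G`-sets (with the
diagonal action). -/
instance : Mul (Burn G) :=
  ⟨fun a b => ext2 (fun K L => cls G ((G ⧸ K) × (G ⧸ L))) a b⟩

/-- The unit is the isomorphism class of the trivial `G`-set. -/
instance : One (Burn G) := ⟨basisElt (Quotient.mk (indecSetoid G) ⊤)⟩

theorem mul_def (a b : Burn G) :
    a * b = ext2 (fun K L => cls G ((G ⧸ K) × (G ⧸ L))) a b := rfl

theorem cls_mul_cls [Finite G] (X Y : Type u) [MulAction G X] [Finite X] [MulAction G Y]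
    [Finite Y] : cls G X * cls G Y = cls G (X × Y) := by
  have h := ext2_cls (G := G) (H := G) (M := Burn G)
    (fun X Y [MulAction G X] [MulAction G Y] => cls G (X × Y)) ?_ ?_ ?_ X Y
  · exact h
  · intro X X' Y Y' _ _ _ _ e f
    exact cls_congr ⟨e.toEquiv.prodCongr f.toEquiv, fun g x =>
      Prod.ext (e.map_smul g x.1) (f.map_smul g x.2)⟩
  · intro ι _ X _ _ Y _ _
    rw [← cls_sigma]
    exact cls_congr ⟨Equiv.sigmaProdDistrib X Y, fun _ _ => rfl⟩
  · intro ι _ X _ _ Y _ _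
    rw [← cls_sigma]
    exact cls_congr ⟨⟨fun a => ⟨a.2.1, a.1, a.2.2⟩, fun a => ⟨a.2.1, a.1, a.2.2⟩,
      fun _ => rfl, fun _ => rfl⟩, fun _ _ => rfl⟩

theorem one_eq (G : Type u) [Group G] : (1 : Burn G) = cls G (G ⧸ (⊤ : Subgroup G)) :=
  (cls_quotient _).symm

theorem induction_on {p : Burn G → Prop} (a : Burn G) (basis : ∀ q, p (basisElt q))
    (zero : p 0) (add : ∀ a b, p a → p b → p (a + b)) (neg : ∀ a, p a → p (-a)) : p a := by
  have h' : ∀ (n : ℤ) (q : IndecClass G), p (n • basisElt q) := by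
    intro n q
    induction n with
    | zero => simpa using zero
    | succ n ih => rw [add_smul, one_smul]; exact add _ _ ih (basis q)
    | pred n ih =>
      rw [sub_smul, one_smul, sub_eq_add_neg]
      exact add _ _ ih (neg _ (basis q))
  have h : ∀ (n : ℤ) (q : IndecClass G), p (Finsupp.single q n : IndecClass G →₀ ℤ) := by
    intro n q
    have key : (Finsupp.single q n : IndecClass G →₀ ℤ) = n • Finsupp.single q 1 := by simp
    rw [key]
    exact h' n q
  induction a using Finsupp.induction_linear with
  | zero => exact zero
  | add f g hf hg => exact add f g hf hg
  | single q n => exact h n q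

theorem burn_mul_comm [Finite G] (a b : Burn G) : a * b = b * a := by
  have h : (ext2 (fun K L => cls G ((G ⧸ K) × (G ⧸ L))) : Burn G →ₗ[ℤ] Burn G →ₗ[ℤ] Burn G) =
      (ext2 (fun K L => cls G ((G ⧸ K) × (G ⧸ L)))).flip := by
    refine hom_ext fun q => hom_ext fun r => ?_
    change basisElt q * basisElt r = basisElt r * basisElt q
    rw [← cls_out q, ← cls_out r, cls_mul_cls, cls_mul_cls]
    exact cls_congr ⟨Equiv.prodComm _ _, fun _ _ => rfl⟩
  exact LinearMap.congr_fun₂ h a b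

theorem burn_add_mul (a b c : Burn G) : (a + b) * c = a * c + b * c := by
  simp only [mul_def, map_add, LinearMap.add_apply]

theorem burn_mul_add (a b c : Burn G) : a * (b + c) = a * b + a * c := by
  simp only [mul_def, map_add]

theorem burn_zero_mul (a : Burn G) : 0 * a = 0 := by
  simp only [mul_def, map_zero, LinearMap.zero_apply]

theorem burn_mul_zero (a : Burn G) : a * 0 = 0 := by
  simp only [mul_def, map_zero]

theorem burn_neg_mul (a b : Burn G) : -a * b = -(a * b) := by
  simp only [mul_def, map_neg, LinearMap.neg_apply]

theorem burn_mul_neg (a b : Burn G) : a * -b = -(a * b) := by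
  simp only [mul_def, map_neg]

theorem burn_mul_assoc [Finite G] (a b c : Burn G) : a * b * c = a * (b * c) := by
  induction a using induction_on with
  | zero => simp only [burn_zero_mul]
  | add a a' h h' => simp only [burn_add_mul, h, h']
  | neg a h => simp only [burn_neg_mul, h]
  | basis q =>
  induction b using induction_on with
  | zero => simp only [burn_zero_mul, burn_mul_zero]
  | add a a' h h' => simp only [burn_add_mul, burn_mul_add, h, h']
  | neg a h => simp only [burn_neg_mul, burn_mul_neg, h]
  | basis r =>
  induction c using induction_on with
  | zero => simp only [burn_mul_zero]
  | add a a' h h' => simp only [burn_mul_add, h, h']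
  | neg a h => simp only [burn_mul_neg, h]
  | basis s =>
  rw [← cls_out q, ← cls_out r, ← cls_out s]
  simp only [cls_mul_cls]
  exact cls_congr ⟨Equiv.prodAssoc _ _ _, fun _ _ => rfl⟩

theorem burn_one_mul [Finite G] (a : Burn G) : 1 * a = a := by
  induction a using induction_on with
  | zero => simp only [burn_mul_zero]
  | add a a' h h' => simp only [burn_mul_add, h, h']
  | neg a h => simp only [burn_mul_neg, h]
  | basis q =>
  rw [← cls_out q, one_eq, cls_mul_cls]
  have : Subsingleton (G ⧸ (⊤ : Subgroup G)) := QuotientGroup.subsingleton_quotient_top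
  exact cls_congr ⟨⟨fun a => a.2, fun x => (((1 : G) : G ⧸ (⊤ : Subgroup G)), x),
    fun a => Prod.ext (Subsingleton.elim _ _) rfl, fun _ => rfl⟩, fun _ _ => rfl⟩

/-- The Burnside algebra of a finite group. -/
instance [Finite G] : CommRing (Burn G) where
  left_distrib := burn_mul_add
  right_distrib := burn_add_mul
  zero_mul := burn_zero_mul
  mul_zero := burn_mul_zero
  mul_assoc := burn_mul_assoc
  one_mul := burn_one_mul
  mul_one a := by rw [burn_mul_comm, burn_one_mul]
  mul_comm := burn_mul_comm
  zsmul := (· • ·)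
  zsmul_zero' := zero_zsmul
  zsmul_succ' n a := SubNegMonoid.zsmul_succ' n a
  zsmul_neg' n a := SubNegMonoid.zsmul_neg' n a
  neg_add_cancel := neg_add_cancel
  nsmul := (· • ·)
  nsmul_zero := zero_nsmul
  nsmul_succ n a := succ_nsmul a n
  sub_eq_add_neg := sub_eq_add_neg

end Product

end Burn

/-! ### Bisets -/

section Amalgamation

variable {A H G₁ G₂ : Type u} [Group A] [Group H] [Group G₁] [Group G₂]
  (α : A × H →* G₁) (β : A × H →* G₂)

/-- Let `A × H` act on `Ω` and on `X` through `α` and `β`. This is the equivalence relation on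
`Ω × X` whose classes are the orbits of `H`. -/
def amalgSetoid (Ω X : Type u) [MulAction G₁ Ω] [MulAction G₂ X] : Setoid (Ω × X) where
  r a b := ∃ u : H, b = (α (1, u) • a.1, β (1, u) • a.2)
  iseqv := by
    refine ⟨fun a => ⟨1, ?_⟩, ?_, ?_⟩
    · have h : ((1 : A), (1 : H)) = 1 := rfl
      simp [h]
    · rintro a _ ⟨u, rfl⟩
      have h : ((1 : A), u⁻¹) * (1, u) = 1 := by simp
      exact ⟨u⁻¹, by simp only [← mul_smul, ← map_mul, h]; simp⟩
    · rintro a _ _ ⟨u, rfl⟩ ⟨v, rfl⟩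
      exact ⟨v * u, by simp only [← mul_smul, ← map_mul]; simp⟩

/-- The set of orbits of `H` on `Ω × X`. -/
def Amalg (Ω X : Type u) [MulAction G₁ Ω] [MulAction G₂ X] : Type u :=
  Quotient (amalgSetoid α β Ω X)

namespace Amalg

variable {α β} {Ω X : Type u} [MulAction G₁ Ω] [MulAction G₂ X]

/-- The orbit of `(ω, x)`. -/
def mk (ω : Ω) (x : X) : Amalg α β Ω X := Quotient.mk (amalgSetoid α β Ω X) (ω, x)

theorem mk_eq_mk {ω ω' : Ω} {x x' : X} : (mk ω x : Amalg α β Ω X) = mk ω' x' ↔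
    ∃ u : H, ω' = α (1, u) • ω ∧ x' = β (1, u) • x := by
  constructor
  · intro h
    obtain ⟨u, hu⟩ := Quotient.exact h
    exact ⟨u, congrArg Prod.fst hu, congrArg Prod.snd hu⟩
  · rintro ⟨u, rfl, rfl⟩
    exact Quotient.sound ⟨u, rfl⟩

theorem ind {p : Amalg α β Ω X → Prop} (h : ∀ ω x, p (mk ω x)) (a : Amalg α β Ω X) : p a :=
  Quotient.inductionOn a fun b => h b.1 b.2

/-- Maps out of the set of orbits. -/
def lift {Y : Type*} (f : Ω → X → Y)
    (hf : ∀ ω x (u : H), f ω x = f (α (1, u) • ω) (β (1, u) • x)) (a : Amalg α β Ω X) : Y :=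
  Quotient.lift (fun b : Ω × X => f b.1 b.2) (by rintro a _ ⟨u, rfl⟩; exact hf _ _ u) a

instance [Finite Ω] [Finite X] : Finite (Amalg α β Ω X) :=
  inferInstanceAs (Finite (Quotient (amalgSetoid α β Ω X)))

/-- The action of `A` on the set of orbits of `H`. -/
instance : MulAction A (Amalg α β Ω X) where
  smul a := lift (fun ω x => mk (α (a, 1) • ω) (β (a, 1) • x)) (by
    intro ω x u
    refine mk_eq_mk.2 ⟨u, ?_, ?_⟩ <;> simp only [← mul_smul, ← map_mul] <;> simp)
  one_smul := ind fun ω x => by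
    change mk (α (1, 1) • ω) (β (1, 1) • x) = _
    have h : ((1 : A), (1 : H)) = 1 := rfl
    simp [h]
  mul_smul a b := ind fun ω x => by
    change mk (α (a * b, 1) • ω) (β (a * b, 1) • x) =
      mk (α (a, 1) • α (b, 1) • ω) (β (a, 1) • β (b, 1) • x)
    simp only [← mul_smul, ← map_mul]; simp

theorem smul_mk (a : A) (ω : Ω) (x : X) :
    a • (mk ω x : Amalg α β Ω X) = mk (α (a, 1) • ω) (β (a, 1) • x) := rfl

/-- Functoriality of the amalgamation for isomorphisms. -/
def congr {Ω' X' : Type u} [MulAction G₁ Ω'] [MulAction G₂ X'] (e : GEquiv G₁ Ω Ω')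
    (f : GEquiv G₂ X X') : GEquiv A (Amalg α β Ω X) (Amalg α β Ω' X') where
  toFun := lift (fun ω x => mk (e.toEquiv ω) (f.toEquiv x)) (by
    intro ω x u
    rw [e.map_smul, f.map_smul]; exact mk_eq_mk.2 ⟨u, rfl, rfl⟩)
  invFun := lift (fun ω x => mk (e.symm.toEquiv ω) (f.symm.toEquiv x)) (by
    intro ω x u
    rw [e.symm.map_smul, f.symm.map_smul]; exact mk_eq_mk.2 ⟨u, rfl, rfl⟩)
  left_inv := ind fun ω x => by
    change mk (e.toEquiv.symm (e.toEquiv ω)) (f.toEquiv.symm (f.toEquiv x)) = _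
    simp
  right_inv := ind fun ω x => by
    change mk (e.toEquiv (e.toEquiv.symm ω)) (f.toEquiv (f.toEquiv.symm x)) = _
    simp
  map_smul' a := ind fun ω x => by
    change mk (e.toEquiv (α (a, 1) • ω)) (f.toEquiv (β (a, 1) • x)) =
      mk (α (a, 1) • e.toEquiv ω) (β (a, 1) • f.toEquiv x)
    rw [e.map_smul, f.map_smul]

/-- Distributivity on the left. -/
def sigmaLeft {ι : Type u} {Ω : ι → Type u} [∀ i, MulAction G₁ (Ω i)] :
    GEquiv A (Amalg α β (Σ i, Ω i) X) (Σ i, Amalg α β (Ω i) X) where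
  toFun := lift (fun ω x => ⟨ω.1, mk ω.2 x⟩) (by
    rintro ⟨i, ω⟩ x u
    simp only [Sigma.smul_mk]
    congr 1
    exact mk_eq_mk.2 ⟨u, rfl, rfl⟩)
  invFun a := lift (fun ω x => mk ⟨a.1, ω⟩ x) (by
    intro ω x u
    exact mk_eq_mk.2 ⟨u, rfl, rfl⟩) a.2
  left_inv := ind fun ω x => rfl
  right_inv := by
    rintro ⟨i, a⟩
    induction a using ind
    rfl
  map_smul' a := ind fun ω x => rfl

/-- Distributivity on the right. -/
def sigmaRight {ι : Type u} {X : ι → Type u} [∀ i, MulAction G₂ (X i)] :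
    GEquiv A (Amalg α β Ω (Σ i, X i)) (Σ i, Amalg α β Ω (X i)) where
  toFun := lift (fun ω x => ⟨x.1, mk ω x.2⟩) (by
    rintro ω ⟨i, x⟩ u
    simp only [Sigma.smul_mk]
    congr 1
    exact mk_eq_mk.2 ⟨u, rfl, rfl⟩)
  invFun a := lift (fun ω x => mk ω ⟨a.1, x⟩) (by
    intro ω x u
    exact mk_eq_mk.2 ⟨u, rfl, rfl⟩) a.2
  left_inv := ind fun ω x => rfl
  right_inv := by
    rintro ⟨i, a⟩
    induction a using ind
    rfl
  map_smul' a := ind fun ω x => rfl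

end Amalg

end Amalgamation

namespace Burn

/-- The bilinear map induced by the amalgamation of sets. -/
def amalg {A H G₁ G₂ : Type u} [Group A] [Group H] [Group G₁] [Group G₂]
    (α : A × H →* G₁) (β : A × H →* G₂) : Burn G₁ →ₗ[ℤ] Burn G₂ →ₗ[ℤ] Burn A :=
  ext2 fun K L => cls A (Amalg α β (G₁ ⧸ K) (G₂ ⧸ L))

theorem amalg_cls {A H G₁ G₂ : Type u} [Group A] [Group H] [Group G₁] [Group G₂]
    [Finite G₁] [Finite G₂] (α : A × H →* G₁) (β : A × H →* G₂) (Ω X : Type u)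
    [MulAction G₁ Ω] [MulAction G₂ X] [Finite Ω] [Finite X] :
    amalg α β (cls G₁ Ω) (cls G₂ X) = cls A (Amalg α β Ω X) := by
  have h := ext2_cls (G := G₁) (H := G₂) (M := Burn A)
    (fun Ω X [MulAction G₁ Ω] [MulAction G₂ X] => cls A (Amalg α β Ω X)) ?_ ?_ ?_ Ω X
  · exact h
  · intro X X' Y Y' _ _ _ _ e f
    exact cls_congr (Amalg.congr e f)
  · intro ι _ X _ _ Y _ _
    rw [← cls_sigma]
    exact cls_congr Amalg.sigmaLeft
  · intro ι _ X _ _ Y _ _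
    rw [← cls_sigma]
    exact cls_congr Amalg.sigmaRight

section Composition

variable {G H K L : Type u} [Group G] [Group H] [Group K] [Group L]

/-- The homomorphism `((g, k), h) ↦ (g, h)`. -/
def outerLeft (G H K : Type u) [Group G] [Group H] [Group K] : (G × K) × H →* G × H where
  toFun a := (a.1.1, a.2)
  map_one' := rfl
  map_mul' _ _ := rfl

/-- The homomorphism `((g, k), h) ↦ (h, k)`. -/
def outerRight (G H K : Type u) [Group G] [Group H] [Group K] : (G × K) × H →* H × K where
  toFun a := (a.2, a.1.2)
  map_one' := rfl
  map_mul' _ _ := rfl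

/-- For a `G × H`-set `Ω` and an `H × K`-set `Ω'`, the `G × K`-set `Ω ×_H Ω'` of the orbits of `H`
on `Ω × Ω'` for the action `u • (ω, ω') = ((1, u) • ω, (u, 1) • ω')`, with
`(g, k) • [ω, ω'] = [(g, 1) • ω, (1, k) • ω']`. -/
abbrev BTensor (G H K : Type u) [Group G] [Group H] [Group K] (Ω Ω' : Type u)
    [MulAction (G × H) Ω] [MulAction (H × K) Ω'] : Type u :=
  Amalg (outerLeft G H K) (outerRight G H K) Ω Ω'

/-- For a `G × H`-set `Ω` and an `H`-set `X`, the `G`-set `Ω ×_H X` of the orbits of `H` on `Ω × X`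
for the action `u • (ω, x) = ((1, u) • ω, u • x)`, with `g • [ω, x] = [(g, 1) • ω, x]`: the image
of `X` under the functor determined by `Ω`. -/
abbrev ATensor (G H : Type u) [Group G] [Group H] (Ω X : Type u)
    [MulAction (G × H) Ω] [MulAction H X] : Type u :=
  Amalg (MonoidHom.id (G × H)) (MonoidHom.snd G H) Ω X

/-- The bilinear map induced by `(Ω, Ω') ↦ Ω ×_H Ω'`, that is, by the composition of the functors
determined by bisets. -/
def comp : Burn (G × H) →ₗ[ℤ] Burn (H × K) →ₗ[ℤ] Burn (G × K) :=
  ext2 fun D E => cls (G × K) (BTensor G H K ((G × H) ⧸ D) ((H × K) ⧸ E))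

/-- The bilinear map induced by `(Ω, X) ↦ Ω ×_H X`: the action of `Burn (G × H)` by functors from
`H`-sets to `G`-sets. -/
def act : Burn (G × H) →ₗ[ℤ] Burn H →ₗ[ℤ] Burn G :=
  ext2 fun D E => cls G (ATensor G H ((G × H) ⧸ D) (H ⧸ E))

theorem comp_cls [Finite G] [Finite H] [Finite K] (Ω Ω' : Type u) [MulAction (G × H) Ω]
    [MulAction (H × K) Ω'] [Finite Ω] [Finite Ω'] :
    comp (cls (G × H) Ω) (cls (H × K) Ω') = cls (G × K) (BTensor G H K Ω Ω') :=
  amalg_cls _ _ Ω Ω'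

theorem act_cls [Finite G] [Finite H] (Ω X : Type u) [MulAction (G × H) Ω]
    [MulAction H X] [Finite Ω] [Finite X] :
    act (cls (G × H) Ω) (cls H X) = cls G (ATensor G H Ω X) :=
  amalg_cls _ _ Ω X

/-- The `G × K`-sets `(Ω ×_H Ω') ×_K Ω''` and `Ω ×_H (Ω' ×_K Ω'')` are isomorphic. -/
def tensorAssoc (Ω Ω' Ω'' : Type u) [MulAction (G × H) Ω] [MulAction (H × K) Ω']
    [MulAction (K × L) Ω''] : GEquiv (G × L) (BTensor G K L (BTensor G H K Ω Ω') Ω'')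
      (BTensor G H L Ω (BTensor H K L Ω' Ω'')) where
  toFun := Amalg.lift (fun a x => Amalg.lift (fun ω ω' => Amalg.mk ω (Amalg.mk ω' x)) (by
      intro ω ω' u
      refine Amalg.mk_eq_mk.2 ⟨u, rfl, ?_⟩
      change Amalg.mk ((u, (1 : K)) • ω') x =
        Amalg.mk ((u, (1 : K)) • ω') ((1 : K × L) • x)
      rw [one_smul]) a) (by
    intro a x u
    induction a using Amalg.ind
    rename_i ω ω'
    change Amalg.mk ω (Amalg.mk ω' x) = Amalg.mk ((1 : G × H) • ω)
      (Amalg.mk (((1 : H), u) • ω') ((u, (1 : L)) • x))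
    rw [one_smul]
    congr 1
    exact Amalg.mk_eq_mk.2 ⟨u, rfl, rfl⟩)
  invFun := Amalg.lift (fun ω a => Amalg.lift (fun ω' x => Amalg.mk (Amalg.mk ω ω') x) (by
      intro ω' x u
      refine Amalg.mk_eq_mk.2 ⟨u, ?_, rfl⟩
      change Amalg.mk ω (((1 : H), u) • ω') =
        Amalg.mk ((1 : G × H) • ω) (((1 : H), u) • ω')
      rw [one_smul]) a) (by
    intro ω a u
    induction a using Amalg.ind
    rename_i ω' x
    change Amalg.mk (Amalg.mk ω ω') x = Amalg.mk (Amalg.mk (((1 : G), u) • ω) ((u, (1 : K)) • ω'))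
      ((1 : K × L) • x)
    rw [one_smul]
    congr 1
    exact Amalg.mk_eq_mk.2 ⟨u, rfl, rfl⟩)
  left_inv := by
    intro a
    induction a using Amalg.ind
    rename_i a x
    induction a using Amalg.ind
    rfl
  right_inv := by
    intro a
    induction a using Amalg.ind
    rename_i x a
    induction a using Amalg.ind
    rfl
  map_smul' g := by
    intro a
    induction a using Amalg.ind
    rename_i a x
    induction a using Amalg.ind
    rfl

theorem comp_assoc [Finite G] [Finite H] [Finite K] [Finite L] (a : Burn (G × H))
    (b : Burn (H × K)) (c : Burn (K × L)) : comp (comp a b) c = comp a (comp b c) := by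
  induction a using induction_on with
  | zero => simp only [map_zero, LinearMap.zero_apply]
  | add a a' h h' => simp only [map_add, LinearMap.add_apply, h, h']
  | neg a h => simp only [map_neg, LinearMap.neg_apply, h]
  | basis q =>
  induction b using induction_on with
  | zero => simp only [map_zero, LinearMap.zero_apply]
  | add a a' h h' => simp only [map_add, LinearMap.add_apply, h, h']
  | neg a h => simp only [map_neg, LinearMap.neg_apply, h]
  | basis r =>
  induction c using induction_on with
  | zero => simp only [map_zero]
  | add a a' h h' => simp only [map_add, h, h']
  | neg a h => simp only [map_neg, h]
  | basis s =>
  rw [← cls_out q, ← cls_out r, ← cls_out s, comp_cls, comp_cls, comp_cls, comp_cls]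
  exact cls_congr (tensorAssoc _ _ _)

end Composition

/-- For a homomorphism `φ : Q → P`, the `Q × P`-set `P` with `(q, u) • v = φ q * v * u⁻¹`; it
determines the restriction functor from `P`-sets to `Q`-sets. -/
@[ext]
structure ResSet {Q P : Type u} [Group Q] [Group P] (φ : Q →* P) : Type u where
  val : P

section ResSet

variable {Q P K : Type u} [Group Q] [Group P] [Group K]

instance (φ : Q →* P) : MulAction (Q × P) (ResSet φ) where
  smul a v := ⟨φ a.1 * v.val * a.2⁻¹⟩
  one_smul v := by ext; change φ 1 * v.val * 1⁻¹ = v.val; simp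
  mul_smul a b v := by
    ext
    change φ (a.1 * b.1) * v.val * (a.2 * b.2)⁻¹ = φ a.1 * (φ b.1 * v.val * b.2⁻¹) * a.2⁻¹
    simp [mul_assoc]

instance [Finite P] (φ : Q →* P) : Finite (ResSet φ) :=
  Finite.of_injective ResSet.val fun _ _ h => ResSet.ext h

theorem resSet_smul (φ : Q →* P) (a : Q × P) (v : ResSet φ) :
    a • v = ⟨φ a.1 * v.val * a.2⁻¹⟩ := rfl

/-- The element `res_φ` determined by the restriction through `φ`. -/
def res (φ : Q →* P) : Burn (Q × P) := cls (Q × P) (ResSet φ)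

/-- The identity functor is a left unit. -/
def idTensor (Ω : Type u) [MulAction (P × K) Ω] :
    GEquiv (P × K) (BTensor P P K (ResSet (MonoidHom.id P)) Ω) Ω where
  toFun := Amalg.lift (fun v ω => (v.val, (1 : K)) • ω) (by
    intro v ω u
    change (v.val, (1 : K)) • ω = ((1 : P) * v.val * u⁻¹, (1 : K)) • ((u, (1 : K)) • ω)
    rw [← mul_smul]; simp)
  invFun ω := Amalg.mk ⟨1⟩ ω
  left_inv := by
    intro a
    induction a using Amalg.ind
    rename_i v ω
    refine Amalg.mk_eq_mk.2 ⟨v.val⁻¹, ?_, ?_⟩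
    · ext
      change v.val = (1 : P) * 1 * (v.val⁻¹)⁻¹
      simp
    · change ω = (v.val⁻¹, (1 : K)) • (v.val, (1 : K)) • ω
      rw [← mul_smul, Prod.mk_mul_mk, inv_mul_cancel, one_mul]
      exact (one_smul (P × K) ω).symm
  right_inv ω := one_smul (P × K) ω
  map_smul' g := by
    intro a
    induction a using Amalg.ind
    rename_i v ω
    change (g.1 * v.val * (1 : P)⁻¹, (1 : K)) • (((1 : P), g.2) • ω) = g • (v.val, (1 : K)) • ω
    rw [← mul_smul, ← mul_smul]
    congr 1
    simp [Prod.ext_iff]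

/-- The identity functor is a right unit. -/
def tensorId (Ω : Type u) [MulAction (K × P) Ω] :
    GEquiv (K × P) (BTensor K P P Ω (ResSet (MonoidHom.id P))) Ω where
  toFun := Amalg.lift (fun ω v => ((1 : K), v.val⁻¹) • ω) (by
    intro ω v u
    change ((1 : K), v.val⁻¹) • ω = ((1 : K), (u * v.val * 1⁻¹)⁻¹) • (((1 : K), u) • ω)
    rw [← mul_smul]; simp)
  invFun ω := Amalg.mk ω ⟨1⟩
  left_inv := by
    intro a
    induction a using Amalg.ind
    rename_i ω v
    refine Amalg.mk_eq_mk.2 ⟨v.val, ?_, ?_⟩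
    · change ω = ((1 : K), v.val) • ((1 : K), v.val⁻¹) • ω
      rw [← mul_smul, Prod.mk_mul_mk, mul_inv_cancel, one_mul]
      exact (one_smul (K × P) ω).symm
    · ext
      change v.val = v.val * 1 * (1 : P)⁻¹
      simp
  right_inv ω := by
    change ((1 : K), (1 : P)⁻¹) • ω = ω
    rw [inv_one]
    exact one_smul (K × P) ω
  map_smul' g := by
    intro a
    induction a using Amalg.ind
    rename_i ω v
    change ((1 : K), (1 * v.val * g.2⁻¹)⁻¹) • ((g.1, (1 : P)) • ω) = g • ((1 : K), v.val⁻¹) • ω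
    rw [← mul_smul, ← mul_smul]
    congr 1
    simp [Prod.ext_iff]

theorem res_id_comp [Finite P] [Finite K] (a : Burn (P × K)) :
    comp (res (MonoidHom.id P)) a = a := by
  induction a using induction_on with
  | zero => simp only [map_zero]
  | add a a' h h' => simp only [map_add, h, h']
  | neg a h => simp only [map_neg, h]
  | basis q =>
  rw [← cls_out q, res, comp_cls]
  exact cls_congr (idTensor _)

theorem comp_res_id [Finite P] [Finite K] (a : Burn (K × P)) :
    comp a (res (MonoidHom.id P)) = a := by
  induction a using induction_on with
  | zero => simp only [map_zero, LinearMap.zero_apply]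
  | add a a' h h' => simp only [map_add, LinearMap.add_apply, h, h']
  | neg a h => simp only [map_neg, LinearMap.neg_apply, h]
  | basis q =>
  rw [← cls_out q, res, comp_cls]
  exact cls_congr (tensorId _)

end ResSet

/-- The opposite of a `G × H`-set: the `H × G`-set obtained by exchanging the factors. -/
@[ext]
structure OppSet (G H Ω : Type u) : Type u where
  val : Ω

instance {G H Ω : Type u} [Group G] [Group H] [MulAction (G × H) Ω] :
    MulAction (H × G) (OppSet G H Ω) where
  smul a ω := ⟨(a.2, a.1) • ω.val⟩
  one_smul ω := OppSet.ext (one_smul (G × H) ω.val)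
  mul_smul a b ω := OppSet.ext (mul_smul (a.2, a.1) (b.2, b.1) ω.val)

/-- The linear map `t`, `f ↦ f°`, induced by the opposite of bisets. -/
def opp {G H : Type u} [Group G] [Group H] : Burn (G × H) →ₗ[ℤ] Burn (H × G) :=
  ext1 fun D => cls (H × G) (OppSet G H ((G × H) ⧸ D))

/-- For a `P`-set `X`, the `P × P`-set `X × P` with `(a, b) • (x, v) = (a • x, a * v * b⁻¹)`; it
determines the functor `Y ↦ X × Y` from `P`-sets to `P`-sets. -/
@[ext]
structure MulSet (P X : Type u) : Type u where
  pt : X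
  val : P

instance {P X : Type u} [Group P] [MulAction P X] : MulAction (P × P) (MulSet P X) where
  smul a z := ⟨a.1 • z.pt, a.1 * z.val * a.2⁻¹⟩
  one_smul z := by
    ext
    · exact one_smul P z.pt
    · change (1 : P) * z.val * (1 : P)⁻¹ = z.val
      simp
  mul_smul a b z := by
    ext
    · exact mul_smul a.1 b.1 z.pt
    · change (a.1 * b.1) * z.val * (a.2 * b.2)⁻¹ = a.1 * (b.1 * z.val * b.2⁻¹) * a.2⁻¹
      simp [mul_assoc]

instance {P X : Type u} [Finite P] [Finite X] : Finite (MulSet P X) :=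
  Finite.of_injective (fun z => (z.pt, z.val)) fun _ _ h =>
    MulSet.ext (congrArg Prod.fst h) (congrArg Prod.snd h)

/-- The map `m^P`, sending the class of a `P`-set `X` to the class of the functor `Y ↦ X × Y`. -/
def mulMap (P : Type u) [Group P] : Burn P →ₗ[ℤ] Burn (P × P) :=
  ext1 fun K => cls (P × P) (MulSet P (P ⧸ K))

end Burn

/-- The double Burnside algebra of `P`: the free `ℤ`-module over the isomorphism classes of
indecomposable `P × P`-sets, with the product induced by the composition `Ω ×_P Ω'`. -/
def DBurn (P : Type u) [Group P] : Type u := Burn (P × P)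

namespace DBurn

variable {P : Type u} [Group P]

instance : AddCommGroup (DBurn P) := inferInstanceAs (AddCommGroup (Burn (P × P)))

/-- The identification of the double Burnside algebra with `Burn (P × P)` as a module. -/
def toBurn : DBurn P ≃ₗ[ℤ] Burn (P × P) := LinearEquiv.refl ℤ (Burn (P × P))

instance : Mul (DBurn P) := ⟨fun a b => toBurn.symm (Burn.comp (toBurn a) (toBurn b))⟩

/-- The unit is the class of the `P × P`-set `P`, that is, of the identity functor. -/
instance : One (DBurn P) := ⟨toBurn.symm (Burn.res (MonoidHom.id P))⟩

theorem mul_def (a b : DBurn P) : a * b = toBurn.symm (Burn.comp (toBurn a) (toBurn b)) := rfl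

theorem one_def : (1 : DBurn P) = toBurn.symm (Burn.res (MonoidHom.id P)) := rfl

instance [Finite P] : Ring (DBurn P) where
  left_distrib a b c := by simp only [mul_def, map_add]
  right_distrib a b c := by simp only [mul_def, map_add, LinearMap.add_apply]
  zero_mul a := by simp only [mul_def, map_zero, LinearMap.zero_apply]
  mul_zero a := by simp only [mul_def, map_zero]
  mul_assoc a b c := by
    simp only [mul_def, LinearEquiv.apply_symm_apply, Burn.comp_assoc]
  one_mul a := by
    simp only [mul_def, one_def, LinearEquiv.apply_symm_apply, Burn.res_id_comp,
      LinearEquiv.symm_apply_apply]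
  mul_one a := by
    simp only [mul_def, one_def, LinearEquiv.apply_symm_apply, Burn.comp_res_id,
      LinearEquiv.symm_apply_apply]
  zsmul := (· • ·)
  zsmul_zero' := zero_zsmul
  zsmul_succ' n a := SubNegMonoid.zsmul_succ' n a
  zsmul_neg' n a := SubNegMonoid.zsmul_neg' n a
  neg_add_cancel := neg_add_cancel
  nsmul := (· • ·)
  nsmul_zero := zero_nsmul
  nsmul_succ n a := succ_nsmul a n
  sub_eq_add_neg := sub_eq_add_neg

end DBurn

/-! ### Divisible and Frobenius `P`-categories -/

/-- A divisible `P`-category: a subcategory of the category of finite groups, with the subgroups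
of `P` as objects, whose morphisms are injective, which contains all the homomorphisms between
subgroups of `P` induced by conjugation by elements of `P`, and such that a group homomorphism
`θ : R → Q` is a morphism as soon as `φ` and `φ ∘ θ` are morphisms for some `φ : Q → T`. -/
structure DivisibleCategory (P : Type u) [Group P] where
  /-- `Hom Q R` is the set of morphisms from `Q` to `R`. -/
  Hom : (Q R : Subgroup P) → Set (Q →* R)
  id_mem : ∀ Q, MonoidHom.id Q ∈ Hom Q Q
  comp_mem : ∀ {Q R T : Subgroup P} {ψ : R →* T} {φ : Q →* R},
    ψ ∈ Hom R T → φ ∈ Hom Q R → ψ.comp φ ∈ Hom Q T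
  injective : ∀ {Q R : Subgroup P} {φ : Q →* R}, φ ∈ Hom Q R → Function.Injective φ
  conj_mem : ∀ {Q R : Subgroup P} (φ : Q →* R) (x : P),
    (∀ u : Q, (φ u : P) = x * u * x⁻¹) → φ ∈ Hom Q R
  divisible : ∀ {Q R T : Subgroup P} {φ : Q →* T} (θ : R →* Q),
    φ ∈ Hom Q T → φ.comp θ ∈ Hom R T → θ ∈ Hom R Q

namespace DivisibleCategory

variable {P : Type u} [Group P] (F : DivisibleCategory P)

/-- A homomorphism `φ : Q → P` that is a morphism of the category (with target the object `P`). -/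
def IsMor {Q : Subgroup P} (φ : Q →* P) : Prop :=
  (Subgroup.topEquiv (G := P)).symm.toMonoidHom.comp φ ∈ F.Hom Q ⊤

/-- The group `F(Q)` of automorphisms of an object `Q`. -/
def aut (Q : Subgroup P) : Subgroup (MulAut Q) where
  carrier := {σ | σ.toMonoidHom ∈ F.Hom Q Q}
  mul_mem' {σ τ} hσ hτ := F.comp_mem (φ := τ.toMonoidHom) (ψ := σ.toMonoidHom) hσ hτ
  one_mem' := F.id_mem Q
  inv_mem' {σ} hσ := by
    refine F.divisible (φ := σ.toMonoidHom) _ hσ ?_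
    convert F.id_mem Q
    ext u
    exact congrArg Subtype.val (σ.apply_symm_apply u)

end DivisibleCategory

/-- The group `F_P(Q)` of automorphisms of `Q` induced by conjugation by elements of `P`. -/
def conjAut {P : Type u} [Group P] (Q : Subgroup P) : Subgroup (MulAut Q) :=
  (Subgroup.normalizerMonoidHom Q).range

/-- For an injective homomorphism `φ : Q → P`, the converse image in `N_P(Q)` of the intersection
of `F_P(Q)` with the image of `F_P(φ(Q))` in `Aut(Q)` by the inverse of `Q ≅ φ(Q)`: the elements
`x` of `N_P(Q)` such that for some `y ∈ N_P(φ(Q))` one has `φ (x u x⁻¹) = y (φ u) y⁻¹` for all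
`u ∈ Q`. -/
def extDomain {P : Type u} [Group P] {Q : Subgroup P} (φ : Q →* P) : Subgroup P where
  carrier := {x | x ∈ Subgroup.normalizer (Q : Set P) ∧
    ∃ y ∈ Subgroup.normalizer (φ.range : Set P),
      ∀ u v : Q, (v : P) = x * u * x⁻¹ → φ v = y * φ u * y⁻¹}
  one_mem' := ⟨one_mem _, 1, one_mem _, fun u v h => by
    have : v = u := Subtype.ext (by simpa using h)
    simp [this]⟩
  mul_mem' := by
    rintro x x' ⟨hx, y, hy, h⟩ ⟨hx', y', hy', h'⟩
    refine ⟨mul_mem hx hx', y * y', mul_mem hy hy', fun u v huv => ?_⟩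
    have hw := (Subgroup.mem_normalizer_iff.1 hx' u).1 u.2
    rw [h ⟨_, hw⟩ v (by rw [huv]; group), h' u ⟨_, hw⟩ rfl]
    group
  inv_mem' := by
    rintro x ⟨hx, y, hy, h⟩
    refine ⟨inv_mem hx, y⁻¹, inv_mem hy, fun u v huv => ?_⟩
    rw [h v u (by rw [huv]; group)]
    group

theorem le_extDomain {P : Type u} [Group P] {Q : Subgroup P} (φ : Q →* P) : Q ≤ extDomain φ := by
  intro x hx
  refine ⟨Subgroup.le_normalizer hx, φ ⟨x, hx⟩, Subgroup.le_normalizer ⟨_, rfl⟩, fun u v h => ?_⟩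
  have : v = ⟨x, hx⟩ * u * ⟨x, hx⟩⁻¹ := Subtype.ext h
  rw [this]; simp

namespace DivisibleCategory

variable {P : Type u} [Group P] (F : DivisibleCategory P)

/-- `F` is a Frobenius `P`-category when `F_P(P)` is a Sylow `p`-subgroup of `F(P)` and any
morphism `φ : Q → P` such that `ζ(C_P(φ(Q))) = C_P(ζ(φ(Q)))` for every morphism
`ζ : φ(Q) C_P(φ(Q)) → P` can be extended to a morphism from `extDomain φ` to `P`. -/
structure IsFrobenius (p : ℕ) : Prop where
  sylow : ∃ S : Sylow p (F.aut ⊤), (S : Subgroup (F.aut ⊤)) = (conjAut ⊤).subgroupOf (F.aut ⊤)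
  extend : ∀ (Q : Subgroup P) (φ : Q →* P), F.IsMor φ →
    (∀ ζ : (φ.range ⊔ Subgroup.centralizer (φ.range : Set P) : Subgroup P) →* P, F.IsMor ζ →
      ((Subgroup.centralizer (φ.range : Set P)).subgroupOf
          (φ.range ⊔ Subgroup.centralizer (φ.range : Set P))).map ζ =
        Subgroup.centralizer ((φ.range.subgroupOf
          (φ.range ⊔ Subgroup.centralizer (φ.range : Set P))).map ζ : Set P)) →
    ∃ ψ : extDomain φ →* P, F.IsMor ψ ∧ ψ.comp (Subgroup.inclusion (le_extDomain φ)) = φ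

end DivisibleCategory

/-- The subgroup `Δ_φ(Q) = {(φ u, u) | u ∈ Q}` of `P × P`. -/
def graphSubgroup {P : Type u} [Group P] {Q : Subgroup P} (φ : Q →* P) : Subgroup (P × P) :=
  (φ.prod Q.subtype).range

theorem mem_graphSubgroup {P : Type u} [Group P] {Q : Subgroup P} {φ : Q →* P} {a : P × P} :
    a ∈ graphSubgroup φ ↔ ∃ h : a.2 ∈ Q, φ ⟨a.2, h⟩ = a.1 := by
  constructor
  · rintro ⟨u, rfl⟩
    exact ⟨u.2, rfl⟩
  · rintro ⟨h, h'⟩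
    exact ⟨⟨a.2, h⟩, Prod.ext h' rfl⟩

/-- The isomorphism class `f_{Q,φ}` of the `P × P`-set `(P × P) ⧸ Δ_φ(Q)`. -/
def indecElt {P : Type u} [Group P] {Q : Subgroup P} (φ : Q →* P) : DBurn P :=
  DBurn.toBurn.symm (Burn.cls (P × P) ((P × P) ⧸ graphSubgroup φ))

namespace DivisibleCategory

variable {P : Type u} [Group P] (F : DivisibleCategory P)

/-- `D = Δ_φ(Q)` for some morphism `φ : Q → P`. -/
def IsGraph (D : Subgroup (P × P)) : Prop :=
  ∃ (Q : Subgroup P) (φ : Q →* P), F.IsMor φ ∧ D = graphSubgroup φ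

variable {F} in
theorem isMor_comp {Q R : Subgroup P} {φ : Q →* P} {ψ : R →* Q} (hφ : F.IsMor φ)
    (hψ : ψ ∈ F.Hom R Q) : F.IsMor (φ.comp ψ) := F.comp_mem hφ hψ

theorem isMor_subtype (Q : Subgroup P) : F.IsMor Q.subtype :=
  F.conj_mem _ 1 fun u => by simp

variable {F} in
theorem isGraph_star {D E C : Subgroup (P × P)} (hD : F.IsGraph D) (hE : F.IsGraph E)
    (h : ∀ a b : P, (a, b) ∈ C ↔ ∃ u, (a, u) ∈ D ∧ (u, b) ∈ E) : F.IsGraph C := by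
  obtain ⟨Q, φ, hφ, rfl⟩ := hD
  obtain ⟨R, ψ, hψ, rfl⟩ := hE
  let U : Subgroup P := (Q.comap ψ).map R.subtype
  have hUR : U ≤ R := by rintro _ ⟨u, _, rfl⟩; exact u.2
  have hU : ∀ u : U, ψ (Subgroup.inclusion hUR u) ∈ Q := by
    rintro ⟨_, v, hv, rfl⟩
    exact hv
  let ψ' : U →* Q := (ψ.comp (Subgroup.inclusion hUR)).codRestrict Q hU
  have hι : Subgroup.inclusion hUR ∈ F.Hom U R := F.conj_mem _ 1 fun u => by simp
  have hψ' : ψ' ∈ F.Hom U Q := by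
    refine F.divisible ψ' (F.isMor_subtype Q) ?_
    exact isMor_comp hψ hι
  refine ⟨U, φ.comp ψ', isMor_comp hφ hψ', ?_⟩
  ext ⟨a, b⟩
  rw [h]
  simp only [mem_graphSubgroup]
  constructor
  · rintro ⟨u, ⟨hu, hua⟩, ⟨hb, hbu⟩⟩
    have hbU : b ∈ U := ⟨⟨b, hb⟩, by change ψ ⟨b, hb⟩ ∈ Q; rw [hbu]; exact hu, rfl⟩
    refine ⟨hbU, Eq.trans (congrArg φ ?_) hua⟩
    exact Subtype.ext hbu
  · rintro ⟨hb, hba⟩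
    exact ⟨ψ' ⟨b, hb⟩, ⟨(ψ' ⟨b, hb⟩).2, hba⟩, hUR hb, rfl⟩

theorem isGraph_conj (x : P) :
    F.IsGraph (graphSubgroup ((MulAut.conj x).toMonoidHom.comp (⊤ : Subgroup P).subtype)) :=
  ⟨⊤, _, F.conj_mem _ x fun _ => rfl, rfl⟩

variable {F} in
theorem isGraph_stabilizer {D : Subgroup (P × P)} (hD : F.IsGraph D) (ω : (P × P) ⧸ D) :
    F.IsGraph (MulAction.stabilizer (P × P) ω) := by
  induction ω using Quotient.inductionOn'
  rename_i g
  let C : Subgroup (P × P) := D.map (MulAut.conj ((1 : P), g.2)).toMonoidHom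
  have hC : F.IsGraph C := by
    refine isGraph_star hD (F.isGraph_conj g.2⁻¹) fun a b => ?_
    simp only [mem_graphSubgroup]
    constructor
    · rintro ⟨d, hd, he⟩
      refine ⟨d.2, ?_, trivial, ?_⟩
      · have : a = d.1 := by simpa using (congrArg Prod.fst he).symm
        rwa [this]
      · have : b = g.2 * d.2 * g.2⁻¹ := by simpa using (congrArg Prod.snd he).symm
        simp [this, mul_assoc]
    · rintro ⟨u, hu, _, he⟩
      refine ⟨(a, u), hu, ?_⟩
      simp at he
      simp [← he, mul_assoc]
  refine isGraph_star (F.isGraph_conj g.1) hC fun a b => ?_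
  rw [MulAction.mem_stabilizer_iff]
  change (((a, b) * g : P × P) : (P × P) ⧸ D) = (g : (P × P) ⧸ D) ↔ _
  rw [eq_comm, QuotientGroup.eq]
  simp only [mem_graphSubgroup]
  constructor
  · intro h
    refine ⟨g.1⁻¹ * a * g.1, ⟨trivial, by simp [mul_assoc]⟩, ⟨_, h, ?_⟩⟩
    ext <;> simp [mul_assoc]
  · rintro ⟨u, ⟨_, he⟩, d, hd, he'⟩
    have h1 : d.1 = u := by simpa using congrArg Prod.fst he'
    have h2 : g.2 * d.2 * g.2⁻¹ = b := by simpa using congrArg Prod.snd he'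
    have h3 : g.1 * u * g.1⁻¹ = a := by simpa using he
    have h4 : g⁻¹ * ((a, b) * g) = d := by
      ext
      · simp [← h3, ← h1, mul_assoc]
      · simp [← h2, mul_assoc]
    rw [h4]
    exact hd

/-- The `ℤ`-module freely generated by the classes `f_{Q,φ}`, with `φ : Q → P` a morphism. -/
def heckeModule : Submodule ℤ (DBurn P) :=
  Submodule.span ℤ {f | ∃ (Q : Subgroup P) (φ : Q →* P), F.IsMor φ ∧ f = indecElt φ}

theorem cls_mem_heckeModule {Ω : Type u} [MulAction (P × P) Ω] [Finite Ω]
    (h : ∀ ω : Ω, F.IsGraph (MulAction.stabilizer (P × P) ω)) :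
    DBurn.toBurn.symm (Burn.cls (P × P) Ω) ∈ F.heckeModule := by
  have : Finite (MulAction.orbitRel.Quotient (P × P) Ω) := Quotient.finite _
  let _ : Fintype (MulAction.orbitRel.Quotient (P × P) Ω) := Fintype.ofFinite _
  rw [Burn.cls, finsum_eq_sum_of_fintype, map_sum]
  refine Submodule.sum_mem _ fun ω _ => Submodule.subset_span ?_
  obtain ⟨Q, φ, hφ, hD⟩ := h (Quotient.out ω)
  exact ⟨Q, φ, hφ, by rw [indecElt, Burn.cls_quotient, hD]⟩

variable [Finite P]

theorem mul_mem_heckeModule {a b : DBurn P} (ha : a ∈ F.heckeModule) (hb : b ∈ F.heckeModule) :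
    a * b ∈ F.heckeModule := by
  induction ha using Submodule.span_induction with
  | zero => simp
  | add x y _ _ hx hy => rw [add_mul]; exact add_mem hx hy
  | smul n x _ hx => rw [smul_mul_assoc]; exact Submodule.smul_mem _ _ hx
  | mem x hx =>
  induction hb using Submodule.span_induction with
  | zero => simp
  | add x y _ _ hx hy => rw [mul_add]; exact add_mem hx hy
  | smul n x _ hx => rw [mul_smul_comm]; exact Submodule.smul_mem _ _ hx
  | mem y hy =>
  obtain ⟨Q, φ, hφ, rfl⟩ := hx
  obtain ⟨R, ψ, hψ, rfl⟩ := hy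
  rw [DBurn.mul_def, indecElt, indecElt, LinearEquiv.apply_symm_apply,
    LinearEquiv.apply_symm_apply, Burn.comp_cls]
  refine F.cls_mem_heckeModule fun ω => ?_
  induction ω using Amalg.ind
  rename_i ω ω'
  refine isGraph_star (isGraph_stabilizer ⟨Q, φ, hφ, rfl⟩ ω)
    (isGraph_stabilizer ⟨R, ψ, hψ, rfl⟩ ω') fun a b => ?_
  simp only [MulAction.mem_stabilizer_iff]
  rw [Amalg.smul_mk, Amalg.mk_eq_mk]
  change (∃ u : P, ω = ((1 : P), u) • (a, (1 : P)) • ω ∧ ω' = (u, (1 : P)) • ((1 : P), b) • ω') ↔ _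
  simp only [← mul_smul, Prod.mk_mul_mk, one_mul, mul_one]
  simp only [eq_comm]

theorem one_mem_heckeModule : (1 : DBurn P) ∈ F.heckeModule := by
  refine F.cls_mem_heckeModule fun v => ?_
  have h := F.isGraph_conj v.val
  convert h using 1
  ext ⟨a, b⟩
  rw [MulAction.mem_stabilizer_iff, Burn.resSet_smul, mem_graphSubgroup, Burn.ResSet.ext_iff]
  change a * v.val * b⁻¹ = v.val ↔ ∃ _ : b ∈ (⊤ : Subgroup P), v.val * b * v.val⁻¹ = a
  rw [mul_inv_eq_iff_eq_mul, ← eq_mul_inv_iff_mul_eq]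
  exact ⟨fun h => ⟨trivial, h.symm⟩, fun ⟨_, h⟩ => h.symm⟩

/-- The Hecke algebra of `F`. -/
def hecke : Subalgebra ℤ (DBurn P) where
  carrier := F.heckeModule
  mul_mem' := F.mul_mem_heckeModule
  add_mem' := F.heckeModule.add_mem
  algebraMap_mem' n := by
    rw [Algebra.algebraMap_eq_smul_one]
    exact F.heckeModule.smul_mem n F.one_mem_heckeModule

theorem mulMap_mem (s : Burn P) : DBurn.toBurn.symm (Burn.mulMap P s) ∈ F.hecke := by
  change _ ∈ F.heckeModule
  induction s using Burn.induction_on with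
  | zero => simp
  | add a b ha hb => rw [map_add, map_add]; exact add_mem ha hb
  | neg a ha => rw [map_neg, map_neg]; exact neg_mem ha
  | basis q =>
  rw [Burn.mulMap, Burn.ext1_basisElt]
  refine F.cls_mem_heckeModule fun z => ?_
  let Q : Subgroup P := MulAction.stabilizer P (z.val⁻¹ • z.pt)
  refine ⟨Q, (MulAut.conj z.val).toMonoidHom.comp Q.subtype, F.conj_mem _ z.val fun _ => rfl, ?_⟩
  ext ⟨a, b⟩
  rw [MulAction.mem_stabilizer_iff, mem_graphSubgroup, Burn.MulSet.ext_iff]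
  change a • z.pt = z.pt ∧ a * z.val * b⁻¹ = z.val ↔
    ∃ _ : b • (z.val⁻¹ • z.pt) = z.val⁻¹ • z.pt, z.val * b * z.val⁻¹ = a
  rw [mul_inv_eq_iff_eq_mul, ← eq_mul_inv_iff_mul_eq, exists_prop, eq_comm (a := a)]
  refine and_congr_left fun h => ?_
  rw [← h, mul_smul, mul_smul, smul_eq_iff_eq_inv_smul]

/-- The map `m^P`, which takes its values in the Hecke algebra. -/
def mulHecke : Burn P →ₗ[ℤ] F.hecke :=
  (DBurn.toBurn.symm.toLinearMap ∘ₗ Burn.mulMap P).codRestrict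
    (Subalgebra.toSubmodule F.hecke) F.mulMap_mem

/-- The evaluation `v_H : H → Burn P`, `f ↦ f(1)`, at the trivial `P`-set. -/
def eval : F.hecke →ₗ[ℤ] Burn P :=
  (Burn.act.flip 1) ∘ₗ DBurn.toBurn.toLinearMap ∘ₗ (Subalgebra.toSubmodule F.hecke).subtype

/-- The kernel `K_H` of the evaluation. -/
def kerEval : Submodule ℤ F.hecke := LinearMap.ker F.eval

/-- `H^F`: the elements `f` of the Hecke algebra such that `res_φ · f = res_ι · f` and
`res_φ · f° = res_ι · f°` for any subgroup `Q` of `P` and any morphism `φ : Q → P`, where `ι` is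
the inclusion of `Q` in `P`. -/
def heckeInv : Submodule ℤ F.hecke where
  carrier := {f | ∀ (Q : Subgroup P) (φ : Q →* P), F.IsMor φ →
    Burn.comp (Burn.res φ) (DBurn.toBurn (f : DBurn P)) =
      Burn.comp (Burn.res Q.subtype) (DBurn.toBurn (f : DBurn P)) ∧
    Burn.comp (Burn.res φ) (Burn.opp (DBurn.toBurn (f : DBurn P))) =
      Burn.comp (Burn.res Q.subtype) (Burn.opp (DBurn.toBurn (f : DBurn P)))}
  add_mem' {f g} hf hg Q φ hφ := by
    simp only [AddMemClass.coe_add, map_add, (hf Q φ hφ).1, (hf Q φ hφ).2, (hg Q φ hφ).1,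
      (hg Q φ hφ).2, and_self]
  zero_mem' Q φ hφ := by simp
  smul_mem' n f hf Q φ hφ := by
    simp only [SetLike.val_smul, map_smul, (hf Q φ hφ).1, (hf Q φ hφ).2, and_self]

/-- `(B_P)^F`: the elements `s` of the Burnside algebra such that `res_φ s = res_ι s` for any
subgroup `Q` of `P` and any morphism `φ : Q → P`, where `ι` is the inclusion of `Q` in `P`. -/
def burnInv : Submodule ℤ (Burn P) where
  carrier := {s | ∀ (Q : Subgroup P) (φ : Q →* P), F.IsMor φ →
    Burn.act (Burn.res φ) s = Burn.act (Burn.res Q.subtype) s}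
  add_mem' {f g} hf hg Q φ hφ := by simp only [map_add, hf Q φ hφ, hg Q φ hφ]
  zero_mem' Q φ hφ := by simp
  smul_mem' n f hf Q φ hφ := by simp only [map_smul, hf Q φ hφ]

end DivisibleCategory

instance isPrime_span_natCast (p : ℕ) [hp : Fact p.Prime] :
    (Ideal.span {(p : ℤ)}).IsPrime :=
  (Ideal.span_singleton_prime (by exact_mod_cast hp.out.ne_zero)).2
    (Nat.prime_iff_prime_int.1 hp.out)

end

/-
Elements of a Burnside algebra are determined by their marks, the numbers of fixed points of the
subgroups. For `f ∈ H^F` and `h ∈ H` stability gives `h f = m(v(h)) f`. Hence `K_H` annihilates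
`H^F` from the left and `v` is multiplicative on `H^F`; it is injective there since
`|P| mark_R (v f) = |F(P, R)| mark_{Δ(R)} f`.

A Sylow type argument with the extension property makes the marks of an element of `H` invariant
under `F` by descending induction on the order of the subgroups, which yields an `f ∈ H^F` with
`mark_P (v f) = [F(P) : F_P(P)]` prime to `p`. As all marks of a set with an action of a `p`-group
are congruent modulo `p`, the annihilating polynomial `∏ (X - mark_R (v f))` turns `f` into a
`w ∈ H^F` with `v w = n` prime to `p`. Then `e = w / n` is the unit of the localized `H^F`, the map
`s ↦ m(s) e` is inverse to `v`, and the localized `K_H + H^F` is the preimage of the localized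
`(B_P)^F` under `v`.
-/

noncomputable section

namespace Burn

section Marks

open MulAction

variable {G : Type u} [Group G]

/-- The set `X^K` of the points fixed by `K`. It is phrased by stabilizers, and not as
`fixedPoints K X`, since the action of `K` on a quotient `G ⧸ L` comes from two different
instances. -/
def fixSet (K : Subgroup G) (X : Type*) [MulAction G X] : Set X := {x | K ≤ stabilizer G x}

theorem mem_fixSet {K : Subgroup G} {X : Type*} [MulAction G X] {x : X} :
    x ∈ fixSet K X ↔ ∀ k ∈ K, k • x = x := Iff.rfl

theorem fixSet_eq_fixedPoints (K : Subgroup G) (X : Type*) [MulAction G X] :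
    fixSet K X = fixedPoints K X :=
  Set.ext fun _ => ⟨fun h k => h k.2, fun h k hk => h ⟨k, hk⟩⟩

theorem fixSet_of_subsingleton (K : Subgroup G) (X : Type*) [MulAction G X] [Subsingleton X] :
    fixSet K X = Set.univ :=
  Set.eq_univ_of_forall fun _ _ _ => Subsingleton.elim _ _

theorem card_fixSet_congr {H X Y : Type*} [Group H] [MulAction G X] [MulAction H Y]
    {K : Subgroup G} {L : Subgroup H} (e : X ≃ Y)
    (h : ∀ x, K ≤ stabilizer G x ↔ L ≤ stabilizer H (e x)) :
    Nat.card (fixSet K X) = Nat.card (fixSet L Y) :=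
  Nat.card_congr (e.subtypeEquiv h)

theorem stabilizer_gequiv {X Y : Type*} [MulAction G X] [MulAction G Y] (e : GEquiv G X Y)
    (x : X) : stabilizer G (e.toEquiv x) = stabilizer G x := by
  ext g
  simp only [mem_stabilizer_iff, ← e.map_smul, e.toEquiv.injective.eq_iff]

theorem card_fixSet_gequiv {X Y : Type*} [MulAction G X] [MulAction G Y] (K : Subgroup G)
    (e : GEquiv G X Y) : Nat.card (fixSet K X) = Nat.card (fixSet K Y) :=
  card_fixSet_congr e.toEquiv fun x => by rw [stabilizer_gequiv]

theorem stabilizer_sigma_mk {ι : Type*} {X : ι → Type*} [∀ i, MulAction G (X i)] (i : ι)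
    (x : X i) : stabilizer G (⟨i, x⟩ : Σ i, X i) = stabilizer G x := by
  ext g
  simp only [mem_stabilizer_iff, Sigma.smul_mk, Sigma.mk.injEq, heq_eq_eq, true_and]

theorem card_fixSet_sigma {ι : Type*} [Fintype ι] {X : ι → Type*} [∀ i, MulAction G (X i)]
    [∀ i, Finite (X i)] (K : Subgroup G) :
    Nat.card (fixSet K (Σ i, X i)) = ∑ i, Nat.card (fixSet K (X i)) := by
  rw [← Nat.card_sigma]
  exact Nat.card_congr
    { toFun x := ⟨x.1.1, x.1.2, le_of_le_of_eq x.2 (stabilizer_sigma_mk x.1.1 x.1.2)⟩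
      invFun x := ⟨⟨x.1, x.2.1⟩, le_of_le_of_eq x.2.2 (stabilizer_sigma_mk x.1 x.2.1).symm⟩
      left_inv _ := rfl
      right_inv _ := rfl }

/-- The mark (table-of-marks) homomorphism at a subgroup `K`: the number of fixed points of `K`,
extended linearly from `G`-sets to the Burnside module. -/
def mark (K : Subgroup G) : Burn G →ₗ[ℤ] ℤ :=
  ext1 fun L => (Nat.card (fixSet K (G ⧸ L)) : ℤ)

theorem mark_cls [Finite G] (K : Subgroup G) (X : Type u) [MulAction G X] [Finite X] :
    mark K (cls G X) = Nat.card (fixSet K X) :=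
  ext1_cls (fun X [MulAction G X] => (Nat.card (fixSet K X) : ℤ))
    (fun _ _ _ _ e => congrArg _ (card_fixSet_gequiv K e))
    (fun ι _ X _ _ => by rw [card_fixSet_sigma, Nat.cast_sum]) X

theorem hom_ext_cls {M : Type*} [AddCommGroup M] {φ ψ : Burn G →ₗ[ℤ] M}
    (h : ∀ K : Subgroup G, φ (cls G (G ⧸ K)) = ψ (cls G (G ⧸ K))) : φ = ψ :=
  hom_ext fun q => by rw [← cls_out q]; exact h _

theorem dvd_of_forall_dvd_cls (φ : Burn G →ₗ[ℤ] ℤ) {n : ℤ}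
    (h : ∀ K : Subgroup G, n ∣ φ (cls G (G ⧸ K))) (a : Burn G) : n ∣ φ a := by
  induction a using induction_on with
  | zero => simp
  | add a b ha hb => rw [map_add]; exact dvd_add ha hb
  | neg a ha => rw [map_neg]; exact ha.neg_right
  | basis q => rw [← cls_out q]; exact h _

theorem mk_mem_fixSet_quotient {K L : Subgroup G} {g : G} :
    (g : G ⧸ L) ∈ fixSet K (G ⧸ L) ↔ K.map (MulAut.conj g⁻¹).toMonoidHom ≤ L := by
  rw [Subgroup.map_le_iff_le_comap]
  refine forall₂_congr fun k _ => ?_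
  rw [mem_stabilizer_iff, eq_comm, Subgroup.mem_comap]
  change (g : G ⧸ L) = ((k * g : G) : G ⧸ L) ↔ g⁻¹ * k * g⁻¹⁻¹ ∈ L
  rw [QuotientGroup.eq, inv_inv, mul_assoc]

theorem indecClass_conj (g : G) (L : Subgroup G) :
    Quotient.mk (indecSetoid G) (L.map (MulAut.conj g).toMonoidHom) =
      Quotient.mk (indecSetoid G) L := by
  have h := mk_stabilizer_smul (X := G ⧸ L) g ((1 : G) : G ⧸ L)
  rwa [stabilizer_smul_eq_stabilizer_map_conj, stabilizer_quotient] at h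

variable [Finite G]

theorem mark_mul (K : Subgroup G) (a b : Burn G) : mark K (a * b) = mark K a * mark K b := by
  have h : (ext2 fun K L => cls G ((G ⧸ K) × (G ⧸ L))).compr₂ (mark K) =
      (LinearMap.mul ℤ ℤ).compl₁₂ (mark K) (mark K) := by
    refine hom_ext_cls fun L => hom_ext_cls fun L' => ?_
    simp only [LinearMap.compr₂_apply, LinearMap.compl₁₂_apply, LinearMap.mul_apply', ← mul_def,
      cls_mul_cls, mark_cls]
    rw [← Nat.cast_mul, ← Nat.card_prod]
    refine congrArg _ (Nat.card_congr <| (Equiv.subtypeEquivRight fun x => ?_).trans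
      Equiv.subtypeProdEquivProd)
    simp only [mem_fixSet, Prod.ext_iff, Prod.smul_fst, Prod.smul_snd, forall_and]
  exact LinearMap.congr_fun (LinearMap.congr_fun h a) b

theorem mark_one (K : Subgroup G) : mark K (1 : Burn G) = 1 := by
  have := QuotientGroup.subsingleton_quotient_top (G := G)
  rw [one_eq, mark_cls, fixSet_of_subsingleton, Nat.card_univ, Nat.card_unique, Nat.cast_one]

theorem mark_conj (g : G) (K : Subgroup G) (a : Burn G) :
    mark (K.map (MulAut.conj g).toMonoidHom) a = mark K a := by
  suffices h : mark (K.map (MulAut.conj g).toMonoidHom) = mark K by rw [h]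
  refine hom_ext_cls fun L => ?_
  rw [mark_cls, mark_cls, Nat.cast_inj]
  refine (card_fixSet_congr (toPerm g) fun x => ?_).symm
  rw [toPerm_apply, stabilizer_smul_eq_stabilizer_map_conj,
    Subgroup.map_le_map_iff_of_injective (MulAut.conj g).injective]

theorem exists_map_conj_le_of_mark_ne_zero {K L : Subgroup G}
    (h : mark K (cls G (G ⧸ L)) ≠ 0) : ∃ g : G, K.map (MulAut.conj g).toMonoidHom ≤ L := by
  rw [mark_cls, Nat.cast_ne_zero] at h
  obtain ⟨⟨x, hx⟩⟩ : Nonempty (fixSet K (G ⧸ L)) := (Nat.card_ne_zero.1 h).1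
  obtain ⟨g, rfl⟩ := QuotientGroup.mk_surjective x
  exact ⟨g⁻¹, mk_mem_fixSet_quotient.1 hx⟩

theorem indecClass_eq_of_mark_ne_zero {K L : Subgroup G} (h : mark K (cls G (G ⧸ L)) ≠ 0)
    (hcard : Nat.card L ≤ Nat.card K) :
    Quotient.mk (indecSetoid G) K = Quotient.mk (indecSetoid G) L := by
  obtain ⟨g, hg⟩ := exists_map_conj_le_of_mark_ne_zero h
  rw [← Subgroup.eq_of_le_of_card_ge hg
    (by rwa [Subgroup.card_map_of_injective (MulAut.conj g).injective]), indecClass_conj]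

theorem card_mul_mark_self (K : Subgroup G) :
    (Nat.card K : ℤ) * mark K (cls G (G ⧸ K)) = Nat.card (Subgroup.normalizer (K : Set G)) := by
  have hquot : Nat.card (fixSet K (G ⧸ K)) = (K.subgroupOf (Subgroup.normalizer K)).index := by
    rw [fixSet_eq_fixedPoints, Subgroup.index]
    exact Nat.card_congr (Sylow.fixedPointsMulLeftCosetsEquivQuotient K)
  rw [mark_cls, hquot, ← Subgroup.card_mul_index (K.subgroupOf (Subgroup.normalizer (K : Set G))),
    Nat.card_congr (Subgroup.subgroupOfEquivOfLe K.le_normalizer).toEquiv, Nat.cast_mul]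

theorem mark_self_ne_zero (K : Subgroup G) : mark K (cls G (G ⧸ K)) ≠ 0 := by
  refine right_ne_zero_of_mul (a := (Nat.card K : ℤ)) ?_
  rw [card_mul_mark_self]
  exact Nat.cast_ne_zero.2 Nat.card_pos.ne'

theorem mark_eq_sum (K : Subgroup G) (a : Burn G) :
    mark K a = Finsupp.sum (show IndecClass G →₀ ℤ from a) fun q n =>
      n * mark K (cls G (G ⧸ Quotient.out q)) := by
  simp only [mark_cls K (G ⧸ Quotient.out _)]
  rfl

/-- The matrix of marks is triangular with respect to the order of the subgroups. -/
theorem eq_zero_of_forall_mark {a : Burn G} (h : ∀ K, mark K a = 0) : a = 0 := by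
  by_contra ha
  let c : IndecClass G →₀ ℤ := a
  obtain ⟨q, hq, hmax⟩ := c.support.exists_max_image
    (fun q => Nat.card (Quotient.out q : Subgroup G)) (Finsupp.support_nonempty_iff.2 ha)
  have hsum : mark (Quotient.out q) a = c q * mark (Quotient.out q) (cls G (G ⧸ q.out)) := by
    rw [mark_eq_sum]
    refine Finset.sum_eq_single_of_mem q hq fun r hr hrq => ?_
    by_contra hne
    have := indecClass_eq_of_mark_ne_zero (right_ne_zero_of_mul hne) (hmax r hr)
    rw [Quotient.out_eq, Quotient.out_eq] at this
    exact hrq this.symm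
  rw [h] at hsum
  exact mul_ne_zero (Finsupp.mem_support_iff.1 hq) (mark_self_ne_zero _) hsum.symm

theorem ext_mark {a b : Burn G} (h : ∀ K, mark K a = mark K b) : a = b :=
  sub_eq_zero.1 (eq_zero_of_forall_mark fun K => by rw [map_sub, h, sub_self])

theorem card_fixSet_sup_zpowers {N X : Type*} [Group N] [MulAction N X] (D : Subgroup N)
    [D.Normal] (n : N) :
    Nat.card (fixSet (D ⊔ Subgroup.zpowers n) X) = Nat.card (fixedBy (fixedPoints D X) n) := by
  have hmem : ∀ x : X, x ∈ fixSet (D ⊔ Subgroup.zpowers n) X ↔ x ∈ fixSet D X ∧ n • x = x :=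
    fun x => by
      change _ ≤ stabilizer N x ↔ D ≤ stabilizer N x ∧ n ∈ stabilizer N x
      rw [sup_le_iff, Subgroup.zpowers_le]
  refine Nat.card_congr ((Equiv.subtypeEquivRight hmem).trans
    ((Equiv.subtypeSubtypeEquivSubtypeInter (· ∈ fixSet D X) (fun x => n • x = x)).symm.trans ?_))
  exact (Equiv.setCongr (fixSet_eq_fixedPoints D X)).subtypeEquiv fun _ =>
    ⟨fun h => Subtype.ext h, fun h => congrArg Subtype.val h⟩

/-- Burnside's orbit counting for the action of `N` on the fixed points of `D`. -/
theorem card_dvd_sum_mark {N : Type*} [Group N] [Fintype N] (χ : N →* G) (D : Subgroup N)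
    [D.Normal] (a : Burn G) :
    (Nat.card N : ℤ) ∣ ∑ n : N, mark ((D ⊔ Subgroup.zpowers n).map χ) a := by
  rw [← LinearMap.sum_apply]
  refine dvd_of_forall_dvd_cls _ (fun K => ?_) a
  let _ : MulAction N (G ⧸ K) := MulAction.compHom (G ⧸ K) χ
  classical
  let _ : Fintype (fixedPoints D (G ⧸ K)) := Fintype.ofFinite _
  let _ : Fintype (Quotient (orbitRel N (fixedPoints D (G ⧸ K)))) := Fintype.ofFinite _
  let _ : ∀ n : N, Fintype (fixedBy (fixedPoints D (G ⧸ K)) n) := fun n => Fintype.ofFinite _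
  have hmark : ∀ n : N, mark ((D ⊔ Subgroup.zpowers n).map χ) (cls G (G ⧸ K)) =
      Fintype.card (fixedBy (fixedPoints D (G ⧸ K)) n) := by
    intro n
    rw [mark_cls, ← Nat.card_eq_fintype_card, ← card_fixSet_sup_zpowers]
    exact congrArg _ (card_fixSet_congr (Equiv.refl _) fun x => Subgroup.map_le_iff_le_comap)
  rw [LinearMap.sum_apply, Finset.sum_congr rfl fun n _ => hmark n, ← Nat.cast_sum,
    sum_card_fixedBy_eq_card_orbits_mul_card_group, Nat.card_eq_fintype_card, Nat.cast_mul]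
  exact dvd_mul_left _ _

theorem dvd_mark_bot_sub_mark {p : ℕ} [Fact p.Prime] (hG : IsPGroup p G) (K : Subgroup G)
    (a : Burn G) : (p : ℤ) ∣ mark ⊥ a - mark K a := by
  refine dvd_of_forall_dvd_cls (mark ⊥ - mark K) (fun L => ?_) a
  have hbot : fixSet (⊥ : Subgroup G) (G ⧸ L) = Set.univ :=
    Set.eq_univ_of_forall fun _ => (bot_le : ⊥ ≤ stabilizer G _)
  rw [LinearMap.sub_apply, mark_cls, mark_cls, hbot, Nat.card_univ,
    fixSet_eq_fixedPoints]
  exact Nat.modEq_iff_dvd.1 ((hG.to_subgroup K).card_modEq_card_fixedPoints (G ⧸ L)).symm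

end Marks

section MarkPolynomial

open Polynomial

variable {G : Type u} [Group G] [Finite G]

theorem aeval_prod_X_sub_C_mark [Fintype (Subgroup G)] (a : Burn G) :
    aeval a (∏ K : Subgroup G, (X - C (mark K a))) = 0 := by
  classical
  refine eq_zero_of_forall_mark fun K => ?_
  rw [← Finset.mul_prod_erase _ _ (Finset.mem_univ K), map_mul, mark_mul, map_sub, aeval_X, aeval_C,
    map_sub, Algebra.algebraMap_eq_smul_one, map_smul, mark_one, smul_eq_mul, mul_one, sub_self,
    zero_mul]

theorem exists_mem_mul_eq_zsmul_one {p : ℕ} [Fact p.Prime] (hG : IsPGroup p G)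
    {S : Subalgebra ℤ (Burn G)} {a : Burn G} (ha : a ∈ S) (hap : ¬ (p : ℤ) ∣ mark ⊤ a) :
    ∃ n : ℤ, ¬ (p : ℤ) ∣ n ∧ ∃ b ∈ S, b * a = n • 1 := by
  cases nonempty_fintype (Subgroup G)
  let q : ℤ[X] := ∏ K : Subgroup G, (X - C (mark K a))
  have hq : aeval a q.divX * a + q.coeff 0 • 1 = 0 := by
    rw [← aeval_prod_X_sub_C_mark a, ← Algebra.algebraMap_eq_smul_one, ← aeval_C (A := Burn G) a]
    nth_rewrite 2 [← aeval_X (R := ℤ) a]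
    rw [← map_mul, ← map_add, divX_mul_X_add]
  refine ⟨-q.coeff 0, fun h => hap ?_, aeval a q.divX, ?_, ?_⟩
  · obtain ⟨K, -, hK⟩ : ∃ K ∈ Finset.univ, (p : ℤ) ∣ (X - C (mark K a)).eval 0 := by
      rwa [dvd_neg, coeff_zero_eq_eval_zero, eval_prod,
        (Nat.prime_iff_prime_int.1 Fact.out).dvd_finsetProd_iff] at h
    rw [eval_sub, eval_X, eval_C, zero_sub, dvd_neg] at hK
    have hbot := (dvd_sub_left hK).1 (dvd_mark_bot_sub_mark hG K a)
    exact (dvd_sub_right hbot).1 (dvd_mark_bot_sub_mark hG ⊤ a)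
  · exact Algebra.adjoin_le (Set.singleton_subset_iff.2 ha) (aeval_mem_adjoin_singleton ℤ a)
  · rw [neg_smul, eq_neg_iff_add_eq_zero, hq]

end MarkPolynomial

end Burn

namespace Amalg

section Trivialization

variable {A H G₁ G₂ : Type u} [Group A] [Group H] [Group G₁] [Group G₂]
  {α : A × H →* G₁} {β : A × H →* G₂} {Ω X : Type u} [MulAction G₁ Ω] [MulAction G₂ X]

/-- The symmetry of the amalgamation. -/
def swap : GEquiv A (Amalg α β Ω X) (Amalg β α X Ω) where
  toFun := lift (fun ω x => mk x ω) fun _ _ u => mk_eq_mk.2 ⟨u, rfl, rfl⟩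
  invFun := lift (fun x ω => mk ω x) fun _ _ u => mk_eq_mk.2 ⟨u, rfl, rfl⟩
  left_inv := ind fun _ _ => rfl
  right_inv := ind fun _ _ => rfl
  map_smul' _ := ind fun _ _ => rfl

/-- If `Ω ≃ B × H` is free over `H`, then every orbit of `H` on `Ω × X` has a unique
representative whose first component corresponds to an element of `B × {1}`. -/
def equivProd {B : Type*} (e : Ω ≃ B × H)
    (he : ∀ u ω, e (α (1, u) • ω) = ((e ω).1, (e ω).2 * u⁻¹)) : Amalg α β Ω X ≃ B × X where
  toFun := lift (fun ω x => ((e ω).1, β (1, (e ω).2) • x)) fun ω x u => by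
    rw [he, ← mul_smul, ← map_mul, Prod.mk_mul_mk, one_mul, inv_mul_cancel_right]
  invFun z := mk (e.symm (z.1, 1)) z.2
  left_inv := ind fun ω x => by
    refine (mk_eq_mk.2 ⟨(e ω).2, e.injective ?_, rfl⟩).symm
    change e (e.symm ((e ω).1, 1)) = _
    rw [Equiv.apply_symm_apply, he, mul_inv_cancel]
  right_inv z := by
    change ((e (e.symm (z.1, 1))).1, β (1, (e (e.symm (z.1, 1))).2) • z.2) = z
    rw [Equiv.apply_symm_apply, Prod.mk_one_one, map_one, one_smul]

theorem card_fixSet {G₃ B : Type*} [Group G₃] [MulAction G₃ B] (e : Ω ≃ B × H)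
    (he : ∀ u ω, e (α (1, u) • ω) = ((e ω).1, (e ω).2 * u⁻¹)) (l : A →* G₃) (r : A →* G₂)
    (hl : ∀ a ω, (e (α (a, 1) • ω)).1 = l a • (e ω).1)
    (hr : ∀ a ω, β (1, (e (α (a, 1) • ω)).2) * β (a, 1) = r a * β (1, (e ω).2))
    (D : Subgroup A) :
    Nat.card (Burn.fixSet D (Amalg α β Ω X)) =
      Nat.card (Burn.fixSet (D.map l) B) * Nat.card (Burn.fixSet (D.map r) X) := by
  have hsmul : ∀ a (y : Amalg α β Ω X), equivProd e he (a • y) =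
      (l a • (equivProd e he y).1, r a • (equivProd e he y).2) := fun a => ind fun ω x => by
    change ((e (α (a, 1) • ω)).1, β (1, (e (α (a, 1) • ω)).2) • β (a, 1) • x) =
      (l a • (e ω).1, r a • β (1, (e ω).2) • x)
    rw [hl, ← mul_smul, hr, mul_smul]
  rw [← Nat.card_prod]
  refine Nat.card_congr (((equivProd e he).subtypeEquiv
    (q := fun z => z.1 ∈ Burn.fixSet (D.map l) B ∧ z.2 ∈ Burn.fixSet (D.map r) X)
    fun y => ?_).trans Equiv.subtypeProdEquivProd)
  simp only [Burn.mem_fixSet, Subgroup.mem_map, forall_exists_index, and_imp,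
    forall_apply_eq_imp_iff₂, ← forall_and]
  refine forall₂_congr fun k _ => ?_
  rw [← (equivProd e he).injective.eq_iff, hsmul, Prod.ext_iff]

end Trivialization

end Amalg

namespace Burn

section Formulas

variable {G H K P Q : Type u} [Group G] [Group H] [Group K] [Group P] [Group Q]

theorem cls_eq_cls_quotient {X : Type u} [MulAction G X] {L : Subgroup G} (x : X)
    (hx : ∀ y, ∃ g : G, g • x = y) (hL : MulAction.stabilizer G x = L) :
    cls G X = cls G (G ⧸ L) := by
  subst hL
  exact (cls_congr ⟨Equiv.ofBijective (MulAction.ofQuotientStabilizer G x)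
    ⟨MulAction.injective_ofQuotientStabilizer G x, fun y =>
      (hx y).imp' QuotientGroup.mk fun _ h => h⟩,
    MulAction.ofQuotientStabilizer_smul G x⟩).symm

instance {Ω : Type u} [Finite Ω] : Finite (OppSet G H Ω) :=
  Finite.of_injective OppSet.val fun _ _ h => OppSet.ext h

theorem opp_cls [Finite G] [Finite H] (Ω : Type u) [MulAction (G × H) Ω] [Finite Ω] :
    opp (cls (G × H) Ω) = cls (H × G) (OppSet G H Ω) := by
  refine ext1_cls (fun Ω [MulAction (G × H) Ω] => cls (H × G) (OppSet G H Ω)) ?_ ?_ Ω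
  · intro X Y _ _ e
    exact cls_congr ⟨⟨fun x => ⟨e.toEquiv x.val⟩, fun x => ⟨e.toEquiv.symm x.val⟩,
      fun x => OppSet.ext (e.toEquiv.symm_apply_apply _),
      fun x => OppSet.ext (e.toEquiv.apply_symm_apply _)⟩,
      fun g x => OppSet.ext (e.map_smul (g.2, g.1) x.val)⟩
  · intro ι _ X _ _
    rw [← cls_sigma]
    exact cls_congr ⟨⟨fun x => ⟨x.val.1, ⟨x.val.2⟩⟩, fun x => ⟨⟨x.1, x.2.val⟩⟩,
      fun _ => rfl, fun _ => rfl⟩, fun _ _ => rfl⟩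

theorem mulMap_cls [Finite P] (X : Type u) [MulAction P X] [Finite X] :
    mulMap P (cls P X) = cls (P × P) (MulSet P X) := by
  refine ext1_cls (fun X [MulAction P X] => cls (P × P) (MulSet P X)) ?_ ?_ X
  · intro X Y _ _ e
    exact cls_congr ⟨⟨fun x => ⟨e.toEquiv x.pt, x.val⟩, fun x => ⟨e.toEquiv.symm x.pt, x.val⟩,
      fun x => MulSet.ext (e.toEquiv.symm_apply_apply _) rfl,
      fun x => MulSet.ext (e.toEquiv.apply_symm_apply _) rfl⟩,
      fun g x => MulSet.ext (e.map_smul g.1 x.pt) rfl⟩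
  · intro ι _ X _ _
    rw [← cls_sigma]
    exact cls_congr ⟨⟨fun x => ⟨x.pt.1, ⟨x.pt.2, x.val⟩⟩, fun x => ⟨⟨x.1, x.2.pt⟩, x.2.val⟩,
      fun _ => rfl, fun _ => rfl⟩, fun _ _ => rfl⟩

theorem mark_opp [Finite G] [Finite H] (D : Subgroup (H × G)) (f : Burn (G × H)) :
    mark D (opp f) = mark (D.map (MulEquiv.prodComm : H × G ≃* G × H).toMonoidHom) f := by
  suffices h : mark D ∘ₗ opp = mark (D.map (MulEquiv.prodComm : H × G ≃* G × H).toMonoidHom) from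
    LinearMap.congr_fun h f
  refine hom_ext_cls fun L => ?_
  rw [LinearMap.comp_apply, opp_cls, mark_cls, mark_cls, Nat.cast_inj]
  refine card_fixSet_congr ⟨OppSet.val, OppSet.mk, fun _ => rfl, fun _ => rfl⟩ fun x => ?_
  rw [Subgroup.map_le_iff_le_comap]
  exact forall₂_congr fun _ _ => OppSet.ext_iff

/-- A point of the `Q × P`-set `P`, seen as an element of `P`. -/
def resSetEquiv (φ : Q →* P) : ResSet φ ≃ Unit × P :=
  ⟨fun v => (⟨⟩, v.val), fun z => ⟨z.2⟩, fun _ => rfl, fun _ => rfl⟩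

theorem resSetEquiv_smul (φ : Q →* P) (u : P) (v : ResSet φ) :
    resSetEquiv φ (((1 : Q), u) • v) = ((resSetEquiv φ v).1, (resSetEquiv φ v).2 * u⁻¹) := by
  change ((), φ 1 * v.val * u⁻¹) = ((), v.val * u⁻¹)
  rw [map_one, one_mul]

theorem mark_comp_res [Finite P] [Finite Q] [Finite K] (φ : Q →* P) (D : Subgroup (Q × K))
    (g : Burn (P × K)) :
    mark D (comp (res φ) g) = mark (D.map (φ.prodMap (MonoidHom.id K))) g := by
  suffices h : mark D ∘ₗ comp (res φ) = mark (D.map (φ.prodMap (MonoidHom.id K))) from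
    LinearMap.congr_fun h g
  refine hom_ext_cls fun L => ?_
  rw [LinearMap.comp_apply, res, comp_cls, mark_cls, mark_cls, Nat.cast_inj,
    Amalg.card_fixSet (resSetEquiv φ) (resSetEquiv_smul φ) (1 : Q × K →* Q)
      (φ.prodMap (MonoidHom.id K)) (fun _ _ => rfl) fun a v => ?_,
    fixSet_of_subsingleton, Nat.card_univ, Nat.card_unique, one_mul]
  change (φ a.1 * v.val * 1⁻¹, (1 : K)) * (1, a.2) = (φ a.1, a.2) * (v.val, 1)
  rw [inv_one, mul_one, Prod.mk_mul_mk, Prod.mk_mul_mk, mul_one, mul_one, one_mul]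

theorem mark_act_res [Finite P] [Finite Q] (φ : Q →* P) (R : Subgroup Q) (s : Burn P) :
    mark R (act (res φ) s) = mark (R.map φ) s := by
  suffices h : mark R ∘ₗ act (res φ) = mark (R.map φ) from LinearMap.congr_fun h s
  refine hom_ext_cls fun L => ?_
  rw [LinearMap.comp_apply, res, act_cls, mark_cls, mark_cls, Nat.cast_inj,
    Amalg.card_fixSet (resSetEquiv φ) (resSetEquiv_smul φ) (1 : Q →* Q) φ (fun _ _ => rfl)
      fun a v => ?_,
    fixSet_of_subsingleton, Nat.card_univ, Nat.card_unique, one_mul]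
  change φ a * v.val * 1⁻¹ * 1 = φ a * v.val
  rw [inv_one, mul_one, mul_one]

section MulSet

variable (X : Type u) [MulAction P X]

/-- Coordinates of the `P × P`-set `X × P` in which the right action only affects the second one. -/
def mulSetEquiv : MulSet P X ≃ X × P :=
  ⟨fun z => (z.pt, z.val), fun z => ⟨z.1, z.2⟩, fun _ => rfl, fun _ => rfl⟩

/-- Coordinates of the `P × P`-set `X × P` in which the left action only affects the second one. -/
def mulSetEquivLeft : MulSet P X ≃ X × P where
  toFun z := (z.val⁻¹ • z.pt, z.val⁻¹)
  invFun z := ⟨z.2⁻¹ • z.1, z.2⁻¹⟩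
  left_inv z := MulSet.ext (inv_smul_smul z.val⁻¹ z.pt) (inv_inv _)
  right_inv z := Prod.ext (inv_smul_smul z.2⁻¹ z.1) (inv_inv _)

variable {X}

theorem mulSetEquiv_smul (u : P) (z : MulSet P X) : mulSetEquiv X (((1 : P), u) • z) =
    ((mulSetEquiv X z).1, (mulSetEquiv X z).2 * u⁻¹) := by
  change ((1 : P) • z.pt, 1 * z.val * u⁻¹) = (z.pt, z.val * u⁻¹)
  rw [one_smul, one_mul]

theorem mulSetEquivLeft_smul (u : P) (z : MulSet P X) : mulSetEquivLeft X ((u, (1 : P)) • z) =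
    ((mulSetEquivLeft X z).1, (mulSetEquivLeft X z).2 * u⁻¹) := by
  change ((u * z.val * 1⁻¹)⁻¹ • u • z.pt, (u * z.val * 1⁻¹)⁻¹) =
    (z.val⁻¹ • z.pt, z.val⁻¹ * u⁻¹)
  rw [inv_one, mul_one, mul_inv_rev, mul_smul, inv_smul_smul]

variable [Finite P]

theorem mark_mulMap_comp [Finite K] (D : Subgroup (P × K)) (s : Burn P) (f : Burn (P × K)) :
    mark D (comp (mulMap P s) f) = mark (D.map (MonoidHom.fst P K)) s * mark D f := by
  suffices h : (comp ∘ₗ mulMap P).compr₂ (mark D) =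
      (LinearMap.mul ℤ ℤ).compl₁₂ (mark (D.map (MonoidHom.fst P K))) (mark D) from
    LinearMap.congr_fun₂ h s f
  refine hom_ext_cls fun L => hom_ext_cls fun L' => ?_
  simp only [LinearMap.compr₂_apply, LinearMap.compl₁₂_apply, LinearMap.mul_apply',
    LinearMap.comp_apply, mulMap_cls, comp_cls, mark_cls, ← Nat.cast_mul]
  rw [Amalg.card_fixSet (mulSetEquiv (P ⧸ L)) mulSetEquiv_smul (MonoidHom.fst P K)
    (MonoidHom.id _) (fun _ _ => rfl) fun a z => ?_, Subgroup.map_id]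
  change (a.1 * z.val * 1⁻¹, (1 : K)) * (1, a.2) = a * (z.val, 1)
  rw [inv_one, mul_one, Prod.mk_mul_mk, mul_one, one_mul, ← Prod.mk.eta (p := a),
    Prod.mk_mul_mk, mul_one]

theorem mark_comp_mulMap [Finite K] (D : Subgroup (K × P)) (s : Burn P) (f : Burn (K × P)) :
    mark D (comp f (mulMap P s)) = mark (D.map (MonoidHom.snd K P)) s * mark D f := by
  suffices h : (comp.flip ∘ₗ mulMap P).compr₂ (mark D) =
      (LinearMap.mul ℤ ℤ).compl₁₂ (mark (D.map (MonoidHom.snd K P))) (mark D) from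
    LinearMap.congr_fun₂ h s f
  refine hom_ext_cls fun L => hom_ext_cls fun L' => ?_
  simp only [LinearMap.compr₂_apply, LinearMap.compl₁₂_apply, LinearMap.mul_apply',
    LinearMap.comp_apply, LinearMap.flip_apply, mulMap_cls, comp_cls, mark_cls, ← Nat.cast_mul]
  rw [card_fixSet_gequiv D Amalg.swap, Amalg.card_fixSet (mulSetEquivLeft (P ⧸ L))
    mulSetEquivLeft_smul (MonoidHom.snd K P) (MonoidHom.id _) (fun a z => ?_) fun a z => ?_,
    Subgroup.map_id]
  · change (1 * z.val * a.2⁻¹)⁻¹ • (1 : P) • z.pt = a.2 • z.val⁻¹ • z.pt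
    rw [one_mul, one_smul, mul_inv_rev, inv_inv, mul_smul]
  · change ((1 : K), (1 * z.val * a.2⁻¹)⁻¹) * (a.1, 1) = (a.1, a.2) * (1, z.val⁻¹)
    rw [Prod.mk_mul_mk, Prod.mk_mul_mk, one_mul, one_mul, mul_one, mul_one, mul_inv_rev, inv_inv]

theorem mark_act_mulMap (D : Subgroup P) (s t : Burn P) :
    mark D (act (mulMap P s) t) = mark D s * mark D t := by
  suffices h : (act ∘ₗ mulMap P).compr₂ (mark D) =
      (LinearMap.mul ℤ ℤ).compl₁₂ (mark D) (mark D) from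
    LinearMap.congr_fun₂ h s t
  refine hom_ext_cls fun L => hom_ext_cls fun L' => ?_
  simp only [LinearMap.compr₂_apply, LinearMap.compl₁₂_apply, LinearMap.mul_apply',
    LinearMap.comp_apply, mulMap_cls, act_cls, mark_cls, ← Nat.cast_mul]
  rw [Amalg.card_fixSet (mulSetEquiv (P ⧸ L)) mulSetEquiv_smul (MonoidHom.id P)
    (MonoidHom.id P) (fun _ _ => rfl) fun a z => ?_, Subgroup.map_id]
  change a * z.val * 1⁻¹ * 1 = a * z.val
  rw [inv_one, mul_one, mul_one]

theorem act_mulMap (s t : Burn P) : act (mulMap P s) t = s * t :=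
  ext_mark fun D => by rw [mark_act_mulMap, mark_mul]

end MulSet

section Associativity

variable (Ω Ω' X : Type u) [MulAction (G × H) Ω] [MulAction (H × K) Ω'] [MulAction K X]

/-- The `G`-sets `(Ω ×_H Ω') ×_K X` and `Ω ×_H (Ω' ×_K X)` are isomorphic. -/
def actAssoc : GEquiv G (ATensor G K (BTensor G H K Ω Ω') X)
    (ATensor G H Ω (ATensor H K Ω' X)) where
  toFun := Amalg.lift (fun a x => Amalg.lift (fun ω ω' => Amalg.mk ω (Amalg.mk ω' x))
      (by
      refine fun ω ω' u => Amalg.mk_eq_mk.2 ⟨u, rfl, ?_⟩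
      exact congrArg (Amalg.mk ((u, (1 : K)) • ω')) (one_smul K x).symm) a) fun a x u => by
    induction a using Amalg.ind with | _ ω ω'
    change Amalg.mk ω (Amalg.mk ω' x) =
      Amalg.mk ((1 : G × H) • ω) (Amalg.mk (((1 : H), u) • ω') (u • x))
    rw [one_smul]
    exact congrArg _ (Amalg.mk_eq_mk.2 ⟨u, rfl, rfl⟩)
  invFun := Amalg.lift (fun ω a => Amalg.lift (fun ω' x => Amalg.mk (Amalg.mk ω ω') x)
      (by
      refine fun ω' x u => Amalg.mk_eq_mk.2 ⟨u, ?_, rfl⟩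
      exact congrArg (Amalg.mk · (((1 : H), u) • ω')) (one_smul (G × H) ω).symm) a)
      fun ω a u => by
    induction a using Amalg.ind with | _ ω' x
    change Amalg.mk (Amalg.mk ω ω') x =
      Amalg.mk (Amalg.mk (((1 : G), u) • ω) ((u, (1 : K)) • ω')) ((1 : K) • x)
    rw [one_smul]
    exact congrArg (Amalg.mk · x) (Amalg.mk_eq_mk.2 ⟨u, rfl, rfl⟩)
  left_inv := Amalg.ind fun a _ => by
    induction a using Amalg.ind with | _
    rfl
  right_inv := Amalg.ind fun _ a => by
    induction a using Amalg.ind with | _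
    rfl
  map_smul' _ := Amalg.ind fun a _ => by
    induction a using Amalg.ind with | _
    rfl

end Associativity

theorem act_comp [Finite G] [Finite H] [Finite K] (a : Burn (G × H)) (b : Burn (H × K))
    (s : Burn K) : act (comp a b) s = act a (act b s) := by
  suffices h : comp.compr₂ act = (LinearMap.llcomp ℤ _ _ _).compl₁₂ act act from
    LinearMap.congr_fun (LinearMap.congr_fun₂ h a b) s
  refine hom_ext_cls fun L => hom_ext_cls fun L' => hom_ext_cls fun L'' => ?_
  change act (comp (cls _ _) (cls _ _)) (cls _ _) = act (cls _ _) (act (cls _ _) (cls _ _))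
  rw [comp_cls, act_cls, act_cls, act_cls]
  exact cls_congr (actAssoc _ _ _)

end Formulas

section Quotients

open MulAction

variable {G H : Type u} [Group G] [Group H]

theorem stabilizer_quotient_mk (L : Subgroup G) (g : G) :
    stabilizer G (g : G ⧸ L) = L.map (MulAut.conj g).toMonoidHom := by
  have h := stabilizer_smul_eq_stabilizer_map_conj g ((1 : G) : G ⧸ L)
  rw [stabilizer_quotient] at h
  rw [← h, MulAction.Quotient.smul_coe, smul_eq_mul, mul_one]

theorem map_stabilizer_quotient_mk (f : G →* H) (L : Subgroup G) (g : G) :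
    (stabilizer G (g : G ⧸ L)).map f = stabilizer H (f g : H ⧸ L.map f) := by
  rw [stabilizer_quotient_mk, stabilizer_quotient_mk, Subgroup.map_map, Subgroup.map_map]
  refine congrArg L.map (MonoidHom.ext fun x => ?_)
  change f (g * x * g⁻¹) = f g * f x * (f g)⁻¹
  rw [map_mul, map_mul, map_inv]

theorem card_mul_card_fixSet_quotient (K L : Subgroup G) :
    Nat.card L * Nat.card (fixSet K (G ⧸ L)) =
      Nat.card {g : G // K ≤ stabilizer G (g : G ⧸ L)} := by
  rw [← Nat.card_prod]
  exact (Nat.card_congr (QuotientGroup.preimageMkEquivSubgroupProdSet L (fixSet K (G ⧸ L)))).symm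

end Quotients

section Graphs

variable {P K : Type u} [Group P] [Group K]

/-- The graph `{(u, ψ u)}` of a homomorphism `ψ` from `R`, with the argument in the first
coordinate, contrary to `graphSubgroup`. -/
def coGraph {R : Subgroup P} (ψ : R →* K) : Subgroup (P × K) := (R.subtype.prod ψ).range

theorem coGraph_le {R : Subgroup P} {ψ : R →* K} {D : Subgroup (P × K)} :
    coGraph ψ ≤ D ↔ ∀ u : R, ((u : P), ψ u) ∈ D :=
  ⟨fun h u => h ⟨u, rfl⟩, fun h => by rintro _ ⟨u, rfl⟩; exact h u⟩

theorem map_fst_coGraph {R : Subgroup P} (ψ : R →* K) :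
    (coGraph ψ).map (MonoidHom.fst P K) = R := by
  rw [coGraph, MonoidHom.map_range, MonoidHom.fst_comp_prod, Subgroup.range_subtype]

variable {D : Subgroup (P × K)}

theorem coGraph_le_unique (hD : ∀ v, (1, v) ∈ D → v = 1) {R : Subgroup P} {ψ ψ' : R →* K}
    (h : coGraph ψ ≤ D) (h' : coGraph ψ' ≤ D) : ψ = ψ' := by
  ext u
  have hu := mul_mem (coGraph_le.1 h u) (inv_mem (coGraph_le.1 h' u))
  rw [Prod.inv_mk, Prod.mk_mul_mk, mul_inv_cancel] at hu
  exact mul_inv_eq_one.1 (hD _ hu)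

theorem injective_fst_comp_subtype (hD : ∀ v, (1, v) ∈ D → v = 1) :
    Function.Injective ((MonoidHom.fst P K).comp D.subtype) := by
  refine (injective_iff_map_eq_one _).2 ?_
  rintro ⟨⟨a, b⟩, hab⟩ (rfl : a = 1)
  exact Subtype.ext (Prod.ext rfl (hD b hab))

theorem exists_coGraph_le (hD : ∀ v, (1, v) ∈ D → v = 1) {R : Subgroup P}
    (hR : R ≤ D.map (MonoidHom.fst P K)) : ∃ ψ : R →* K, coGraph ψ ≤ D := by
  let e : D ≃* ((MonoidHom.fst P K).comp D.subtype).range :=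
    MonoidHom.ofInjective (injective_fst_comp_subtype hD)
  have hR' : R ≤ ((MonoidHom.fst P K).comp D.subtype).range := fun u hu => by
    obtain ⟨d, hd, rfl⟩ := hR hu
    exact ⟨⟨d, hd⟩, rfl⟩
  refine ⟨((MonoidHom.snd P K).comp D.subtype).comp
    (e.symm.toMonoidHom.comp (Subgroup.inclusion hR')), coGraph_le.2 fun u => ?_⟩
  have hu : (e.symm (Subgroup.inclusion hR' u) : P × K).1 = u :=
    congrArg Subtype.val (e.apply_symm_apply (Subgroup.inclusion hR' u))
  rw [← hu]
  exact (e.symm (Subgroup.inclusion hR' u)).2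

/-- Both sides count the pairs `g` for which `R` is contained in the first projection of the
stabilizer of the class of `g`. -/
theorem sum_card_fixSet_coGraph [Finite P] [Finite K] (hD : ∀ v, (1, v) ∈ D → v = 1)
    (R : Subgroup P) [Fintype (R →* K)] :
    ∑ ψ : R →* K, Nat.card (fixSet (coGraph ψ) ((P × K) ⧸ D)) =
      Nat.card K * Nat.card (fixSet R (P ⧸ D.map (MonoidHom.fst P K))) := by
  have hstab (g : P × K) (v : K) (hv : (1, v) ∈ MulAction.stabilizer (P × K) (g : (P × K) ⧸ D)) :
      v = 1 := by
    rw [stabilizer_quotient_mk] at hv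
    obtain ⟨⟨a, b⟩, hab, h⟩ := hv
    obtain ⟨ha, rfl⟩ := Prod.ext_iff.1 h
    obtain rfl : a = 1 := conj_eq_one_iff.1 ha
    change g.2 * b * g.2⁻¹ = 1
    rw [hD b hab, mul_one, mul_inv_cancel]
  have hcard : Nat.card (D.map (MonoidHom.fst P K)) = Nat.card D := by
    rw [← Subgroup.range_subtype D, MonoidHom.map_range, Subgroup.range_subtype]
    exact Nat.card_congr (MonoidHom.ofInjective (injective_fst_comp_subtype hD)).symm.toEquiv
  refine Nat.eq_of_mul_eq_mul_left (Nat.card_pos (α := D)) ?_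
  rw [Finset.mul_sum, mul_left_comm, ← hcard, card_mul_card_fixSet_quotient, hcard,
    Finset.sum_congr rfl fun ψ _ => card_mul_card_fixSet_quotient (coGraph ψ) D,
    ← Nat.card_sigma, ← Nat.card_prod]
  refine Nat.card_congr (Equiv.ofBijective (fun z => ⟨z.2.1.2, z.2.1.1, ?_⟩) ⟨?_, ?_⟩)
  · exact (map_fst_coGraph z.1).symm.trans_le <|
      (Subgroup.map_mono z.2.2).trans_eq (map_stabilizer_quotient_mk _ D _)
  · rintro ⟨ψ, g, h⟩ ⟨ψ', g', h'⟩ he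
    obtain rfl : g = g' := by
      rw [Prod.ext_iff, Subtype.ext_iff] at he
      exact Prod.ext he.2 he.1
    obtain rfl := coGraph_le_unique (hstab g) h h'
    rfl
  · rintro ⟨y, x, hx⟩
    obtain ⟨ψ, hψ⟩ := exists_coGraph_le (hstab (x, y)) <|
      hx.trans_eq (map_stabilizer_quotient_mk (MonoidHom.fst P K) D (x, y)).symm
    exact ⟨⟨ψ, (x, y), hψ⟩, rfl⟩

variable [Finite P] [Finite K]

theorem act_cls_quotient_one (D : Subgroup (P × K)) :
    act (cls (P × K) ((P × K) ⧸ D)) 1 = cls P (P ⧸ D.map (MonoidHom.fst P K)) := by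
  have := QuotientGroup.subsingleton_quotient_top (G := K)
  rw [one_eq, act_cls]
  refine cls_eq_cls_quotient (Amalg.mk ((1 : P × K) : (P × K) ⧸ D) ((1 : K) : K ⧸ ⊤)) ?_ ?_
  · refine Amalg.ind fun x y => ?_
    obtain ⟨g, rfl⟩ := QuotientGroup.mk_surjective x
    refine ⟨g.1, Amalg.mk_eq_mk.2 ⟨g.2, ?_, Subsingleton.elim _ _⟩⟩
    change (g : (P × K) ⧸ D) = (((1, g.2) * ((g.1, 1) * 1) : P × K) : (P × K) ⧸ D)
    rw [mul_one, Prod.mk_mul_mk, one_mul, mul_one]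
  · ext a
    rw [MulAction.mem_stabilizer_iff, Amalg.smul_mk, Amalg.mk_eq_mk, Subgroup.mem_map]
    have hD (u : K) : ((1 : P × K) : (P × K) ⧸ D) =
        (((1, u) * ((a, 1) * 1) : P × K) : (P × K) ⧸ D) ↔ (a, u) ∈ D := by
      rw [QuotientGroup.eq, inv_one, one_mul, mul_one, Prod.mk_mul_mk, one_mul, mul_one]
    constructor
    · rintro ⟨u, hu, -⟩
      exact ⟨(a, u), (hD u).1 hu, rfl⟩
    · rintro ⟨⟨_, u⟩, hu, rfl⟩
      exact ⟨u, (hD u).2 hu, Subsingleton.elim _ _⟩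

theorem comp_opp_res_res {Q : Type u} [Group Q] [Finite Q] (φ : Q →* P) (ψ : Q →* K) :
    comp (opp (res φ)) (res ψ) = cls (P × K) ((P × K) ⧸ (φ.prod ψ).range) := by
  rw [res, res, opp_cls, comp_cls]
  refine cls_eq_cls_quotient (Amalg.mk ⟨⟨1⟩⟩ ⟨1⟩) (Amalg.ind fun v w => ?_) ?_
  · refine ⟨(v.val.val⁻¹, w.val⁻¹), Amalg.mk_eq_mk.2 ⟨1, OppSet.ext (ResSet.ext ?_), ResSet.ext ?_⟩⟩
    · change v.val.val = φ 1 * (φ 1 * 1 * v.val.val⁻¹⁻¹) * (1 : P)⁻¹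
      simp only [map_one, one_mul, inv_inv, inv_one, mul_one]
    · change w.val = ψ 1 * (ψ 1 * 1 * w.val⁻¹⁻¹) * (1 : K)⁻¹
      simp only [map_one, one_mul, inv_inv, inv_one, mul_one]
  · ext ⟨a, b⟩
    rw [MulAction.mem_stabilizer_iff, Amalg.smul_mk, Amalg.mk_eq_mk]
    refine exists_congr fun u => ?_
    rw [OppSet.ext_iff, ResSet.ext_iff, ResSet.ext_iff]
    change 1 = φ u * (φ 1 * 1 * a⁻¹) * (1 : P)⁻¹ ∧ 1 = ψ u * (ψ 1 * 1 * b⁻¹) * (1 : K)⁻¹ ↔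
      (φ u, ψ u) = (a, b)
    simp only [map_one, one_mul, inv_one, mul_one, eq_comm (a := (1 : P)), eq_comm (a := (1 : K)),
      mul_inv_eq_one, Prod.mk.injEq]

theorem mulMap_cls_quotient_range {Q : Type u} [Group Q] (φ : Q →* P) :
    mulMap P (cls P (P ⧸ φ.range)) = cls (P × P) ((P × P) ⧸ (φ.prod φ).range) := by
  rw [mulMap_cls]
  refine cls_eq_cls_quotient ⟨((1 : P) : P ⧸ φ.range), 1⟩ ?_ ?_
  · rintro ⟨x, v⟩
    obtain ⟨g, rfl⟩ := QuotientGroup.mk_surjective x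
    refine ⟨(g, v⁻¹ * g), MulSet.ext ?_ ?_⟩
    · change ((g * 1 : P) : P ⧸ φ.range) = g
      rw [mul_one]
    · change g * 1 * (v⁻¹ * g)⁻¹ = v
      rw [mul_one, mul_inv_rev, inv_inv, mul_inv_cancel_left]
  · ext ⟨a, b⟩
    rw [MulAction.mem_stabilizer_iff, MulSet.ext_iff]
    change ((a * 1 : P) : P ⧸ φ.range) = ((1 : P) : P ⧸ φ.range) ∧ a * 1 * b⁻¹ = 1 ↔
      ∃ u, (φ u, φ u) = (a, b)
    rw [mul_one, mul_inv_eq_one, eq_comm, QuotientGroup.eq, inv_one, one_mul, MonoidHom.mem_range]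
    constructor
    · rintro ⟨⟨u, rfl⟩, rfl⟩
      exact ⟨u, rfl⟩
    · rintro ⟨u, hu⟩
      obtain ⟨rfl, rfl⟩ := Prod.mk.inj hu
      exact ⟨⟨u, rfl⟩, rfl⟩

end Graphs

end Burn

namespace DivisibleCategory

variable {P : Type u} [Group P] {F : DivisibleCategory P}

open Burn

theorem isGraph_of_le {D E : Subgroup (P × P)} (hE : F.IsGraph E) (h : D ≤ E) : F.IsGraph D := by
  refine isGraph_star (E := graphSubgroup (D.map (MonoidHom.snd P P)).subtype) hE
    ⟨_, _, F.isMor_subtype _, rfl⟩ fun a b => ?_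
  simp only [mem_graphSubgroup]
  constructor
  · intro hab
    exact ⟨b, h hab, ⟨(a, b), hab, rfl⟩, rfl⟩
  · rintro ⟨u, hu, ⟨⟨c, v⟩, hcb, hv⟩, hb⟩
    obtain rfl : v = b := hv
    obtain rfl : v = u := hb
    obtain ⟨Q, φ, -, rfl⟩ := hE
    obtain ⟨_, ha⟩ := mem_graphSubgroup.1 hu
    obtain ⟨_, hc⟩ := mem_graphSubgroup.1 (h hcb)
    obtain rfl : c = a := hc.symm.trans ha
    exact hcb

theorem IsGraph.eq_one_of_mk_one_mem {D : Subgroup (P × P)} (hD : F.IsGraph D) {v : P}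
    (hv : (1, v) ∈ D) : v = 1 := by
  obtain ⟨Q, φ, hφ, rfl⟩ := hD
  obtain ⟨h, h1⟩ := mem_graphSubgroup.1 hv
  exact congrArg Subtype.val (F.injective hφ (a₁ := ⟨v, h⟩) (a₂ := 1) (by simp [h1]))

variable [Finite P]

theorem eqOn_hecke {M : Type*} [AddCommGroup M] {α β : DBurn P →ₗ[ℤ] M}
    (h : ∀ D, F.IsGraph D → α (DBurn.toBurn.symm (cls (P × P) ((P × P) ⧸ D))) =
      β (DBurn.toBurn.symm (cls (P × P) ((P × P) ⧸ D)))) (f : F.hecke) : α f = β f := by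
  refine LinearMap.eqOn_span (s := {f | ∃ (Q : Subgroup P) (φ : Q →* P), F.IsMor φ ∧
    f = indecElt φ}) ?_ f.2
  rintro _ ⟨Q, φ, hφ, rfl⟩
  exact h _ ⟨Q, φ, hφ, rfl⟩

theorem card_mul_mark_eval (f : F.hecke) (R : Subgroup P) [Fintype (R →* P)] :
    (Nat.card P : ℤ) * mark R (F.eval f) =
      ∑ ψ : R →* P, mark (coGraph ψ) (DBurn.toBurn (f : DBurn P)) := by
  have h := eqOn_hecke (F := F)
    (α := (Nat.card P : ℤ) • mark R ∘ₗ act.flip 1 ∘ₗ DBurn.toBurn.toLinearMap)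
    (β := (∑ ψ : R →* P, mark (coGraph ψ)) ∘ₗ DBurn.toBurn.toLinearMap) (fun D hD => ?_) f
  · exact h.trans (LinearMap.sum_apply _ _ _)
  · change (Nat.card P : ℤ) * mark R (act (cls (P × P) ((P × P) ⧸ D)) 1) =
      (∑ ψ : R →* P, mark (coGraph ψ)) (cls (P × P) ((P × P) ⧸ D))
    simp only [act_cls_quotient_one, LinearMap.sum_apply, mark_cls, ← Nat.cast_mul,
      ← Nat.cast_sum, sum_card_fixSet_coGraph fun _ => hD.eq_one_of_mk_one_mem]

/-- The class of the graph of `φ` is `(res φ)° * res ι`. By the stability of `f`, `res ι` may be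
replaced by `res φ`, and `(res φ)° * res φ` is the multiplication by `P ⧸ φ(Q)`. -/
theorem mul_eq_mulHecke_eval_mul (h : F.hecke) {f : F.hecke} (hf : f ∈ F.heckeInv) :
    h * f = F.mulHecke (F.eval h) * f := by
  refine Subtype.ext (DBurn.toBurn.injective (eqOn_hecke (F := F)
    (α := comp.flip (DBurn.toBurn (f : DBurn P)) ∘ₗ DBurn.toBurn.toLinearMap)
    (β := comp.flip (DBurn.toBurn (f : DBurn P)) ∘ₗ mulMap P ∘ₗ act.flip 1 ∘ₗ
      DBurn.toBurn.toLinearMap) ?_ h))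
  rintro _ ⟨Q, φ, hφ, rfl⟩
  change comp (cls (P × P) ((P × P) ⧸ graphSubgroup φ)) (DBurn.toBurn (f : DBurn P)) =
    comp (mulMap P (act (cls (P × P) ((P × P) ⧸ graphSubgroup φ)) 1)) (DBurn.toBurn (f : DBurn P))
  have hrange : (graphSubgroup φ).map (MonoidHom.fst P P) = φ.range := by
    rw [graphSubgroup, MonoidHom.map_range, MonoidHom.fst_comp_prod]
  rw [act_cls_quotient_one, hrange, mulMap_cls_quotient_range, ← comp_opp_res_res, comp_assoc,
    (hf Q φ hφ).1, ← comp_assoc, comp_opp_res_res, graphSubgroup]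

theorem mark_eq_zero_of_not_isGraph (f : F.hecke) {D : Subgroup (P × P)} (hD : ¬ F.IsGraph D) :
    mark D (DBurn.toBurn (f : DBurn P)) = 0 := by
  refine eqOn_hecke (F := F) (α := mark D ∘ₗ DBurn.toBurn.toLinearMap) (β := 0) (fun E hE => ?_) f
  by_contra hne
  obtain ⟨⟨x, hx⟩⟩ := (Nat.card_ne_zero.1 (Nat.cast_ne_zero.1 ((mark_cls D _).symm.trans_ne hne))).1
  exact hD (isGraph_of_le (isGraph_stabilizer hE x) hx)

end DivisibleCategory

section Groups

variable {G : Type*} [Group G] [Finite G] {p : ℕ}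

theorem exists_sylow_eq_of_normalizer [Fact p.Prime] {S : Subgroup G} (hS : IsPGroup p S)
    (h : ∀ g ∈ Subgroup.normalizer (S : Set G), (∃ k, g ^ p ^ k = 1) → g ∈ S) :
    ∃ X : Sylow p G, (X : Subgroup G) = S := by
  obtain ⟨X, hSX⟩ := hS.exists_le_sylow
  refine ⟨X, le_antisymm ?_ hSX⟩
  by_contra hXS
  have hlt : S.subgroupOf X < ⊤ := by
    rwa [lt_top_iff_ne_top, Ne, Subgroup.subgroupOf_eq_top]
  have := X.isPGroup'.isNilpotent
  obtain ⟨x, hx, hxS⟩ := SetLike.exists_of_lt (Group.normalizerCondition_of_isNilpotent _ hlt)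
  rw [← Subgroup.subgroupOf_normalizer_eq hSX] at hx
  obtain ⟨k, hk⟩ := X.isPGroup' x
  exact hxS (h x hx ⟨k, congrArg Subtype.val hk⟩)

theorem exists_pow_pow_eq_one_of_modEq (hp : p.Prime) (g : G) (a : ℕ) :
    ∃ k : ℕ, k ≡ 1 [MOD p ^ a] ∧ ∃ b, (g ^ k) ^ p ^ b = 1 := by
  obtain ⟨b, m, hm, hb⟩ := Nat.exists_eq_pow_mul_and_not_dvd (orderOf_pos g).ne' p hp.ne_one
  have hco : Nat.Coprime (p ^ a) m :=
    Nat.Coprime.pow_left a ((Nat.Prime.coprime_iff_not_dvd hp).2 hm)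
  obtain ⟨k, hk, hmk⟩ := Nat.chineseRemainder hco 1 0
  refine ⟨k, hk, b, ?_⟩
  rw [← pow_mul, ← orderOf_dvd_iff_pow_eq_one, hb, mul_comm]
  exact Nat.mul_dvd_mul (Nat.modEq_zero_iff_dvd.1 hmk) dvd_rfl

end Groups

theorem mem_extDomain_of_conj {P : Type u} [Group P] [Finite P] {Q : Subgroup P} {φ : Q →* P}
    {x y : P} (hx : x ∈ Subgroup.normalizer (Q : Set P))
    (h : ∀ u v : Q, (v : P) = x * u * x⁻¹ → φ v = y * φ u * y⁻¹) : x ∈ extDomain φ := by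
  refine ⟨hx, y, Subgroup.mem_normalizer_fintype ?_, h⟩
  rintro _ ⟨u, rfl⟩
  exact ⟨⟨x * u * x⁻¹, (Subgroup.mem_normalizer_iff.1 hx u).1 u.2⟩, h u _ rfl⟩

theorem mem_conjAut {P : Type u} [Group P] {Q : Subgroup P} {σ : MulAut Q} : σ ∈ conjAut Q ↔
    ∃ x ∈ Subgroup.normalizer (Q : Set P), ∀ u : Q, (σ u : P) = x * u * x⁻¹ := by
  constructor
  · rintro ⟨x, rfl⟩
    exact ⟨x, x.2, fun u => rfl⟩
  · rintro ⟨x, hx, h⟩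
    exact ⟨⟨x, hx⟩, MulEquiv.ext fun u => Subtype.ext (h u).symm⟩

theorem isPGroup_conjAut {P : Type u} [Group P] {p : ℕ} (hP : IsPGroup p P) (Q : Subgroup P) :
    IsPGroup p (conjAut Q) :=
  (hP.to_subgroup _).of_surjective (Subgroup.normalizerMonoidHom Q).rangeRestrict
    (MonoidHom.rangeRestrict_surjective _)

theorem coe_map_subgroupOf {G H : Type*} [Group G] [Group H] {L Q : Subgroup G} (hL : L ≤ Q)
    {φ : Q →* H} {f : G → H} (h : ∀ u : Q, φ u = f u) :
    ((L.subgroupOf Q).map φ : Set H) = f '' L := by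
  ext y
  constructor
  · rintro ⟨u, hu, rfl⟩
    exact ⟨u, hu, (h u).symm⟩
  · rintro ⟨u, hu, rfl⟩
    exact ⟨⟨u, hL hu⟩, hu, h _⟩

theorem inclusion_pow_apply {G : Type*} [Group G] {Q N : Subgroup G} (hQN : Q ≤ N) {τ : MulAut Q}
    {γ : MulAut N} (h : ∀ u, γ (Subgroup.inclusion hQN u) = Subgroup.inclusion hQN (τ u)) (n : ℕ)
    (u : Q) : (γ ^ n) (Subgroup.inclusion hQN u) = Subgroup.inclusion hQN ((τ ^ n) u) := by
  induction n generalizing u with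
  | zero => rfl
  | succ n ih => rw [pow_succ, pow_succ, MulAut.mul_apply, MulAut.mul_apply, h, ih]

namespace DivisibleCategory

variable {P : Type u} [Group P] (F : DivisibleCategory P)

/-- The map `f` restricts to a morphism `Q → P` of the category. Working with maps on the whole
group avoids transporting homomorphisms between equal subgroups. -/
def IsMorOn (f : P → P) (Q : Subgroup P) : Prop :=
  ∃ φ : Q →* P, F.IsMor φ ∧ ∀ u : Q, φ u = f u

/-- Isomorphism of objects in the category. -/
def Isomorphic (Q R : Subgroup P) : Prop := ∃ f, F.IsMorOn f Q ∧ f '' Q = R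

variable {F} {Q R N : Subgroup P} {f g : P → P}

theorem IsMor.injective {φ : Q →* P} (hφ : F.IsMor φ) : Function.Injective φ := fun _ _ h =>
  F.injective hφ (congrArg (Subgroup.topEquiv (G := P)).symm h)

theorem isMor_subtype_comp {φ : Q →* R} (h : φ ∈ F.Hom Q R) : F.IsMor (R.subtype.comp φ) :=
  isMor_comp (F.isMor_subtype R) h

theorem mem_hom_of_isMor {φ : Q →* R} (h : F.IsMor (R.subtype.comp φ)) : φ ∈ F.Hom Q R :=
  F.divisible φ (F.isMor_subtype R) h

theorem IsMor.exists_isMorOn {φ : Q →* P} (hφ : F.IsMor φ) :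
    ∃ f, F.IsMorOn f Q ∧ ∀ u : Q, φ u = f u :=
  have h (u : Q) : φ u = Function.extend Subtype.val φ 1 (u : P) :=
    (Subtype.val_injective.extend_apply φ 1 u).symm
  ⟨Function.extend Subtype.val φ 1, ⟨φ, hφ, h⟩, h⟩

theorem exists_isMorOn_of_mem_hom {φ : Q →* R} (hφ : φ ∈ F.Hom Q R) :
    ∃ f, F.IsMorOn f Q ∧ ∀ u : Q, (φ u : P) = f u :=
  (isMor_subtype_comp hφ).exists_isMorOn

namespace IsMorOn

theorem map_mul (hf : F.IsMorOn f Q) {x y : P} (hx : x ∈ Q) (hy : y ∈ Q) :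
    f (x * y) = f x * f y := by
  obtain ⟨φ, -, h⟩ := hf
  have := _root_.map_mul φ ⟨x, hx⟩ ⟨y, hy⟩
  rwa [h, h, h] at this

theorem map_inv (hf : F.IsMorOn f Q) {x : P} (hx : x ∈ Q) : f x⁻¹ = (f x)⁻¹ := by
  obtain ⟨φ, -, h⟩ := hf
  have := _root_.map_inv φ ⟨x, hx⟩
  rwa [h, h] at this

theorem map_conj (hf : F.IsMorOn f Q) {x u : P} (hx : x ∈ Q) (hu : u ∈ Q) :
    f (x * u * x⁻¹) = f x * f u * (f x)⁻¹ := by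
  rw [hf.map_mul (mul_mem hx hu) (inv_mem hx), hf.map_mul hx hu, hf.map_inv hx]

theorem injOn (hf : F.IsMorOn f Q) : Set.InjOn f Q := by
  obtain ⟨φ, hφ, h⟩ := hf
  intro x hx y hy hxy
  exact congrArg Subtype.val (hφ.injective ((h ⟨x, hx⟩).trans (hxy.trans (h ⟨y, hy⟩).symm)))

theorem mono (hf : F.IsMorOn f Q) (h : R ≤ Q) : F.IsMorOn f R := by
  obtain ⟨φ, hφ, hφf⟩ := hf
  exact ⟨φ.comp (Subgroup.inclusion h), isMor_comp hφ (F.conj_mem _ 1 fun u => by simp),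
    fun _ => hφf _⟩

theorem comp (hg : F.IsMorOn g R) (hf : F.IsMorOn f Q) (h : Set.MapsTo f Q R) :
    F.IsMorOn (g ∘ f) Q := by
  obtain ⟨φ, hφ, hφf⟩ := hf
  obtain ⟨ψ, hψ, hψg⟩ := hg
  have hφR (u : Q) : φ u ∈ R := (hφf u).symm ▸ h u.2
  refine ⟨ψ.comp (φ.codRestrict R hφR), isMor_comp hψ (mem_hom_of_isMor hφ), fun u => ?_⟩
  exact (hψg _).trans (congrArg g (hφf u))

theorem conj (Q : Subgroup P) (x : P) : F.IsMorOn (fun u => x * u * x⁻¹) Q :=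
  ⟨(MulAut.conj x).toMonoidHom.comp Q.subtype, F.conj_mem _ x fun _ => rfl, fun _ => rfl⟩

theorem id (Q : Subgroup P) : F.IsMorOn id Q := ⟨Q.subtype, F.isMor_subtype Q, fun _ => rfl⟩

theorem exists_coe_eq_image (hf : F.IsMorOn f Q) : ∃ R : Subgroup P, f '' Q = R := by
  obtain ⟨φ, -, h⟩ := hf
  refine ⟨φ.range, Set.Subset.antisymm ?_ ?_⟩
  · rintro _ ⟨u, hu, rfl⟩
    exact ⟨⟨u, hu⟩, h _⟩
  · rintro _ ⟨u, rfl⟩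
    exact ⟨u, u.2, (h u).symm⟩

theorem exists_mulEquiv (hf : F.IsMorOn f Q) (hfR : f '' Q = R) :
    ∃ e : Q ≃* R, (∀ u, (e u : P) = f u) ∧ e.toMonoidHom ∈ F.Hom Q R ∧
      e.symm.toMonoidHom ∈ F.Hom R Q := by
  obtain ⟨φ, hφ, h⟩ := hf
  have hφR (u : Q) : φ u ∈ R := by
    rw [← SetLike.mem_coe, ← hfR, h]
    exact Set.mem_image_of_mem f u.2
  let e : Q ≃* R := MulEquiv.ofBijective (φ.codRestrict R hφR) <| by
    refine ⟨(MonoidHom.injective_codRestrict _ _ _).2 hφ.injective, fun y => ?_⟩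
    obtain ⟨x, hx, hxy⟩ := hfR.ge y.2
    exact ⟨⟨x, hx⟩, Subtype.ext ((h _).trans hxy)⟩
  have he : e.toMonoidHom ∈ F.Hom Q R := mem_hom_of_isMor hφ
  refine ⟨e, h, he, F.divisible _ he ?_⟩
  have hid : e.toMonoidHom.comp e.symm.toMonoidHom = MonoidHom.id R :=
    MonoidHom.ext e.apply_symm_apply
  exact hid ▸ F.id_mem R

theorem exists_inverse (hf : F.IsMorOn f Q) (hfR : f '' Q = R) :
    ∃ g, F.IsMorOn g R ∧ ∀ u ∈ Q, g (f u) = u := by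
  obtain ⟨e, he, -, hsymm⟩ := hf.exists_mulEquiv hfR
  obtain ⟨g, hg, hge⟩ := exists_isMorOn_of_mem_hom hsymm
  refine ⟨g, hg, fun u hu => ?_⟩
  rw [← he ⟨u, hu⟩, ← hge]
  exact congrArg Subtype.val (e.symm_apply_apply _)

theorem image_centralizer_subset (hf : F.IsMorOn f N) (hQ : Q ≤ N)
    (hC : Subgroup.centralizer (Q : Set P) ≤ N) :
    f '' Subgroup.centralizer (Q : Set P) ⊆ Subgroup.centralizer (f '' Q) := by
  rintro _ ⟨c, hc, rfl⟩
  refine Subgroup.mem_centralizer_iff.2 ?_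
  rintro _ ⟨u, hu, rfl⟩
  rw [← hf.map_mul (hQ hu) (hC hc), ← hf.map_mul (hC hc) (hQ hu),
    Subgroup.mem_centralizer_iff.1 hc u hu]

theorem card_image (hf : F.IsMorOn f Q) (hR : R ≤ Q) : Nat.card (f '' R) = Nat.card R :=
  Nat.card_image_of_injOn (hf.injOn.mono hR)

theorem apply_mem_normalizer [Finite P] (hf : F.IsMorOn f N) (hQN : Q ≤ N) {x : P} (hx : x ∈ N)
    (hxQ : x ∈ Subgroup.normalizer (Q : Set P)) : f x ∈ Subgroup.normalizer (f '' Q) := by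
  refine Subgroup.mem_normalizer_fintype ?_
  rintro _ ⟨u, hu, rfl⟩
  exact ⟨x * u * x⁻¹, (Subgroup.mem_normalizer_iff.1 hxQ u).1 hu, hf.map_conj hx (hQN hu)⟩

end IsMorOn

namespace Isomorphic

theorem refl (Q : Subgroup P) : F.Isomorphic Q Q := ⟨id, IsMorOn.id Q, Set.image_id _⟩

theorem symm (h : F.Isomorphic Q R) : F.Isomorphic R Q := by
  obtain ⟨f, hf, hfR⟩ := h
  obtain ⟨g, hg, hgf⟩ := hf.exists_inverse hfR
  refine ⟨g, hg, ?_⟩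
  rw [← hfR, Set.image_image, Set.image_congr hgf, Set.image_id']

theorem trans (h : F.Isomorphic Q R) (h' : F.Isomorphic R N) : F.Isomorphic Q N := by
  obtain ⟨f, hf, hfR⟩ := h
  obtain ⟨g, hg, hgN⟩ := h'
  exact ⟨g ∘ f, hg.comp hf (Set.mapsTo_iff_image_subset.2 hfR.le), by rw [Set.image_comp, hfR, hgN]⟩

theorem card_eq (h : F.Isomorphic Q R) : Nat.card R = Nat.card Q := by
  obtain ⟨f, hf, hfR⟩ := h
  rw [← hf.card_image le_rfl, hfR]
  rfl

end Isomorphic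

theorem conjAut_le_aut (Q : Subgroup P) : conjAut Q ≤ F.aut Q := by
  intro σ hσ
  obtain ⟨x, -, h⟩ := mem_conjAut.1 hσ
  exact F.conj_mem _ x h

variable (F) in
/-- No subgroup isomorphic to `R` in the category has a larger centralizer in `P`. -/
def FullyCentralized (R : Subgroup P) : Prop :=
  ∀ R', F.Isomorphic R R' →
    Nat.card (Subgroup.centralizer (R' : Set P)) ≤ Nat.card (Subgroup.centralizer (R : Set P))

variable (F) in
/-- The subgroup `F_P(Q)` of the automorphisms induced by `P` is a Sylow `p`-subgroup of `F(Q)`. -/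
def FullyAutomized (p : ℕ) (Q : Subgroup P) : Prop :=
  ∃ S : Sylow p (F.aut Q), (S : Subgroup (F.aut Q)) = (conjAut Q).subgroupOf (F.aut Q)

variable [Finite P] {p : ℕ}

theorem FullyCentralized.image_centralizer (hR : F.FullyCentralized R)
    (hf : F.IsMorOn f (R ⊔ Subgroup.centralizer (R : Set P))) :
    f '' Subgroup.centralizer (R : Set P) = Subgroup.centralizer (f '' R) := by
  obtain ⟨R', hR'⟩ := (hf.mono le_sup_left).exists_coe_eq_image
  refine Set.eq_of_subset_of_ncard_le (hf.image_centralizer_subset le_sup_left le_sup_right) ?_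
  rw [← Nat.card_coe_set_eq (f '' _), hf.card_image le_sup_right, hR']
  exact hR R' ⟨f, hf.mono le_sup_left, hR'⟩

theorem FullyCentralized.exists_extension (hF : F.IsFrobenius p) (hR : F.FullyCentralized R)
    (hf : F.IsMorOn f Q) (hfR : f '' Q = R)
    (hN : ∀ x ∈ N, x ∈ Subgroup.normalizer (Q : Set P) ∧
      ∃ y, ∀ u ∈ Q, f (x * u * x⁻¹) = y * f u * y⁻¹) :
    ∃ g, F.IsMorOn g N ∧ ∀ u ∈ Q, g u = f u := by
  obtain ⟨φ, hφ, hφf⟩ := hf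
  obtain rfl : φ.range = R := SetLike.coe_injective <| by
    rw [← hfR, MonoidHom.coe_range, ← Set.range_domRestrict]
    exact congrArg Set.range (funext hφf)
  obtain ⟨ψ, hψ, hψφ⟩ := hF.extend Q φ hφ fun ζ hζ => by
    obtain ⟨h, hh, hζh⟩ := hζ.exists_isMorOn
    refine SetLike.coe_injective ?_
    rw [coe_map_subgroupOf le_sup_right hζh, coe_map_subgroupOf le_sup_left hζh,
      hR.image_centralizer hh]
  obtain ⟨g, hg, hψg⟩ := hψ.exists_isMorOn
  refine ⟨g, hg.mono fun x hx => ?_, fun u hu => ?_⟩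
  · obtain ⟨hxQ, y, hy⟩ := hN x hx
    refine mem_extDomain_of_conj (y := y) hxQ fun u v huv => ?_
    rw [hφf, hφf, huv, hy u u.2]
  · rw [← hφf ⟨u, hu⟩, ← hψφ]
    exact (hψg ⟨u, le_extDomain φ hu⟩).symm

namespace FullyAutomized

variable [Fact p.Prime]

theorem exists_conj_mem (hQ : F.FullyAutomized p Q) {T : Subgroup (MulAut Q)} (hT : T ≤ F.aut Q)
    (hTp : IsPGroup p T) : ∃ θ ∈ F.aut Q, ∀ t ∈ T, θ * t * θ⁻¹ ∈ conjAut Q := by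
  obtain ⟨S, hS⟩ := hQ
  obtain ⟨Y, hY⟩ := (hTp.of_equiv (Subgroup.subgroupOfEquivOfLe hT).symm).exists_le_sylow
  obtain ⟨θ, hθ⟩ := MulAction.exists_smul_eq (F.aut Q) Y S
  refine ⟨θ, θ.2, fun t ht => ?_⟩
  have hθt : θ * ⟨t, hT ht⟩ * θ⁻¹ ∈ (S : Subgroup (F.aut Q)) := by
    rw [← hθ]
    exact ⟨_, hY (x := ⟨t, hT ht⟩) ht, rfl⟩
  rwa [hS] at hθt

theorem exists_isMorOn_conj (hR : F.FullyAutomized p R) (hQR : F.Isomorphic Q R)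
    {T : Subgroup (MulAut Q)} (hT : T ≤ F.aut Q) (hTp : IsPGroup p T) :
    ∃ g, F.IsMorOn g Q ∧ g '' Q = R ∧
      ∀ τ ∈ T, ∃ x ∈ Subgroup.normalizer (R : Set P), ∀ u : Q, g (τ u) = x * g u * x⁻¹ := by
  obtain ⟨f, hf, hfR⟩ := hQR
  obtain ⟨e, -, he, he'⟩ := hf.exists_mulEquiv hfR
  obtain ⟨θ, hθ, hθT⟩ := hR.exists_conj_mem (T := T.map (MulAut.congr e).toMonoidHom)
    (by rintro _ ⟨τ, hτ, rfl⟩; exact F.comp_mem he (F.comp_mem (hT hτ) he')) (hTp.map _)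
  obtain ⟨g, hg, hgθ⟩ := exists_isMorOn_of_mem_hom (F.comp_mem hθ he)
  refine ⟨g, hg, Set.Subset.antisymm ?_ fun y hy => ?_, fun τ hτ => ?_⟩
  · rintro _ ⟨u, hu, rfl⟩
    rw [← hgθ ⟨u, hu⟩]
    exact SetLike.coe_mem _
  · refine ⟨e.symm (θ.symm ⟨y, hy⟩), SetLike.coe_mem _, ?_⟩
    rw [← hgθ]
    change (θ (e (e.symm (θ.symm ⟨y, hy⟩))) : P) = y
    rw [e.apply_symm_apply, θ.apply_symm_apply]
  · obtain ⟨x, hx, hxu⟩ := mem_conjAut.1 (hθT _ ⟨τ, hτ, rfl⟩)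
    refine ⟨x, hx, fun u => ?_⟩
    rw [← hgθ, ← hgθ]
    refine Eq.trans ?_ (hxu (θ (e u)))
    change _ = (θ (e (τ (e.symm (θ.symm (θ (e u)))))) : P)
    rw [θ.symm_apply_apply, e.symm_apply_apply]
    rfl

end FullyAutomized

theorem FullyCentralized.exists_aut_normalizer (hF : F.IsFrobenius p) (hQ : F.FullyCentralized Q)
    {τ : MulAut Q} (hτ : τ ∈ F.aut Q) (hτQ : ∀ σ ∈ conjAut Q, τ * σ * τ⁻¹ ∈ conjAut Q) :
    ∃ γ ∈ F.aut (Subgroup.normalizer (Q : Set P)), ∀ u,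
      γ (Subgroup.inclusion Subgroup.le_normalizer u) =
        Subgroup.inclusion Subgroup.le_normalizer (τ u) := by
  obtain ⟨f, hf, hτf⟩ := exists_isMorOn_of_mem_hom hτ
  have hfQ : f '' Q = Q := by
    refine Set.eq_of_subset_of_ncard_le ?_ hf.injOn.ncard_image.ge
    rintro _ ⟨u, hu, rfl⟩
    exact hτf ⟨u, hu⟩ ▸ SetLike.coe_mem _
  obtain ⟨g, hg, hgf⟩ := hQ.exists_extension hF hf hfQ
    (N := Subgroup.normalizer (Q : Set P)) fun x hx => ⟨hx, by
      obtain ⟨y, -, hy⟩ := mem_conjAut.1 (hτQ _ ⟨⟨x, hx⟩, rfl⟩)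
      refine ⟨y, fun u hu => ?_⟩
      have h := hy (τ ⟨u, hu⟩)
      rw [MulAut.mul_apply, MulAut.mul_apply, MulAut.inv_apply_self] at h
      exact (hτf _).symm.trans (h.trans (congrArg (y * · * y⁻¹) (hτf ⟨u, hu⟩)))⟩
  have hgN : g '' Subgroup.normalizer (Q : Set P) = Subgroup.normalizer (Q : Set P) := by
    refine Set.eq_of_subset_of_ncard_le ?_ hg.injOn.ncard_image.ge
    rintro _ ⟨x, hx, rfl⟩
    have h := hg.apply_mem_normalizer Subgroup.le_normalizer hx hx
    rwa [Set.image_congr hgf, hfQ] at h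
  obtain ⟨γ, hγg, hγ, -⟩ := hg.exists_mulEquiv hgN
  exact ⟨γ, hγ, fun u => Subtype.ext ((hγg _).trans ((hgf u u.2).trans (hτf u).symm))⟩

theorem mem_conjAut_of_conj (hf : F.IsMorOn f (Subgroup.normalizer (Q : Set P)))
    (hn : ∀ R, F.Isomorphic Q R →
      Nat.card (Subgroup.centralizer (Q : Set P)) ≤ Nat.card (Subgroup.centralizer (R : Set P)) →
      Nat.card (Subgroup.normalizer (R : Set P)) ≤ Nat.card (Subgroup.normalizer (Q : Set P)))
    {τ : MulAut Q} {x : P} (hx : ∀ u : Q, f (τ u) = x * f u * x⁻¹) : τ ∈ conjAut Q := by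
  have hQN : Q ≤ Subgroup.normalizer (Q : Set P) := Subgroup.le_normalizer
  have hCN := Subgroup.centralizer_le_normalizer (Q : Set P)
  obtain ⟨R, hR⟩ := (hf.mono hQN).exists_coe_eq_image
  have hC : Nat.card (Subgroup.centralizer (Q : Set P)) ≤
      Nat.card (Subgroup.centralizer (R : Set P)) := by
    rw [← hf.card_image hCN, ← hR]
    exact Set.ncard_le_ncard (hf.image_centralizer_subset hQN hCN)
  have himage : f '' Subgroup.normalizer (Q : Set P) = Subgroup.normalizer (R : Set P) := by
    refine Set.eq_of_subset_of_ncard_le ?_ ?_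
    · rintro _ ⟨n, hn, rfl⟩
      exact hR ▸ hf.apply_mem_normalizer hQN hn hn
    · rw [hf.injOn.ncard_image]
      exact hn R ⟨f, hf.mono hQN, hR⟩ hC
  have hxR : x ∈ Subgroup.normalizer (R : Set P) := by
    refine Subgroup.mem_normalizer_fintype ?_
    rw [← hR]
    rintro _ ⟨u, hu, rfl⟩
    exact ⟨τ ⟨u, hu⟩, SetLike.coe_mem _, hx ⟨u, hu⟩⟩
  obtain ⟨n, hn, rfl⟩ := himage.ge hxR
  have hnu (u : Q) : n * u * n⁻¹ ∈ Q := (Subgroup.mem_normalizer_iff.1 hn u).1 u.2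
  refine mem_conjAut.2 ⟨n, hn, fun u => hf.injOn (hQN (τ u).2) (hQN (hnu u)) ?_⟩
  rw [hx, hf.map_conj hn (hQN u.2)]

theorem fullyCentralized_top : F.FullyCentralized ⊤ := fun R h => by
  rw [Subgroup.eq_top_of_card_eq R (h.card_eq.trans Subgroup.card_top)]

theorem exists_isomorphic_maximal (Q : Subgroup P) :
    ∃ R, F.Isomorphic Q R ∧ F.FullyCentralized R ∧ ∀ R', F.Isomorphic R R' →
      Nat.card (Subgroup.centralizer (R : Set P)) ≤ Nat.card (Subgroup.centralizer (R' : Set P)) →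
      Nat.card (Subgroup.normalizer (R' : Set P)) ≤ Nat.card (Subgroup.normalizer (R : Set P)) := by
  let c (R : Subgroup P) : ℕ := Nat.card (Subgroup.centralizer (R : Set P))
  let n (R : Subgroup P) : ℕ := Nat.card (Subgroup.normalizer (R : Set P))
  obtain ⟨R, hR, hmax⟩ := Set.exists_max_image {R | F.Isomorphic Q R} (fun R => toLex (c R, n R))
    (Set.toFinite _) ⟨Q, Isomorphic.refl Q⟩
  have hle (R') (h : F.Isomorphic R R') : c R' < c R ∨ c R' = c R ∧ n R' ≤ n R :=
    Prod.Lex.toLex_le_toLex.1 (hmax R' (hR.trans h))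
  exact ⟨R, hR, fun R' h => (hle R' h).elim le_of_lt fun h => h.1.le,
    fun R' h hc => (hle R' h).elim (fun h => absurd hc h.not_ge) And.right⟩

variable [Fact p.Prime]

/-- A `p`-automorphism `τ` of `Q` normalizing `F_P(Q)` extends to a `p`-automorphism of `N_P(Q)`,
which is conjugation by an element of `P` up to an isomorphism from `N_P(Q)` to a fully automized
subgroup. By the maximality of `N_P(Q)` this element comes from `N_P(Q)`. -/
theorem FullyCentralized.fullyAutomized (hP : IsPGroup p P) (hF : F.IsFrobenius p)
    (hQ : F.FullyCentralized Q)
    (hn : ∀ R, F.Isomorphic Q R →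
      Nat.card (Subgroup.centralizer (Q : Set P)) ≤ Nat.card (Subgroup.centralizer (R : Set P)) →
      Nat.card (Subgroup.normalizer (R : Set P)) ≤ Nat.card (Subgroup.normalizer (Q : Set P)))
    (hN : F.Isomorphic (Subgroup.normalizer (Q : Set P)) N) (hNp : F.FullyAutomized p N) :
    F.FullyAutomized p Q := by
  have hSp : IsPGroup p ((conjAut Q).subgroupOf (F.aut Q)) :=
    (isPGroup_conjAut hP Q).of_equiv (Subgroup.subgroupOfEquivOfLe (conjAut_le_aut Q)).symm
  refine exists_sylow_eq_of_normalizer hSp ?_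
  rintro ⟨τ, hτ⟩ hτS ⟨a, ha⟩
  obtain ⟨γ, hγ, hγτ⟩ := hQ.exists_aut_normalizer hF hτ fun σ hσ =>
    (Subgroup.mem_normalizer_iff.1 hτS ⟨σ, conjAut_le_aut Q hσ⟩).1 hσ
  obtain ⟨k, hk, b, hb⟩ := exists_pow_pow_eq_one_of_modEq (Fact.out : p.Prime) γ a
  have hτk : τ ^ k = τ := by
    have h := pow_eq_pow_iff_modEq.2
      (hk.of_dvd (orderOf_dvd_of_pow_eq_one (congrArg Subtype.val ha)))
    exact h.trans (pow_one τ)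
  have hzp : IsPGroup p (Subgroup.zpowers (γ ^ k)) := by
    obtain ⟨j, -, hj⟩ := (Nat.dvd_prime_pow (Fact.out : p.Prime)).1 (orderOf_dvd_of_pow_eq_one hb)
    exact IsPGroup.of_card ((Nat.card_zpowers _).trans hj)
  obtain ⟨f, hf, -, hfx⟩ := hNp.exists_isMorOn_conj hN
    (by rw [Subgroup.zpowers_le]; exact pow_mem hγ k) hzp
  obtain ⟨x, -, hx⟩ := hfx _ (Subgroup.mem_zpowers _)
  refine mem_conjAut_of_conj hf hn (x := x) fun u => ?_
  have h := hx (Subgroup.inclusion Subgroup.le_normalizer u)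
  rwa [inclusion_pow_apply _ hγτ, hτk] at h

theorem exists_isomorphic_fullyAutomized (hP : IsPGroup p P) (hF : F.IsFrobenius p)
    (Q : Subgroup P) : ∃ R, F.Isomorphic Q R ∧ F.FullyCentralized R ∧ F.FullyAutomized p R := by
  induction hd : Nat.card P - Nat.card Q using Nat.strong_induction_on generalizing Q with
  | _ d ih =>
  by_cases hQ : Q = ⊤
  · exact ⟨⊤, hQ ▸ Isomorphic.refl Q, fullyCentralized_top, hF.sylow⟩
  obtain ⟨R, hQR, hR, hmax⟩ := exists_isomorphic_maximal (F := F) Q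
  have hlt : R < Subgroup.normalizer (R : Set P) := by
    have := hP.isNilpotent
    refine Group.normalizerCondition_of_isNilpotent _ (lt_top_iff_ne_top.2 ?_)
    rintro rfl
    exact hQ (Subgroup.eq_top_of_card_eq Q (hQR.card_eq.symm.trans Subgroup.card_top))
  have hcard : Nat.card Q < Nat.card (Subgroup.normalizer (R : Set P)) :=
    hQR.card_eq.symm.trans_lt (Set.ncard_lt_ncard hlt)
  have hle := Subgroup.card_le_card_group (Subgroup.normalizer (R : Set P))
  obtain ⟨N, hN, -, hNp⟩ := ih _ (by omega) (Subgroup.normalizer (R : Set P)) rfl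
  exact ⟨R, hQR, hR, hR.fullyAutomized hP hF hmax hN hNp⟩

theorem exists_isomorphic_receptive (hP : IsPGroup p P) (hF : F.IsFrobenius p) (Q : Subgroup P) :
    ∃ R, F.Isomorphic Q R ∧ F.FullyCentralized R ∧ ∀ R', F.Isomorphic R' R →
      ∃ α, F.IsMorOn α (Subgroup.normalizer (R' : Set P)) ∧ α '' R' = R := by
  obtain ⟨R, hQR, hR, hRp⟩ := exists_isomorphic_fullyAutomized hP hF Q
  refine ⟨R, hQR, hR, fun R' h => ?_⟩
  obtain ⟨f, hf, hfR, hfx⟩ := hRp.exists_isMorOn_conj h (conjAut_le_aut R') (isPGroup_conjAut hP R')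
  obtain ⟨α, hα, hαf⟩ := hR.exists_extension hF hf hfR
    (N := Subgroup.normalizer (R' : Set P)) fun x hx => ⟨hx, by
      obtain ⟨y, -, hy⟩ := hfx _ ⟨⟨x, hx⟩, rfl⟩
      exact ⟨y, fun u hu => hy ⟨u, hu⟩⟩⟩
  exact ⟨α, hα, (Set.image_congr hαf).trans hfR⟩

theorem exists_representatives (hP : IsPGroup p P) (hF : F.IsFrobenius p) :
    ∃ ρ : Subgroup P → Subgroup P, (∀ Q R, F.Isomorphic Q R → ρ Q = ρ R) ∧
      (∀ R : Subgroup P, ∃ α, F.IsMorOn α (Subgroup.normalizer (R : Set P)) ∧ α '' R = ρ R) ∧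
      ∀ R, F.FullyCentralized (ρ R) := by
  choose r hr hrc hrr using exists_isomorphic_receptive hP hF
  let s : Setoid (Subgroup P) :=
    ⟨F.Isomorphic, Isomorphic.refl, Isomorphic.symm, Isomorphic.trans⟩
  refine ⟨fun R => r (Quotient.mk s R).out, fun Q R h => ?_, fun R => hrr _ _ ?_, fun R => hrc _⟩
  · exact congrArg (fun q : Quotient s => r q.out) (Quotient.sound h)
  · exact (Quotient.mk_out (s := s) R).symm.trans (hr _)

end DivisibleCategory

namespace Burn

variable {G : Type u} [Group G] [Finite G]

theorem exists_map_conj_eq_of_indecClass_eq {K L : Subgroup G}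
    (h : Quotient.mk (indecSetoid G) K = Quotient.mk (indecSetoid G) L) :
    ∃ g : G, K.map (MulAut.conj g).toMonoidHom = L := by
  obtain ⟨e⟩ := Quotient.exact h
  have hKL : mark K (cls G (G ⧸ L)) ≠ 0 := cls_congr e ▸ mark_self_ne_zero K
  have hLK : mark L (cls G (G ⧸ K)) ≠ 0 := (cls_congr e).symm ▸ mark_self_ne_zero L
  obtain ⟨g, hg⟩ := exists_map_conj_le_of_mark_ne_zero hKL
  obtain ⟨g', hg'⟩ := exists_map_conj_le_of_mark_ne_zero hLK
  have hcard := Subgroup.card_le_of_le hg'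
  rw [Subgroup.card_map_of_injective (MulAut.conj g').injective] at hcard
  refine ⟨g, Subgroup.eq_of_le_of_card_ge hg ?_⟩
  rwa [Subgroup.card_map_of_injective (MulAut.conj g).injective]

theorem mark_eq_zero_of_card_lt {K L : Subgroup G} (h : Nat.card L < Nat.card K) :
    mark K (cls G (G ⧸ L)) = 0 := by
  by_contra hne
  obtain ⟨g, hg⟩ := exists_map_conj_le_of_mark_ne_zero hne
  have hcard := Subgroup.card_le_of_le hg
  rw [Subgroup.card_map_of_injective (MulAut.conj g).injective] at hcard
  exact hcard.not_gt h

/-- The marks of the transitive sets `G ⧸ D` with `|D| = n` at the subgroups of order `n` form a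
diagonal matrix. -/
theorem exists_mem_span_mark_eq {T : Set (Subgroup G)} {n : ℕ}
    (hT : ∀ D ∈ T, ∀ g : G, D.map (MulAut.conj g).toMonoidHom ∈ T)
    (hTn : ∀ D ∈ T, Nat.card D = n) {c : Subgroup G → ℤ}
    (hc : ∀ D ∈ T, ∀ g : G, c (D.map (MulAut.conj g).toMonoidHom) = c D)
    (hdvd : ∀ D ∈ T, mark D (cls G (G ⧸ D)) ∣ c D) :
    ∃ a ∈ Submodule.span ℤ ((fun D : Subgroup G => cls G (G ⧸ D)) '' T),
      (∀ D ∈ T, mark D a = c D) ∧ ∀ D : Subgroup G, n < Nat.card D → mark D a = 0 := by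
  classical
  let _ : Fintype (IndecClass G) := Fintype.ofFinite _
  let s : Finset (IndecClass G) := {q | Quotient.out q ∈ T}
  have hs {q} : q ∈ s ↔ Quotient.out q ∈ T := by simp [s]
  choose! k hk using hdvd
  let a : Burn G := ∑ q ∈ s, k (Quotient.out q) • cls G (G ⧸ Quotient.out q)
  have hmark (D) :
      mark D a = ∑ q ∈ s, k (Quotient.out q) • mark D (cls G (G ⧸ Quotient.out q)) := by
    simp only [a, map_sum, map_smul]
  refine ⟨a, Submodule.sum_mem _ fun q hq => Submodule.smul_mem _ _
    (Submodule.subset_span ⟨_, hs.1 hq, rfl⟩), fun D hD => ?_, fun D hD => ?_⟩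
  · obtain ⟨g, hg⟩ := exists_map_conj_eq_of_indecClass_eq
      (Quotient.out_eq (Quotient.mk (indecSetoid G) D)).symm
    rw [← hc D hD g, ← mark_conj g, hg]
    have hq := hg ▸ hT D hD g
    generalize Quotient.mk (indecSetoid G) D = q at hq
    have hne (r) (hr : r ∈ s) (hrq : r ≠ q) :
        k (Quotient.out r) • mark (Quotient.out q) (cls G (G ⧸ Quotient.out r)) = 0 := by
      refine smul_eq_zero_of_right _ (by_contra fun hm => hrq ?_)
      have hqr := indecClass_eq_of_mark_ne_zero hm (by rw [hTn _ (hs.1 hr), hTn _ hq])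
      rwa [Quotient.out_eq, Quotient.out_eq, eq_comm] at hqr
    rw [hmark, Finset.sum_eq_single q hne fun h => absurd (hs.2 hq) h, hk _ hq, smul_eq_mul,
      mul_comm]
  · rw [hmark]
    refine Finset.sum_eq_zero fun q hq => ?_
    rw [mark_eq_zero_of_card_lt (by rwa [hTn _ (hs.1 hq)]), smul_zero]

theorem mark_self_dvd_mark_sub {D : Subgroup G} (χ : Subgroup.normalizer (D : Set G) →* G)
    (a : Burn G)
    (h : ∀ E, D.subgroupOf (Subgroup.normalizer (D : Set G)) < E →
      mark (E.map χ) a = mark (E.map (Subgroup.subtype _)) a) :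
    mark D (cls G (G ⧸ D)) ∣
      mark ((D.subgroupOf (Subgroup.normalizer (D : Set G))).map χ) a - mark D a := by
  classical
  let N := Subgroup.normalizer (D : Set G)
  let _ : Fintype N := Fintype.ofFinite _
  let DN : Subgroup N := D.subgroupOf N
  have hDN : D ≤ N := Subgroup.le_normalizer
  have : DN.Normal := Subgroup.normal_in_normalizer
  have hterm (n : N) : mark ((DN ⊔ Subgroup.zpowers n).map χ) a -
      mark ((DN ⊔ Subgroup.zpowers n).map N.subtype) a =
        if n ∈ DN then mark (DN.map χ) a - mark D a else 0 := by
    split_ifs with hn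
    · rw [sup_eq_left.2 (Subgroup.zpowers_le.2 hn), Subgroup.map_subgroupOf_eq_of_le hDN]
    · exact sub_eq_zero.2 (h _ (left_lt_sup.2 fun hle => hn (Subgroup.zpowers_le.1 hle)))
  have hcard : (Finset.univ.filter (· ∈ DN)).card = Nat.card D := by
    rw [← Nat.card_congr (Subgroup.subgroupOfEquivOfLe hDN).toEquiv, Nat.card_eq_fintype_card]
    exact (Fintype.card_subtype _).symm
  have hdvd := dvd_sub (card_dvd_sum_mark χ DN a) (card_dvd_sum_mark N.subtype DN a)
  rw [← Finset.sum_sub_distrib, Finset.sum_congr rfl fun n _ => hterm n, ← Finset.sum_filter,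
    Finset.sum_const, hcard, nsmul_eq_mul, ← card_mul_mark_self D] at hdvd
  exact Int.dvd_of_mul_dvd_mul_left (Nat.cast_ne_zero.2 Nat.card_pos.ne') hdvd

end Burn

namespace DivisibleCategory

open Burn

variable {P : Type u} [Group P] {F : DivisibleCategory P}

theorem isGraph_iff_exists_isMorOn {D : Subgroup (P × P)} :
    F.IsGraph D ↔ ∃ f, F.IsMorOn f (D.map (MonoidHom.snd P P)) ∧ ∀ z ∈ D, f z.2 = z.1 := by
  constructor
  · rintro ⟨Q, φ, hφ, rfl⟩
    have hQ : (graphSubgroup φ).map (MonoidHom.snd P P) = Q := by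
      rw [graphSubgroup, MonoidHom.map_range, MonoidHom.snd_comp_prod, Subgroup.range_subtype]
    obtain ⟨f, hf, hφf⟩ := hφ.exists_isMorOn
    refine ⟨f, hQ.symm ▸ hf, ?_⟩
    rintro _ ⟨u, rfl⟩
    exact (hφf u).symm
  · rintro ⟨f, ⟨φ, hφ, hφf⟩, hD⟩
    refine ⟨_, φ, hφ, le_antisymm (fun z hz => ?_) ?_⟩
    · exact mem_graphSubgroup.2 ⟨⟨z, hz, rfl⟩, (hφf _).trans (hD z hz)⟩
    · rintro _ ⟨⟨_, z, hz, rfl⟩, rfl⟩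
      have hφz : φ ⟨z.2, z, hz, rfl⟩ = z.1 := (hφf _).trans (hD z hz)
      exact (congrArg (· ∈ D) (Prod.ext hφz rfl : (φ ⟨z.2, z, hz, rfl⟩, z.2) = z)).mpr hz

theorem IsGraph.exists_isMorOn_map_fst {D : Subgroup (P × P)} (hD : F.IsGraph D) :
    ∃ g, F.IsMorOn g (D.map (MonoidHom.fst P P)) ∧ ∀ z ∈ D, g z.1 = z.2 := by
  obtain ⟨f, hf, hfD⟩ := isGraph_iff_exists_isMorOn.1 hD
  obtain ⟨g, hg, hgf⟩ := hf.exists_inverse (R := D.map (MonoidHom.fst P P)) (by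
    rw [Subgroup.coe_map, Subgroup.coe_map, Set.image_image]
    exact Set.image_congr hfD)
  exact ⟨g, hg, fun z hz => (congrArg g (hfD z hz)).symm.trans (hgf _ ⟨z, hz, rfl⟩)⟩

theorem IsGraph.card_map_snd {D : Subgroup (P × P)} (hD : F.IsGraph D) :
    Nat.card (D.map (MonoidHom.snd P P)) = Nat.card D := by
  obtain ⟨f, -, hf⟩ := isGraph_iff_exists_isMorOn.1 hD
  exact Nat.card_image_of_injOn fun z hz w hw h =>
    Prod.ext ((hf z hz).symm.trans ((congrArg f h).trans (hf w hw))) h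

theorem IsGraph.card_map_fst {D : Subgroup (P × P)} (hD : F.IsGraph D) :
    Nat.card (D.map (MonoidHom.fst P P)) = Nat.card D := by
  obtain ⟨g, -, hg⟩ := hD.exists_isMorOn_map_fst
  exact Nat.card_image_of_injOn fun z hz w hw h =>
    Prod.ext h ((hg z hz).symm.trans ((congrArg g h).trans (hg w hw)))

variable (F) in
/-- Isomorphism, in the product category `F × F`, of the subgroups `D` and `D'` of `P × P`. -/
def ProdIsomorphic (D D' : Subgroup (P × P)) : Prop :=
  ∃ a b, F.IsMorOn a (D.map (MonoidHom.fst P P)) ∧ F.IsMorOn b (D.map (MonoidHom.snd P P)) ∧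
    Prod.map a b '' D = D'

namespace ProdIsomorphic

variable {D D' : Subgroup (P × P)} {a b : P → P}

theorem image_map_fst (h : Prod.map a b '' D = D') :
    a '' D.map (MonoidHom.fst P P) = D'.map (MonoidHom.fst P P) := by
  simp only [Subgroup.coe_map, ← h, Set.image_image]
  rfl

theorem image_map_snd (h : Prod.map a b '' D = D') :
    b '' D.map (MonoidHom.snd P P) = D'.map (MonoidHom.snd P P) := by
  simp only [Subgroup.coe_map, ← h, Set.image_image]
  rfl

theorem map_snd (h : F.ProdIsomorphic D D') :
    F.Isomorphic (D.map (MonoidHom.snd P P)) (D'.map (MonoidHom.snd P P)) := by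
  obtain ⟨a, b, -, hb, h⟩ := h
  exact ⟨b, hb, image_map_snd h⟩

theorem symm (h : F.ProdIsomorphic D D') : F.ProdIsomorphic D' D := by
  obtain ⟨a, b, ha, hb, h⟩ := h
  obtain ⟨a', ha', haa⟩ := ha.exists_inverse (image_map_fst h)
  obtain ⟨b', hb', hbb⟩ := hb.exists_inverse (image_map_snd h)
  refine ⟨a', b', ha', hb', ?_⟩
  rw [← h, Set.image_image]
  exact (Set.image_congr fun z hz =>
    Prod.ext (haa _ ⟨z, hz, rfl⟩) (hbb _ ⟨z, hz, rfl⟩)).trans (Set.image_id' _)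

theorem isGraph (h : F.ProdIsomorphic D D') (hD : F.IsGraph D) : F.IsGraph D' := by
  obtain ⟨a, b, ha, hb, h⟩ := h
  obtain ⟨f, hf, hfD⟩ := isGraph_iff_exists_isMorOn.1 hD
  obtain ⟨b', hb', hbb⟩ := hb.exists_inverse (image_map_snd h)
  have hmem {z} (hz : z ∈ D) : b' (b z.2) = z.2 := hbb _ ⟨z, hz, rfl⟩
  have hfD' : Set.MapsTo f (D.map (MonoidHom.snd P P)) (D.map (MonoidHom.fst P P)) := by
    rintro _ ⟨z, hz, rfl⟩
    exact ⟨z, hz, (hfD z hz).symm⟩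
  have hbD : Set.MapsTo b' (D'.map (MonoidHom.snd P P)) (D.map (MonoidHom.snd P P)) := by
    rw [← image_map_snd h]
    rintro _ ⟨_, ⟨z, hz, rfl⟩, rfl⟩
    exact ⟨z, hz, (hmem hz).symm⟩
  refine isGraph_iff_exists_isMorOn.2 ⟨a ∘ f ∘ b', ha.comp (hf.comp hb' hbD) (hfD'.comp hbD), ?_⟩
  intro w hw
  obtain ⟨z, hz, rfl⟩ := h.symm.subset hw
  change a (f (b' (b z.2))) = a z.1
  rw [hmem hz, hfD z hz]

theorem card_eq (h : F.ProdIsomorphic D D') : Nat.card D' = Nat.card D := by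
  obtain ⟨a, b, ha, hb, h⟩ := h
  have hinj : Set.InjOn (Prod.map a b) D := fun z hz w hw hzw =>
    Prod.ext (ha.injOn ⟨z, hz, rfl⟩ ⟨w, hw, rfl⟩ (congrArg Prod.fst hzw))
      (hb.injOn ⟨z, hz, rfl⟩ ⟨w, hw, rfl⟩ (congrArg Prod.snd hzw))
  have hcard := Nat.card_image_of_injOn hinj
  rwa [h] at hcard

theorem conj (D : Subgroup (P × P)) (g : P × P) :
    F.ProdIsomorphic D (D.map (MulAut.conj g).toMonoidHom) :=
  ⟨_, _, IsMorOn.conj _ g.1, IsMorOn.conj _ g.2, rfl⟩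

end ProdIsomorphic

/-- The diagonal subgroup `{(u, u) | u ∈ R}` of `P × P`. -/
def diag (R : Subgroup P) : Subgroup (P × P) :=
  R.map ((MonoidHom.id P).prod (MonoidHom.id P))

theorem coe_diag (R : Subgroup P) : (diag R : Set (P × P)) = (fun u => (u, u)) '' (R : Set P) :=
  rfl

section Stabilization

variable [Finite P] {p : ℕ}

theorem FullyCentralized.exists_isMorOn_normalizer_map_fst (hF : F.IsFrobenius p) {R : Subgroup P}
    (hR : F.FullyCentralized R) {D : Subgroup (P × P)} (hD : F.IsGraph D) {b : P → P}
    (hb : F.IsMorOn b (Subgroup.normalizer (D.map (MonoidHom.snd P P))))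
    (hbR : b '' D.map (MonoidHom.snd P P) = R) :
    ∃ a, F.IsMorOn a ((Subgroup.normalizer D).map (MonoidHom.fst P P)) ∧
      Prod.map a b '' D = diag R := by
  obtain ⟨g, hg, hgD⟩ := hD.exists_isMorOn_map_fst
  have hbg : Set.MapsTo g (D.map (MonoidHom.fst P P)) (D.map (MonoidHom.snd P P)) := by
    rintro _ ⟨z, hz, rfl⟩
    exact ⟨z, hz, (hgD z hz).symm⟩
  have hbgR : (b ∘ g) '' D.map (MonoidHom.fst P P) = R := by
    rw [← hbR, Subgroup.coe_map, Subgroup.coe_map, Set.image_image, Set.image_image]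
    exact Set.image_congr fun z hz => congrArg b (hgD z hz)
  have hN : ∀ x ∈ (Subgroup.normalizer D).map (MonoidHom.fst P P),
      x ∈ Subgroup.normalizer (D.map (MonoidHom.fst P P)) ∧
        ∃ y, ∀ u ∈ D.map (MonoidHom.fst P P), (b ∘ g) (x * u * x⁻¹) = y * (b ∘ g) u * y⁻¹ := by
    rintro _ ⟨n, hn, rfl⟩
    have hn₂ := Subgroup.le_normalizer_map (MonoidHom.snd P P) ⟨n, hn, rfl⟩
    refine ⟨Subgroup.le_normalizer_map _ ⟨n, hn, rfl⟩, b n.2, ?_⟩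
    rintro _ ⟨z, hz, rfl⟩
    change b (g (n * z * n⁻¹).1) = b n.2 * b (g z.1) * (b n.2)⁻¹
    rw [hgD _ ((Subgroup.mem_normalizer_iff.1 hn z).1 hz), hgD z hz]
    exact hb.map_conj hn₂ (Subgroup.le_normalizer ⟨z, hz, rfl⟩)
  obtain ⟨a, ha, hag⟩ := hR.exists_extension hF
    ((hb.mono Subgroup.le_normalizer).comp hg hbg) hbgR hN
  refine ⟨a, ha, ?_⟩
  rw [coe_diag, ← hbR, Subgroup.coe_map, Set.image_image, Set.image_image]
  refine Set.image_congr fun z hz => Prod.ext ((hag _ ⟨z, hz, rfl⟩).trans ?_) rfl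
  exact congrArg b (hgD z hz)

theorem mark_self_dvd_mark_sub_of_isMorOn (f : F.hecke) {D D' : Subgroup (P × P)} {a b : P → P}
    (ha : F.IsMorOn a ((Subgroup.normalizer D).map (MonoidHom.fst P P)))
    (hb : F.IsMorOn b ((Subgroup.normalizer D).map (MonoidHom.snd P P)))
    (hab : Prod.map a b '' D = D')
    (hf : ∀ E E', F.IsGraph E → Nat.card D < Nat.card E → F.ProdIsomorphic E E' →
      mark E (DBurn.toBurn (f : DBurn P)) = mark E' (DBurn.toBurn (f : DBurn P))) :
    mark D (cls (P × P) ((P × P) ⧸ D)) ∣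
      mark D' (DBurn.toBurn (f : DBurn P)) - mark D (DBurn.toBurn (f : DBurn P)) := by
  let N := Subgroup.normalizer (D : Set (P × P))
  have hDN : (D.subgroupOf N).map N.subtype = D :=
    Subgroup.map_subgroupOf_eq_of_le Subgroup.le_normalizer
  obtain ⟨φ, -, hφ⟩ := id ha
  obtain ⟨ψ, -, hψ⟩ := id hb
  let χ : N →* P × P :=
    (φ.comp ((MonoidHom.fst P P).subgroupMap N)).prod (ψ.comp ((MonoidHom.snd P P).subgroupMap N))
  have hχ (E : Subgroup N) : Prod.map a b '' E.map N.subtype = E.map χ := by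
    rw [Subgroup.coe_map, Subgroup.coe_map, Set.image_image]
    exact Set.image_congr fun n _ => Prod.ext (hφ ((MonoidHom.fst P P).subgroupMap N n)).symm
      (hψ ((MonoidHom.snd P P).subgroupMap N n)).symm
  have hiso (E : Subgroup N) : F.ProdIsomorphic (E.map N.subtype) (E.map χ) :=
    have hE : E.map N.subtype ≤ N := Subgroup.map_subtype_le E
    ⟨a, b, ha.mono (Subgroup.map_mono hE), hb.mono (Subgroup.map_mono hE), hχ E⟩
  have hD' : (D.subgroupOf N).map χ = D' := SetLike.coe_injective (by rw [← hχ, hDN, hab])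
  rw [← hD']
  refine mark_self_dvd_mark_sub χ _ fun E hE => ?_
  by_cases hg : F.IsGraph (E.map N.subtype)
  · have hlt : D < E.map N.subtype := hDN ▸ Subgroup.map_subtype_lt_map_subtype.2 hE
    exact (hf _ _ hg (Set.ncard_lt_ncard hlt (Set.toFinite _)) (hiso E)).symm
  · rw [mark_eq_zero_of_not_isGraph f hg,
      mark_eq_zero_of_not_isGraph f fun h => hg ((hiso E).symm.isGraph h)]

/-- The marks at the graphs of order `n` can be prescribed, modulo the marks `|N(D)| / |D|` of the
transitive sets, without changing the marks at the graphs of larger order. -/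
theorem exists_hecke_mark_eq (f : F.hecke) (n : ℕ) (c : Subgroup (P × P) → ℤ)
    (hc : ∀ D, F.IsGraph D → Nat.card D = n → mark D (cls (P × P) ((P × P) ⧸ D)) ∣
      c D - mark D (DBurn.toBurn (f : DBurn P)))
    (hconj : ∀ D g, F.IsGraph D → c (D.map (MulAut.conj g).toMonoidHom) = c D) :
    ∃ f' : F.hecke, (∀ D, F.IsGraph D → Nat.card D = n →
        mark D (DBurn.toBurn (f' : DBurn P)) = c D) ∧
      ∀ D : Subgroup (P × P), n < Nat.card D →
        mark D (DBurn.toBurn (f' : DBurn P)) = mark D (DBurn.toBurn (f : DBurn P)) := by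
  obtain ⟨a, ha, haT, han⟩ := exists_mem_span_mark_eq
    (T := {D : Subgroup (P × P) | F.IsGraph D ∧ Nat.card D = n}) (n := n)
    (fun D hD g => ⟨(ProdIsomorphic.conj D g).isGraph hD.1,
      (ProdIsomorphic.conj (F := F) D g).card_eq.trans hD.2⟩) (fun D hD => hD.2)
    (fun D hD g => by rw [hconj D g hD.1, mark_conj]) fun D hD => hc D hD.1 hD.2
  have hmem : DBurn.toBurn.symm a ∈ F.heckeModule := by
    refine (Submodule.span_le (p := F.heckeModule.comap DBurn.toBurn.symm.toLinearMap)).2 ?_ ha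
    rintro _ ⟨D, ⟨⟨Q, φ, hφ, rfl⟩, -⟩, rfl⟩
    exact Submodule.subset_span ⟨Q, φ, hφ, rfl⟩
  have hmark (D) : mark D (DBurn.toBurn ((f + ⟨_, hmem⟩ : F.hecke) : DBurn P)) =
      mark D (DBurn.toBurn (f : DBurn P)) + mark D a := by
    rw [AddMemClass.coe_add, map_add, map_add, LinearEquiv.apply_symm_apply]
  refine ⟨f + ⟨_, hmem⟩, fun D hD hDn => ?_, fun D hD => ?_⟩
  · rw [hmark, haT D ⟨hD, hDn⟩, add_sub_cancel]
  · rw [hmark, han D hD, add_zero]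

theorem IsGraph.card_le {D : Subgroup (P × P)} (hD : F.IsGraph D) : Nat.card D ≤ Nat.card P :=
  hD.card_map_snd ▸ Subgroup.card_le_card_group _

theorem IsGraph.mk_one_mem_normalizer_iff {D : Subgroup (P × P)} (hD : F.IsGraph D)
    (htop : D.map (MonoidHom.fst P P) = ⊤) {x : P} :
    (x, 1) ∈ Subgroup.normalizer (D : Set (P × P)) ↔ x ∈ Subgroup.center P := by
  obtain ⟨f, -, hf⟩ := isGraph_iff_exists_isMorOn.1 hD
  have hconj (z : P × P) : (x, 1) * z * (x, 1)⁻¹ = (x * z.1 * x⁻¹, z.2) := by ext <;> simp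
  constructor
  · intro hx
    refine Subgroup.mem_center_iff.2 fun y => ?_
    obtain ⟨z, hz, rfl⟩ : y ∈ D.map (MonoidHom.fst P P) := htop ▸ Subgroup.mem_top y
    have hzx := hf _ (hconj z ▸ (Subgroup.mem_normalizer_iff.1 hx z).1 hz)
    exact eq_mul_inv_iff_mul_eq.1 ((hf z hz).symm.trans hzx)
  · refine fun hx => Subgroup.mem_normalizer_fintype fun z hz => ?_
    rwa [hconj, ← Subgroup.mem_center_iff.1 hx z.1, mul_inv_cancel_right]

/-- The normalizer of the graph of an automorphism of `P` projects onto the second factor with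
kernel `Z(P) × 1`. -/
theorem IsGraph.mark_self_of_card_eq {D : Subgroup (P × P)} (hD : F.IsGraph D)
    (hcard : Nat.card D = Nat.card P) :
    mark D (cls (P × P) ((P × P) ⧸ D)) = Nat.card (Subgroup.center P) := by
  have hfst := Subgroup.eq_top_of_card_eq _ (hD.card_map_fst.trans hcard)
  have hsnd := Subgroup.eq_top_of_card_eq _ (hD.card_map_snd.trans hcard)
  let N := Subgroup.normalizer (D : Set (P × P))
  let π : N →* P := (MonoidHom.snd P P).comp N.subtype
  have hrange : π.range = ⊤ := by
    rw [MonoidHom.range_comp, Subgroup.range_subtype, eq_top_iff, ← hsnd]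
    exact Subgroup.map_mono Subgroup.le_normalizer
  have hker : Nat.card π.ker = Nat.card (Subgroup.center P) :=
    Nat.card_congr
      { toFun n := ⟨n.1.1.1, (hD.mk_one_mem_normalizer_iff hfst).1 <| by
          have hn : (n.1.1.1, 1) = n.1.1 := Prod.ext rfl n.2.symm
          exact hn ▸ n.1.2⟩
        invFun x := ⟨⟨(x, 1), (hD.mk_one_mem_normalizer_iff hfst).2 x.2⟩, rfl⟩
        left_inv n := Subtype.ext (Subtype.ext (Prod.ext rfl n.2.symm))
        right_inv _ := rfl }
  have hN : Nat.card N = Nat.card D * Nat.card (Subgroup.center P) := by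
    rw [← π.ker.card_mul_index, hker, Subgroup.index_ker, hrange, Subgroup.card_top, hcard,
      mul_comm]
  have hmark := card_mul_mark_self D
  rw [hN, Nat.cast_mul] at hmark
  exact mul_left_cancel₀ (Nat.cast_ne_zero.2 Nat.card_pos.ne') hmark

variable [Fact p.Prime]

theorem exists_hecke_mark_eq_of_le (hP : IsPGroup p P) (hF : F.IsFrobenius p) (f : F.hecke) {n : ℕ}
    (hf : ∀ D D', F.IsGraph D → n < Nat.card D → F.ProdIsomorphic D D' →
      mark D (DBurn.toBurn (f : DBurn P)) = mark D' (DBurn.toBurn (f : DBurn P))) :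
    ∃ f' : F.hecke, (∀ D D', F.IsGraph D → n ≤ Nat.card D → F.ProdIsomorphic D D' →
        mark D (DBurn.toBurn (f' : DBurn P)) = mark D' (DBurn.toBurn (f' : DBurn P))) ∧
      ∀ D : Subgroup (P × P), n < Nat.card D →
        mark D (DBurn.toBurn (f' : DBurn P)) = mark D (DBurn.toBurn (f : DBurn P)) := by
  obtain ⟨ρ, hρ, hρN, hρC⟩ := exists_representatives hP hF
  let c (D : Subgroup (P × P)) : ℤ :=
    mark (diag (ρ (D.map (MonoidHom.snd P P)))) (DBurn.toBurn (f : DBurn P))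
  have hc {D D'} (h : F.ProdIsomorphic D D') : c D = c D' := by simp only [c, hρ _ _ h.map_snd]
  have hdvd (D) (hD : F.IsGraph D) (hDn : Nat.card D = n) :
      mark D (cls (P × P) ((P × P) ⧸ D)) ∣ c D - mark D (DBurn.toBurn (f : DBurn P)) := by
    obtain ⟨b, hb, hbR⟩ := hρN (D.map (MonoidHom.snd P P))
    obtain ⟨a, ha, hab⟩ := (hρC _).exists_isMorOn_normalizer_map_fst hF hD hb hbR
    exact mark_self_dvd_mark_sub_of_isMorOn f ha (hb.mono (Subgroup.le_normalizer_map _)) hab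
      fun E E' hE hlt => hf E E' hE (hDn ▸ hlt)
  obtain ⟨f', hn, hlt⟩ := exists_hecke_mark_eq f n c hdvd
    fun D g _ => (hc (ProdIsomorphic.conj D g)).symm
  refine ⟨f', fun D D' hD hle h => ?_, hlt⟩
  rcases hle.eq_or_lt with hDn | hDn
  · rw [hn D hD hDn.symm, hn D' (h.isGraph hD) (h.card_eq.trans hDn.symm), hc h]
  · rw [hlt D hDn, hlt D' (h.card_eq.symm ▸ hDn), hf D D' hD hDn h]

/-- Starting from the graphs of the automorphisms of `P`, the marks are made invariant by
descending induction on the order of the graphs. -/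
theorem exists_hecke_mark_invariant (hP : IsPGroup p P) (hF : F.IsFrobenius p) :
    ∃ f : F.hecke, (∀ D D', F.IsGraph D → F.ProdIsomorphic D D' →
        mark D (DBurn.toBurn (f : DBurn P)) = mark D' (DBurn.toBurn (f : DBurn P))) ∧
      ∀ D, F.IsGraph D → Nat.card D = Nat.card P →
        mark D (DBurn.toBurn (f : DBurn P)) = Nat.card (Subgroup.center P) := by
  suffices h : ∀ n ≤ Nat.card P, ∃ f : F.hecke,
      (∀ D D', F.IsGraph D → n ≤ Nat.card D → F.ProdIsomorphic D D' →
        mark D (DBurn.toBurn (f : DBurn P)) = mark D' (DBurn.toBurn (f : DBurn P))) ∧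
      ∀ D, F.IsGraph D → Nat.card D = Nat.card P →
        mark D (DBurn.toBurn (f : DBurn P)) = Nat.card (Subgroup.center P) by
    obtain ⟨f, hf, hfP⟩ := h 0 (Nat.zero_le _)
    exact ⟨f, fun D D' hD => hf D D' hD (Nat.zero_le _), hfP⟩
  intro n hn
  induction hn using Nat.decreasingInduction with
  | self =>
    obtain ⟨f, hf, -⟩ := exists_hecke_mark_eq (0 : F.hecke) (Nat.card P)
      (fun _ => Nat.card (Subgroup.center P))
      (fun D hD hcard => by simp [hD.mark_self_of_card_eq hcard]) fun _ _ _ => rfl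
    refine ⟨f, fun D D' hD hle h => ?_, hf⟩
    have hcard := le_antisymm hD.card_le hle
    rw [hf D hD hcard, hf D' (h.isGraph hD) (h.card_eq.trans hcard)]
  | of_succ n hn ih =>
    obtain ⟨f, hf, hfP⟩ := ih
    obtain ⟨f', hf', hlt⟩ := exists_hecke_mark_eq_of_le hP hF f hf
    exact ⟨f', hf', fun D hD hcard => by rw [hlt D (hcard ▸ hn), hfP D hD hcard]⟩

end Stabilization

section ProdIsomorphic

variable {D D' : Subgroup (P × P)}

theorem IsMorOn.exists_prodIsomorphic {a b : P → P}
    (ha : F.IsMorOn a (D.map (MonoidHom.fst P P)))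
    (hb : F.IsMorOn b (D.map (MonoidHom.snd P P))) :
    ∃ D' : Subgroup (P × P), Prod.map a b '' D = D' := by
  obtain ⟨φ, -, hφ⟩ := ha
  obtain ⟨ψ, -, hψ⟩ := hb
  refine ⟨((φ.comp ((MonoidHom.fst P P).subgroupMap D)).prod
    (ψ.comp ((MonoidHom.snd P P).subgroupMap D))).range, ?_⟩
  rw [MonoidHom.coe_range, Set.image_eq_range]
  exact congrArg Set.range (funext fun z => Prod.ext
    (hφ ((MonoidHom.fst P P).subgroupMap D z)).symm
    (hψ ((MonoidHom.snd P P).subgroupMap D z)).symm)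

theorem map_fst_map_prodComm (D : Subgroup (P × P)) :
    (D.map (MulEquiv.prodComm : P × P ≃* P × P).toMonoidHom).map (MonoidHom.fst P P) =
      D.map (MonoidHom.snd P P) :=
  Subgroup.map_map _ _ _

theorem map_snd_map_prodComm (D : Subgroup (P × P)) :
    (D.map (MulEquiv.prodComm : P × P ≃* P × P).toMonoidHom).map (MonoidHom.snd P P) =
      D.map (MonoidHom.fst P P) :=
  Subgroup.map_map _ _ _

theorem map_prodComm_map_prodComm (D : Subgroup (P × P)) :
    (D.map (MulEquiv.prodComm : P × P ≃* P × P).toMonoidHom).map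
      (MulEquiv.prodComm : P × P ≃* P × P).toMonoidHom = D :=
  (Subgroup.map_map _ _ _).trans (Subgroup.map_id D)

theorem image_map_prodComm {a b : P → P} (h : Prod.map a b '' D = D') :
    Prod.map b a '' D.map (MulEquiv.prodComm : P × P ≃* P × P).toMonoidHom =
      D'.map (MulEquiv.prodComm : P × P ≃* P × P).toMonoidHom := by
  simp only [Subgroup.coe_map, ← h, Set.image_image]
  rfl

namespace ProdIsomorphic

theorem map_fst (h : F.ProdIsomorphic D D') :
    F.Isomorphic (D.map (MonoidHom.fst P P)) (D'.map (MonoidHom.fst P P)) := by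
  obtain ⟨a, b, ha, -, h⟩ := h
  exact ⟨a, ha, image_map_fst h⟩

theorem map_prodComm (h : F.ProdIsomorphic D D') :
    F.ProdIsomorphic (D.map (MulEquiv.prodComm : P × P ≃* P × P).toMonoidHom)
      (D'.map (MulEquiv.prodComm : P × P ≃* P × P).toMonoidHom) := by
  obtain ⟨a, b, ha, hb, h⟩ := h
  exact ⟨b, a, (map_fst_map_prodComm D).symm ▸ hb, (map_snd_map_prodComm D).symm ▸ ha,
    image_map_prodComm h⟩

end ProdIsomorphic

theorem isGraph_diag (R : Subgroup P) : F.IsGraph (diag R) := by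
  refine isGraph_iff_exists_isMorOn.2 ⟨id, IsMorOn.id _, ?_⟩
  rintro _ ⟨u, -, rfl⟩
  rfl

theorem map_fst_diag (R : Subgroup P) : (diag R).map (MonoidHom.fst P P) = R :=
  (Subgroup.map_map _ _ _).trans (Subgroup.map_id R)

theorem map_snd_diag (R : Subgroup P) : (diag R).map (MonoidHom.snd P P) = R :=
  (Subgroup.map_map _ _ _).trans (Subgroup.map_id R)

theorem IsMor.prodIsomorphic_coGraph {R : Subgroup P} {ψ : R →* P} (hψ : F.IsMor ψ) :
    F.ProdIsomorphic (diag R) (coGraph ψ) := by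
  obtain ⟨b, hb, hψb⟩ := hψ.exists_isMorOn
  refine ⟨id, b, IsMorOn.id _, (map_snd_diag R).symm ▸ hb, ?_⟩
  rw [coe_diag, Set.image_image, Set.image_eq_range, coGraph, MonoidHom.coe_range]
  exact congrArg Set.range (funext fun u => Prod.ext rfl (hψb u).symm)

theorem isMor_of_isGraph_coGraph {R : Subgroup P} {ψ : R →* P} (h : F.IsGraph (coGraph ψ)) :
    F.IsMor ψ := by
  obtain ⟨g, hg, hgψ⟩ := h.exists_isMorOn_map_fst
  rw [map_fst_coGraph] at hg
  obtain ⟨φ, hφ, hφg⟩ := hg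
  have hψφ : ψ = φ := MonoidHom.ext fun u => ((hφg u).trans (hgψ _ ⟨u, rfl⟩)).symm
  exact hψφ ▸ hφ

theorem IsGraph.prodIsomorphic_diag (hD : F.IsGraph D) :
    F.ProdIsomorphic (diag (D.map (MonoidHom.snd P P))) D := by
  obtain ⟨f, hf, hfD⟩ := isGraph_iff_exists_isMorOn.1 hD
  refine ⟨f, id, by rwa [map_fst_diag], IsMorOn.id _, ?_⟩
  rw [coe_diag, Subgroup.coe_map, Set.image_image, Set.image_image]
  have hz (z : P × P) (hz : z ∈ (D : Set (P × P))) : Prod.map f id (z.2, z.2) = z :=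
    Prod.ext (hfD z hz) rfl
  exact (Set.image_congr hz).trans (Set.image_id' _)

theorem IsGraph.isomorphic_map_snd_map_fst (hD : F.IsGraph D) :
    F.Isomorphic (D.map (MonoidHom.snd P P)) (D.map (MonoidHom.fst P P)) := by
  have h := hD.prodIsomorphic_diag.map_fst
  rwa [map_fst_diag] at h

end ProdIsomorphic

section Invariants

variable [Finite P]

theorem forall_comp_res_eq_iff {x : Burn (P × P)} :
    (∀ (Q : Subgroup P) (φ : Q →* P), F.IsMor φ → comp (res φ) x = comp (res Q.subtype) x) ↔
      ∀ (D D' : Subgroup (P × P)) (a : P → P), F.IsMorOn a (D.map (MonoidHom.fst P P)) →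
        Prod.map a (id : P → P) '' D = D' → mark D x = mark D' x := by
  constructor
  · rintro hx D D' a ⟨φ, hφ, hφa⟩ hD'
    let E : Subgroup (D.map (MonoidHom.fst P P) × P) :=
      D.comap ((Subgroup.subtype _).prodMap (MonoidHom.id P))
    have hE : E.map ((Subgroup.subtype _).prodMap (MonoidHom.id P)) = D :=
      Subgroup.map_comap_eq_self fun z hz => ⟨(⟨z.1, z, hz, rfl⟩, z.2), rfl⟩
    have hEφ : E.map (φ.prodMap (MonoidHom.id P)) = D' := by
      refine SetLike.coe_injective (Eq.trans ?_ hD')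
      conv_rhs => rw [← hE]
      rw [Subgroup.coe_map, Subgroup.coe_map, Set.image_image]
      exact Set.image_congr fun z _ => Prod.ext (hφa z.1) rfl
    have h := congrArg (mark E) (hx _ φ hφ)
    rwa [mark_comp_res, mark_comp_res, hE, hEφ, eq_comm] at h
  · intro hx Q φ hφ
    obtain ⟨a, ha, hφa⟩ := hφ.exists_isMorOn
    refine ext_mark fun E => ?_
    rw [mark_comp_res, mark_comp_res]
    refine (hx _ _ a (ha.mono ?_) ?_).symm
    · rintro _ ⟨_, ⟨z, -, rfl⟩, rfl⟩
      exact z.1.2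
    · rw [Subgroup.coe_map, Subgroup.coe_map, Set.image_image]
      exact Set.image_congr fun z _ => Prod.ext (hφa z.1).symm rfl

theorem mem_heckeInv_iff {f : F.hecke} : f ∈ F.heckeInv ↔
    ∀ D D', F.IsGraph D → F.ProdIsomorphic D D' →
      mark D (DBurn.toBurn (f : DBurn P)) = mark D' (DBurn.toBurn (f : DBurn P)) := by
  have hiff : f ∈ F.heckeInv ↔ _ ∧ _ :=
    ⟨fun hf => ⟨fun Q φ hφ => (hf Q φ hφ).1, fun Q φ hφ => (hf Q φ hφ).2⟩,
      fun hf Q φ hφ => ⟨hf.1 Q φ hφ, hf.2 Q φ hφ⟩⟩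
  rw [hiff, forall_comp_res_eq_iff, forall_comp_res_eq_iff]
  simp only [mark_opp]
  constructor
  · rintro ⟨hfst, hsnd⟩ D D' - ⟨a, b, ha, hb, hD'⟩
    obtain ⟨E, hE⟩ := ha.exists_prodIsomorphic (IsMorOn.id (D.map (MonoidHom.snd P P)))
    have hED' : Prod.map (id : P → P) b '' E = D' := by
      rw [← hE, Set.image_image, ← hD']
      rfl
    have hEsnd := ProdIsomorphic.image_map_snd hE
    rw [Set.image_id, SetLike.coe_set_eq] at hEsnd
    have h := hsnd _ _ b (by rwa [map_fst_map_prodComm, ← hEsnd]) (image_map_prodComm hED')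
    rw [map_prodComm_map_prodComm, map_prodComm_map_prodComm] at h
    exact (hfst D E a ha hE).trans h
  · intro hf
    have hiso (D D') (h : F.ProdIsomorphic D D') :
        mark D (DBurn.toBurn (f : DBurn P)) = mark D' (DBurn.toBurn (f : DBurn P)) := by
      by_cases hD : F.IsGraph D
      · exact hf D D' hD h
      · rw [mark_eq_zero_of_not_isGraph f hD,
          mark_eq_zero_of_not_isGraph f fun hD' => hD (h.symm.isGraph hD')]
    exact ⟨fun D D' a ha h => hiso D D' ⟨a, id, ha, IsMorOn.id _, h⟩, fun D D' a ha h =>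
      hiso _ _ (ProdIsomorphic.map_prodComm ⟨a, id, ha, IsMorOn.id _, h⟩)⟩

theorem mem_burnInv_iff {s : Burn P} :
    s ∈ F.burnInv ↔ ∀ Q R, F.Isomorphic Q R → mark Q s = mark R s := by
  constructor
  · rintro hs Q R ⟨f, ⟨φ, hφ, hφf⟩, hR⟩
    have hφR : (⊤ : Subgroup Q).map φ = R := by
      refine SetLike.coe_injective ?_
      rw [← hR, Subgroup.coe_map, Subgroup.coe_top, Set.image_univ, Set.image_eq_range]
      exact congrArg Set.range (funext hφf)
    have h := congrArg (mark ⊤) (hs Q φ hφ)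
    rwa [mark_act_res, mark_act_res, hφR, ← MonoidHom.range_eq_map, Subgroup.range_subtype,
      eq_comm] at h
  · intro hs Q φ hφ
    obtain ⟨f, hf, hφf⟩ := hφ.exists_isMorOn
    refine ext_mark fun R => ?_
    rw [mark_act_res, mark_act_res]
    refine (hs _ _ ⟨f, hf.mono (Subgroup.map_subtype_le R), ?_⟩).symm
    rw [Subgroup.coe_map, Subgroup.coe_map, Set.image_image]
    exact Set.image_congr fun u _ => (hφf u).symm

variable (F) in
/-- The invariant elements `(B_P)^F` of the Burnside algebra, as a subalgebra. -/
def burnInvSubalgebra : Subalgebra ℤ (Burn P) :=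
  F.burnInv.toSubalgebra
    (mem_burnInv_iff.2 fun Q R _ => by rw [mark_one, mark_one])
    fun s t hs ht => mem_burnInv_iff.2 fun Q R h => by
      rw [mark_mul, mark_mul, mem_burnInv_iff.1 hs Q R h, mem_burnInv_iff.1 ht Q R h]

theorem eval_mul (h k : F.hecke) :
    F.eval (h * k) = act (DBurn.toBurn (h : DBurn P)) (F.eval k) :=
  act_comp _ _ 1

theorem eval_mulHecke_mul (s : Burn P) (k : F.hecke) :
    F.eval (F.mulHecke s * k) = s * F.eval k :=
  (eval_mul _ k).trans (act_mulMap s _)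

theorem eval_mulHecke (s : Burn P) : F.eval (F.mulHecke s) = s :=
  (act_mulMap s 1).trans (mul_one s)

theorem eval_one : F.eval 1 = 1 := by
  have h := eval_mul 1 (F.mulHecke 1)
  rw [one_mul, eval_mulHecke] at h
  exact h.symm

theorem eval_mem_burnInv {f : F.hecke} (hf : f ∈ F.heckeInv) : F.eval f ∈ F.burnInv := by
  intro Q φ hφ
  change act (res φ) (act (DBurn.toBurn (f : DBurn P)) 1) =
    act (res Q.subtype) (act (DBurn.toBurn (f : DBurn P)) 1)
  rw [← act_comp, ← act_comp, (hf Q φ hφ).1]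

theorem mark_mulHecke_mul (s : Burn P) (f : F.hecke) (D : Subgroup (P × P)) :
    mark D (DBurn.toBurn ((F.mulHecke s * f : F.hecke) : DBurn P)) =
      mark (D.map (MonoidHom.fst P P)) s * mark D (DBurn.toBurn (f : DBurn P)) :=
  mark_mulMap_comp D s _

theorem mark_mul_mulHecke (s : Burn P) (f : F.hecke) (D : Subgroup (P × P)) :
    mark D (DBurn.toBurn ((f * F.mulHecke s : F.hecke) : DBurn P)) =
      mark (D.map (MonoidHom.snd P P)) s * mark D (DBurn.toBurn (f : DBurn P)) :=
  mark_comp_mulMap D s _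

theorem mulHecke_mul_mem {s : Burn P} (hs : s ∈ F.burnInv) {f : F.hecke} (hf : f ∈ F.heckeInv) :
    F.mulHecke s * f ∈ F.heckeInv := by
  refine mem_heckeInv_iff.2 fun D D' hD h => ?_
  rw [mark_mulHecke_mul, mark_mulHecke_mul, mem_burnInv_iff.1 hs _ _ h.map_fst,
    mem_heckeInv_iff.1 hf D D' hD h]

theorem mul_mem_heckeInv {f f' : F.hecke} (hf : f ∈ F.heckeInv) (hf' : f' ∈ F.heckeInv) :
    f * f' ∈ F.heckeInv :=
  mul_eq_mulHecke_eval_mul f hf' ▸ mulHecke_mul_mem (eval_mem_burnInv hf) hf'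

theorem eval_mul_of_mem_heckeInv (h : F.hecke) {f : F.hecke} (hf : f ∈ F.heckeInv) :
    F.eval (h * f) = F.eval h * F.eval f := by
  rw [mul_eq_mulHecke_eval_mul h hf, eval_mulHecke_mul]

theorem mul_mulHecke_comm (f : F.hecke) {s : Burn P} (hs : s ∈ F.burnInv) :
    f * F.mulHecke s = F.mulHecke s * f := by
  refine Subtype.ext (DBurn.toBurn.injective (ext_mark fun D => ?_))
  rw [mark_mul_mulHecke, mark_mulHecke_mul]
  by_cases hD : F.IsGraph D
  · rw [mem_burnInv_iff.1 hs _ _ hD.isomorphic_map_snd_map_fst]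
  · rw [mark_eq_zero_of_not_isGraph f hD, mul_zero, mul_zero]

theorem card_mul_mark_eval_of_mem_heckeInv {f : F.hecke} (hf : f ∈ F.heckeInv) (R : Subgroup P) :
    (Nat.card P : ℤ) * mark R (F.eval f) =
      Nat.card {ψ : R →* P // F.IsMor ψ} * mark (diag R) (DBurn.toBurn (f : DBurn P)) := by
  classical
  have : Finite (R →* P) := .of_injective _ DFunLike.coe_injective
  let _ : Fintype (R →* P) := Fintype.ofFinite _
  have hterm (ψ : R →* P) : mark (coGraph ψ) (DBurn.toBurn (f : DBurn P)) =
      if F.IsMor ψ then mark (diag R) (DBurn.toBurn (f : DBurn P)) else 0 := by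
    split_ifs with h
    · exact (mem_heckeInv_iff.1 hf _ _ (isGraph_diag R) h.prodIsomorphic_coGraph).symm
    · exact mark_eq_zero_of_not_isGraph f fun h' => h (isMor_of_isGraph_coGraph h')
  rw [card_mul_mark_eval, Finset.sum_congr rfl fun ψ _ => hterm ψ, ← Finset.sum_filter,
    Finset.sum_const, nsmul_eq_mul, Nat.card_eq_fintype_card, Fintype.card_subtype]

theorem eq_zero_of_eval_eq_zero {f : F.hecke} (hf : f ∈ F.heckeInv) (h : F.eval f = 0) :
    f = 0 := by
  suffices hmark : DBurn.toBurn (f : DBurn P) = 0 from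
    Subtype.ext ((map_eq_zero_iff _ DBurn.toBurn.injective).1 hmark)
  refine eq_zero_of_forall_mark fun D => ?_
  by_cases hD : F.IsGraph D
  · have : Finite (D.map (MonoidHom.snd P P) →* P) := .of_injective _ DFunLike.coe_injective
    have : Nonempty {ψ : D.map (MonoidHom.snd P P) →* P // F.IsMor ψ} :=
      ⟨⟨_, F.isMor_subtype _⟩⟩
    have hcard := card_mul_mark_eval_of_mem_heckeInv hf (D.map (MonoidHom.snd P P))
    rw [h, map_zero, mul_zero, eq_comm, mul_eq_zero] at hcard
    rw [← mem_heckeInv_iff.1 hf _ _ (isGraph_diag _) hD.prodIsomorphic_diag]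
    exact hcard.resolve_left (Nat.cast_ne_zero.2 Nat.card_pos.ne')
  · exact mark_eq_zero_of_not_isGraph f hD

theorem mul_eq_zsmul_of_eval_eq {n : ℤ} {w : F.hecke} (hw : w ∈ F.heckeInv)
    (hwn : F.eval w = n • 1) {f : F.hecke} (hf : f ∈ F.heckeInv) : f * w = n • f := by
  refine sub_eq_zero.1 (eq_zero_of_eval_eq_zero
    (sub_mem (mul_mem_heckeInv hf hw) (F.heckeInv.smul_mem n hf)) ?_)
  rw [map_sub, map_smul, eval_mul_of_mem_heckeInv f hw, hwn, mul_smul_comm, mul_one, sub_self]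

end Invariants

section Frobenius

theorem card_conjAut_mul_card_centralizer [Finite P] (Q : Subgroup P) :
    Nat.card (conjAut Q) * Nat.card (Subgroup.centralizer (Q : Set P)) =
      Nat.card (Subgroup.normalizer (Q : Set P)) := by
  have h := Subgroup.index_mul_card
    ((Subgroup.centralizer (Q : Set P)).subgroupOf (Subgroup.normalizer (Q : Set P)))
  rwa [Nat.card_congr (Subgroup.subgroupOfEquivOfLe
    (Subgroup.centralizer_le_normalizer (Q : Set P))).toEquiv, ← Subgroup.normalizerMonoidHom_ker,
    Subgroup.index_ker] at h

theorem card_isMor_top [Finite P] :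
    Nat.card {ψ : (⊤ : Subgroup P) →* P // F.IsMor ψ} = Nat.card (F.aut ⊤) :=
  Nat.card_congr
    { toFun ψ := ⟨MulEquiv.ofBijective
        ((Subgroup.topEquiv (G := P)).symm.toMonoidHom.comp ψ.1)
        (Finite.injective_iff_bijective.1 (F.injective (show _ ∈ F.Hom ⊤ ⊤ from ψ.2))), ψ.2⟩
      invFun σ := ⟨(Subgroup.topEquiv (G := P)).toMonoidHom.comp σ.1.toMonoidHom, σ.2⟩
      left_inv _ := rfl
      right_inv _ := Subtype.ext (MulEquiv.ext fun _ => rfl) }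

variable [Finite P] {p : ℕ} [Fact p.Prime]

theorem exists_heckeInv_not_dvd (hP : IsPGroup p P) (hF : F.IsFrobenius p) :
    ∃ f ∈ F.heckeInv, ¬ (p : ℤ) ∣ mark ⊤ (F.eval f) := by
  obtain ⟨f, hf, hfP⟩ := exists_hecke_mark_invariant hP hF
  obtain ⟨S, hS⟩ := hF.sylow
  have hdiag : Nat.card (diag (⊤ : Subgroup P)) = Nat.card P := by
    rw [← (isGraph_diag (F := F) ⊤).card_map_snd, map_snd_diag, Subgroup.card_top]
  have hinner : Nat.card (conjAut (⊤ : Subgroup P)) * Nat.card (Subgroup.center P) =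
      Nat.card P := by
    have h := card_conjAut_mul_card_centralizer (⊤ : Subgroup P)
    rwa [Subgroup.normalizer_eq_top, Subgroup.coe_top, Subgroup.centralizer_univ,
      Subgroup.card_top] at h
  have haut : Nat.card (F.aut ⊤) = Nat.card (conjAut (⊤ : Subgroup P)) *
      (S : Subgroup (F.aut ⊤)).index := by
    rw [← Subgroup.card_mul_index (S : Subgroup (F.aut ⊤)), hS,
      Nat.card_congr (Subgroup.subgroupOfEquivOfLe (conjAut_le_aut (F := F) ⊤)).toEquiv]
  have hindex : mark ⊤ (F.eval f) = (S : Subgroup (F.aut ⊤)).index := by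
    have h := card_mul_mark_eval_of_mem_heckeInv (mem_heckeInv_iff.2 hf) ⊤
    rw [hfP _ (isGraph_diag ⊤) hdiag, card_isMor_top, haut, ← Nat.cast_mul, mul_right_comm, hinner,
      Nat.cast_mul] at h
    exact mul_left_cancel₀ (Nat.cast_ne_zero.2 Nat.card_pos.ne') h
  refine ⟨f, mem_heckeInv_iff.2 hf, fun hdvd => S.not_dvd_index ?_⟩
  rwa [hindex, Int.natCast_dvd_natCast] at hdvd

theorem exists_heckeInv_eval_eq (hP : IsPGroup p P) (hF : F.IsFrobenius p) :
    ∃ n : ℤ, ¬ (p : ℤ) ∣ n ∧ ∃ w ∈ F.heckeInv, F.eval w = n • 1 := by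
  obtain ⟨f, hf, hfp⟩ := exists_heckeInv_not_dvd hP hF
  obtain ⟨n, hn, b, hb, hbf⟩ := exists_mem_mul_eq_zsmul_one hP
    (S := F.burnInvSubalgebra) (eval_mem_burnInv hf) hfp
  exact ⟨n, hn, F.mulHecke b * f, mulHecke_mul_mem hb hf, (eval_mulHecke_mul b f).trans hbf⟩

end Frobenius

end DivisibleCategory

section BaseChange

variable {A B : Type*} [CommRing A] [CommRing B] [Algebra A B]

theorem baseChange_le_iff {M : Type*} [AddCommGroup M] [Module A M] {p : Submodule A M}
    {q : Submodule B (B ⊗[A] M)} : p.baseChange B ≤ q ↔ ∀ m ∈ p, 1 ⊗ₜ[A] m ∈ q := by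
  rw [Submodule.baseChange_eq_span, Submodule.span_le]
  exact Set.forall_mem_image

theorem baseChange_sup {M : Type*} [AddCommGroup M] [Module A M] (p q : Submodule A M) :
    (p ⊔ q).baseChange B = p.baseChange B ⊔ q.baseChange B := by
  refine le_antisymm (baseChange_le_iff.2 fun m hm => ?_)
    (sup_le (Submodule.baseChange_mono B le_sup_left) (Submodule.baseChange_mono B le_sup_right))
  obtain ⟨x, hx, y, hy, rfl⟩ := Submodule.mem_sup.1 hm
  rw [TensorProduct.tmul_add]
  exact Submodule.add_mem_sup (Submodule.tmul_mem_baseChange_of_mem 1 hx)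
    (Submodule.tmul_mem_baseChange_of_mem 1 hy)

theorem mul_mem_baseChange {H : Type*} [Ring H] [Algebra A H] {p q r : Submodule A H}
    (h : ∀ x ∈ p, ∀ y ∈ q, x * y ∈ r) {x y : B ⊗[A] H} (hx : x ∈ p.baseChange B)
    (hy : y ∈ q.baseChange B) : x * y ∈ r.baseChange B := by
  suffices p.baseChange B * q.baseChange B ≤ r.baseChange B from
    this (Submodule.mul_mem_mul hx hy)
  rw [Submodule.baseChange_eq_span, Submodule.baseChange_eq_span, Submodule.span_mul_span,
    Submodule.span_le]
  rintro _ ⟨_, ⟨x, hx, rfl⟩, _, ⟨y, hy, rfl⟩, rfl⟩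
  simp only [TensorProduct.mk_apply, Algebra.TensorProduct.tmul_mul_tmul, mul_one]
  exact Submodule.tmul_mem_baseChange_of_mem 1 (h x hx y hy)

theorem ker_baseChange {M N : Type*} [AddCommGroup M] [Module A M] [AddCommGroup N] [Module A N]
    {f : M →ₗ[A] N} (hf : Function.Surjective f) :
    LinearMap.ker (f.baseChange B) = (LinearMap.ker f).baseChange B :=
  SetLike.ext (lTensor_exact B f.exact_subtype_ker_map hf)

end BaseChange

theorem isUnit_intCast_of_not_dvd (p : ℕ) [Fact p.Prime] (A : Type*) [CommRing A]
    [IsLocalization.AtPrime A (Ideal.span {(p : ℤ)})] {n : ℤ} (hn : ¬ (p : ℤ) ∣ n) :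
    IsUnit (n : A) := by
  simpa only [eq_intCast] using IsLocalization.map_units A
    (M := (Ideal.span {(p : ℤ)}).primeCompl) ⟨n, fun h => hn (Ideal.mem_span_singleton.1 h)⟩

section Semidirect

variable {A H : Type*} [CommRing A] [Ring H] [Algebra A H] {K : Ideal H}
  {N : NonUnitalSubalgebra A H}

/-- The sum of a left ideal `K` and a non-unital subalgebra `N` with `K * N = 0`, as a subalgebra,
provided that it contains the unit. -/
def sumSubalgebra (hKN : ∀ k ∈ K, ∀ f ∈ N, k * f = 0)
    (h1 : (1 : H) ∈ K.restrictScalars A ⊔ N.toSubmodule) : Subalgebra A H :=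
  (K.restrictScalars A ⊔ N.toSubmodule).toSubalgebra h1 fun x y hx hy => by
    obtain ⟨k, hk, f, hf, rfl⟩ := Submodule.mem_sup.1 hx
    obtain ⟨k', hk', f', hf', rfl⟩ := Submodule.mem_sup.1 hy
    rw [mul_add, add_mul k f f', hKN k hk f' hf', zero_add]
    exact Submodule.add_mem_sup (K.mul_mem_left _ hk') (N.mul_mem hf hf')

theorem exists_semidirect_linearEquiv (hKN : ∀ k ∈ K, ∀ f ∈ N, k * f = 0)
    (h1 : (1 : H) ∈ K.restrictScalars A ⊔ N.toSubmodule) {e : H} (he : e ∈ N)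
    (hNe : ∀ f ∈ N, f * e = f) :
    ∃ Φ : (K × N) ≃ₗ[A] sumSubalgebra hKN h1, (∀ (k : K) (f : N), (Φ (k, f) : H) = k + f) ∧
      ∀ (k k' : K) (f f' : N),
        Φ (k, f) * Φ (k', f') = Φ ((k : H) • k' + (f : H) • k', f * f') := by
  let Φ : (K × N) →ₗ[A] sumSubalgebra hKN h1 :=
    { toFun a := ⟨a.1 + a.2, Submodule.add_mem_sup a.1.2 a.2.2⟩
      map_add' a b := Subtype.ext (add_add_add_comm _ _ _ _)
      map_smul' c a := Subtype.ext (smul_add c (a.1 : H) a.2).symm }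
  have hΦe (a : K × N) : (Φ a : H) * e = a.2 := by
    change ((a.1 : H) + a.2) * e = a.2
    rw [add_mul, hKN _ a.1.2 e he, hNe _ a.2.2, zero_add]
  refine ⟨.ofBijective Φ ⟨fun a b h => ?_, ?_⟩, fun _ _ => rfl, fun k k' f f' => Subtype.ext ?_⟩
  · have hsnd : (a.2 : H) = b.2 := by rw [← hΦe, ← hΦe, h]
    have hsum : (a.1 : H) + a.2 = b.1 + b.2 := congrArg Subtype.val h
    rw [hsnd] at hsum
    exact Prod.ext (Subtype.ext (add_right_cancel hsum)) (Subtype.ext hsnd)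
  · rintro ⟨x, hx⟩
    obtain ⟨k, hk, f, hf, rfl⟩ := Submodule.mem_sup.1 hx
    exact ⟨(⟨k, hk⟩, ⟨f, hf⟩), rfl⟩
  · change ((k : H) + f) * (k' + f') = k * k' + f * k' + f * f'
    rw [mul_add, add_mul (k : H) f f', hKN k k.2 f' f'.2, zero_add, add_mul]

end Semidirect

namespace DivisibleCategory

open Burn

section BaseChange

variable {P : Type u} [Group P] [Finite P] (F : DivisibleCategory P) (R : Type v) [CommRing R]

/-- The base change `R ⊗ K_H` of the kernel of the evaluation, as a left ideal of `R ⊗ H`. -/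
def kerEvalIdeal : Ideal (R ⊗[ℤ] F.hecke) :=
  { F.kerEval.baseChange R with
    smul_mem' x k hk := mul_mem_baseChange (p := ⊤)
      (fun h _ k hk => LinearMap.mem_ker.2 <| by
        rw [eval_mul, LinearMap.mem_ker.1 hk, map_zero])
      (by rw [Submodule.baseChange_top]; trivial) hk }

/-- The base change `R ⊗ H^F` of the invariant elements of the Hecke algebra, as a non-unital
subalgebra of `R ⊗ H`: its unit is not the unit of `R ⊗ H`. -/
def heckeInvSubalgebra : NonUnitalSubalgebra R (R ⊗[ℤ] F.hecke) :=
  { F.heckeInv.baseChange R with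
    mul_mem' := mul_mem_baseChange fun _ hf _ hf' => mul_mem_heckeInv hf hf' }

variable {F R}

theorem mem_kerEvalIdeal {x : R ⊗[ℤ] F.hecke} :
    x ∈ F.kerEvalIdeal R ↔ F.eval.baseChange R x = 0 := by
  change x ∈ (LinearMap.ker F.eval).baseChange R ↔ _
  rw [← ker_baseChange fun s => ⟨F.mulHecke s, eval_mulHecke s⟩, LinearMap.mem_ker]

theorem mul_eq_zero_of_mem_kerEvalIdeal {k f : R ⊗[ℤ] F.hecke} (hk : k ∈ F.kerEvalIdeal R)
    (hf : f ∈ F.heckeInvSubalgebra R) : k * f = 0 := by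
  have h : k * f ∈ (⊥ : Submodule ℤ F.hecke).baseChange R :=
    mul_mem_baseChange (fun k hk f hf => (Submodule.mem_bot ℤ).2 <| by
      rw [mul_eq_mulHecke_eval_mul k hf, LinearMap.mem_ker.1 hk, map_zero, zero_mul]) hk hf
  rwa [Submodule.baseChange_bot, Submodule.mem_bot] at h

theorem eval_baseChange_one : F.eval.baseChange R 1 = 1 := by
  rw [Algebra.TensorProduct.one_def, LinearMap.baseChange_tmul, eval_one,
    Algebra.TensorProduct.one_def]

theorem eval_baseChange_mulHecke (s : R ⊗[ℤ] Burn P) :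
    F.eval.baseChange R (F.mulHecke.baseChange R s) = s := by
  rw [← LinearMap.comp_apply, ← LinearMap.baseChange_comp,
    show F.eval ∘ₗ F.mulHecke = .id from LinearMap.ext eval_mulHecke, LinearMap.baseChange_id,
    LinearMap.id_apply]

theorem eval_baseChange_mulHecke_mul (s : R ⊗[ℤ] Burn P) (x : R ⊗[ℤ] F.hecke) :
    F.eval.baseChange R (F.mulHecke.baseChange R s * x) = s * F.eval.baseChange R x := by
  induction s using TensorProduct.induction_on with
  | zero => rw [map_zero, zero_mul, map_zero, zero_mul]
  | add s t hs ht => rw [map_add, add_mul, map_add, hs, ht, add_mul]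
  | tmul a s =>
    induction x using TensorProduct.induction_on with
    | zero => rw [map_zero, mul_zero, map_zero, mul_zero]
    | add x y hx hy => rw [mul_add, map_add, hx, hy, map_add, mul_add]
    | tmul b h =>
      simp only [LinearMap.baseChange_tmul, Algebra.TensorProduct.tmul_mul_tmul,
        eval_mulHecke_mul]

theorem mul_eq_mulHecke_eval_baseChange_mul (x : R ⊗[ℤ] F.hecke) {f : R ⊗[ℤ] F.hecke}
    (hf : f ∈ F.heckeInvSubalgebra R) :
    x * f = F.mulHecke.baseChange R (F.eval.baseChange R x) * f := by
  have hx : x - F.mulHecke.baseChange R (F.eval.baseChange R x) ∈ F.kerEvalIdeal R :=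
    mem_kerEvalIdeal.2 (by rw [map_sub, eval_baseChange_mulHecke, sub_self])
  exact sub_eq_zero.1 ((sub_mul _ _ _).symm.trans (mul_eq_zero_of_mem_kerEvalIdeal hx hf))

theorem eval_baseChange_mul (x : R ⊗[ℤ] F.hecke) {f : R ⊗[ℤ] F.hecke}
    (hf : f ∈ F.heckeInvSubalgebra R) :
    F.eval.baseChange R (x * f) = F.eval.baseChange R x * F.eval.baseChange R f := by
  rw [mul_eq_mulHecke_eval_baseChange_mul x hf, eval_baseChange_mulHecke_mul]

theorem eval_baseChange_mem {f : R ⊗[ℤ] F.hecke} (hf : f ∈ F.heckeInvSubalgebra R) :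
    F.eval.baseChange R f ∈ F.burnInvSubalgebra.baseChange R := by
  have h : F.heckeInv.baseChange R ≤ (F.burnInv.baseChange R).comap (F.eval.baseChange R) :=
    baseChange_le_iff.2 fun f hf => Submodule.tmul_mem_baseChange_of_mem 1 (eval_mem_burnInv hf)
  exact h hf

theorem mulHecke_baseChange_mul_mem {s : R ⊗[ℤ] Burn P}
    (hs : s ∈ F.burnInvSubalgebra.baseChange R) {f : R ⊗[ℤ] F.hecke}
    (hf : f ∈ F.heckeInvSubalgebra R) :
    F.mulHecke.baseChange R s * f ∈ F.heckeInvSubalgebra R := by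
  have hmap : F.burnInv.baseChange R ≤
      ((F.burnInv.map F.mulHecke).baseChange R).comap (F.mulHecke.baseChange R) :=
    baseChange_le_iff.2 fun s hs =>
      Submodule.tmul_mem_baseChange_of_mem 1 (Submodule.mem_map_of_mem hs)
  refine mul_mem_baseChange (p := F.burnInv.map F.mulHecke) ?_ (hmap hs) hf
  rintro _ ⟨s, hs, rfl⟩ f hf
  exact mulHecke_mul_mem hs hf

theorem exists_heckeInvSubalgebra_unit {p : ℕ} [Fact p.Prime] (hP : IsPGroup p P)
    (hF : F.IsFrobenius p) (hR : ∀ n : ℤ, ¬ (p : ℤ) ∣ n → IsUnit (n : R)) :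
    ∃ e ∈ F.heckeInvSubalgebra R, F.eval.baseChange R e = 1 ∧
      ∀ f ∈ F.heckeInvSubalgebra R, f * e = f := by
  obtain ⟨n, hn, w, hw, hwn⟩ := exists_heckeInv_eval_eq hP hF
  obtain ⟨v, hv⟩ := hR n hn
  have hcancel {M : Type u} [AddCommGroup M] (m : M) :
      (v⁻¹ : Rˣ).1 ⊗ₜ[ℤ] (n • m) = (1 : R) ⊗ₜ m := by
    rw [← TensorProduct.smul_tmul, zsmul_eq_mul, ← hv, Units.mul_inv]
  refine ⟨(v⁻¹ : Rˣ).1 ⊗ₜ w, Submodule.tmul_mem_baseChange_of_mem _ hw, ?_, fun f hf => ?_⟩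
  · rw [LinearMap.baseChange_tmul, hwn, hcancel, Algebra.TensorProduct.one_def]
  · have h : F.heckeInv.baseChange R ≤
        LinearMap.eqLocus (LinearMap.mulRight R ((v⁻¹ : Rˣ).1 ⊗ₜ w)) LinearMap.id :=
      baseChange_le_iff.2 fun f hf => by
        rw [LinearMap.mem_eqLocus, LinearMap.mulRight_apply, Algebra.TensorProduct.tmul_mul_tmul,
          one_mul, mul_eq_zsmul_of_eval_eq hw hwn hf, hcancel, LinearMap.id_apply]
    exact h hf

section Unit

variable {e : R ⊗[ℤ] F.hecke} (he : e ∈ F.heckeInvSubalgebra R)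
  (heval : F.eval.baseChange R e = 1)

include he heval

theorem mem_sup_of_eval_baseChange_mem {x : R ⊗[ℤ] F.hecke}
    (hx : F.eval.baseChange R x ∈ F.burnInvSubalgebra.baseChange R) :
    x ∈ (F.kerEvalIdeal R).restrictScalars R ⊔ (F.heckeInvSubalgebra R).toSubmodule := by
  rw [← sub_add_cancel x (F.mulHecke.baseChange R (F.eval.baseChange R x) * e)]
  refine Submodule.add_mem_sup (mem_kerEvalIdeal.2 ?_) (mulHecke_baseChange_mul_mem hx he)
  rw [map_sub, eval_baseChange_mulHecke_mul, heval, mul_one, sub_self]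

theorem exists_heckeInvSubalgebra_linearEquiv
    (hmul : ∀ f ∈ F.heckeInvSubalgebra R, f * e = f) :
    ∃ Φ : F.heckeInvSubalgebra R ≃ₗ[R] F.burnInvSubalgebra.baseChange R,
      (∀ f : F.heckeInvSubalgebra R, (Φ f : R ⊗[ℤ] Burn P) = F.eval.baseChange R f) ∧
      ∀ f f' : F.heckeInvSubalgebra R, Φ (f * f') = Φ f * Φ f' :=
  ⟨{  toFun f := ⟨F.eval.baseChange R f, eval_baseChange_mem f.2⟩
      map_add' f f' := Subtype.ext (map_add (F.eval.baseChange R) f.1 f'.1)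
      map_smul' c f := Subtype.ext (map_smul (F.eval.baseChange R) c f.1)
      invFun s := ⟨F.mulHecke.baseChange R s * e, mulHecke_baseChange_mul_mem s.2 he⟩
      left_inv f := Subtype.ext <| by
        change F.mulHecke.baseChange R (F.eval.baseChange R f) * e = f
        rw [← mul_eq_mulHecke_eval_baseChange_mul _ he, hmul f f.2]
      right_inv s := Subtype.ext <| by
        change F.eval.baseChange R (F.mulHecke.baseChange R s * e) = s
        rw [eval_baseChange_mulHecke_mul, heval, mul_one] },
    fun _ => rfl, fun f f' => Subtype.ext (eval_baseChange_mul f.1 f'.2)⟩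

end Unit

end BaseChange

end DivisibleCategory

end

open DivisibleCategory in
theorem theorem6p6_general {P : Type u} [Group P] [Finite P] (p : ℕ) [Fact p.Prime]
    (hP : IsPGroup p P) (R : Type v) [CommRing R]
    (hR : ∀ n : ℤ, ¬ (p : ℤ) ∣ n → IsUnit (n : R)) (F : DivisibleCategory P)
    (hF : F.IsFrobenius p) :
    ∃ (S : Subalgebra R (R ⊗[ℤ] F.hecke))
      (K : Ideal (R ⊗[ℤ] F.hecke))
      (N : NonUnitalSubalgebra R (R ⊗[ℤ] F.hecke))
      (A : Subalgebra R (R ⊗[ℤ] Burn P)),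
      Subalgebra.toSubmodule S = (F.kerEval ⊔ F.heckeInv).baseChange R ∧
      K.restrictScalars R = F.kerEval.baseChange R ∧
      N.toSubmodule = F.heckeInv.baseChange R ∧
      Subalgebra.toSubmodule A = F.burnInv.baseChange R ∧
      (∀ s ∈ F.burnInv, (1 : R) ⊗ₜ[ℤ] F.mulHecke s ∈ S) ∧
      (∃ e : (K × N) ≃ₗ[R] S,
        (∀ (k : K) (f : N), (e (k, f) : R ⊗[ℤ] F.hecke) = k + f) ∧
        ∀ (k k' : K) (f f' : N), e (k, f) * e (k', f') =
          e ((k : R ⊗[ℤ] F.hecke) • k' + (f : R ⊗[ℤ] F.hecke) • k', f * f')) ∧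
      (∀ f, ∀ s ∈ F.burnInv, f * F.mulHecke s = F.mulHecke s * f) ∧
      ∃ e : N ≃ₗ[R] A,
        (∀ f : N, (e f : R ⊗[ℤ] Burn P) = F.eval.baseChange R f) ∧
        ∀ f f' : N, e (f * f') = e f * e f' := by
  obtain ⟨e, he, heval, hmul⟩ := exists_heckeInvSubalgebra_unit hP hF hR
  have hKN (k) (hk : k ∈ F.kerEvalIdeal R) (f) (hf : f ∈ F.heckeInvSubalgebra R) : k * f = 0 :=
    mul_eq_zero_of_mem_kerEvalIdeal hk hf
  have hone : 1 ∈ (F.kerEvalIdeal R).restrictScalars R ⊔ (F.heckeInvSubalgebra R).toSubmodule :=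
    mem_sup_of_eval_baseChange_mem he heval (eval_baseChange_one (F := F) (R := R) ▸ one_mem _)
  refine ⟨sumSubalgebra hKN hone, _, _, F.burnInvSubalgebra.baseChange R,
    (baseChange_sup F.kerEval F.heckeInv).symm, rfl, rfl, rfl, fun s hs => ?_,
    exists_semidirect_linearEquiv hKN hone he hmul, fun f _ => mul_mulHecke_comm f,
    exists_heckeInvSubalgebra_linearEquiv he heval hmul⟩
  refine mem_sup_of_eval_baseChange_mem he heval ?_
  rw [LinearMap.baseChange_tmul, eval_mulHecke]
  exact Subalgebra.tmul_mem_baseChange hs 1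

theorem theorem6p6 {P : Type u} [Group P] [Finite P] (p : ℕ) [Fact p.Prime] (hP : IsPGroup p P)
    (Zp : Type v) [CommRing Zp] [IsLocalization.AtPrime Zp (Ideal.span {(p : ℤ)})]
    (F : DivisibleCategory P) (hF : F.IsFrobenius p) :
    ∃ (S : Subalgebra Zp (Zp ⊗[ℤ] F.hecke))
      (K : Ideal (Zp ⊗[ℤ] F.hecke))
      (N : NonUnitalSubalgebra Zp (Zp ⊗[ℤ] F.hecke))
      (A : Subalgebra Zp (Zp ⊗[ℤ] Burn P)),
      Subalgebra.toSubmodule S = (F.kerEval ⊔ F.heckeInv).baseChange Zp ∧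
      K.restrictScalars Zp = F.kerEval.baseChange Zp ∧
      N.toSubmodule = F.heckeInv.baseChange Zp ∧
      Subalgebra.toSubmodule A = F.burnInv.baseChange Zp ∧
      (∀ s ∈ F.burnInv, (1 : Zp) ⊗ₜ[ℤ] F.mulHecke s ∈ S) ∧
      (∃ e : (K × N) ≃ₗ[Zp] S,
        (∀ (k : K) (f : N), (e (k, f) : Zp ⊗[ℤ] F.hecke) = k + f) ∧
        ∀ (k k' : K) (f f' : N), e (k, f) * e (k', f') =
          e ((k : Zp ⊗[ℤ] F.hecke) • k' + (f : Zp ⊗[ℤ] F.hecke) • k', f * f')) ∧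
      (∀ f ∈ F.heckeInv, ∀ s ∈ F.burnInv, f * F.mulHecke s = F.mulHecke s * f) ∧
      ∃ e : N ≃ₗ[Zp] A,
        (∀ f : N, (e f : Zp ⊗[ℤ] Burn P) = F.eval.baseChange Zp f) ∧
        ∀ f f' : N, e (f * f') = e f * e f' := by
  obtain ⟨S, K, N, A, hS, hK, hN, hA, hm, hSe, hcomm, hNA⟩ :=
    theorem6p6_general p hP Zp (fun _ => isUnit_intCast_of_not_dvd p Zp) F hF
  exact ⟨S, K, N, A, hS, hK, hN, hA, hm, hSe, fun f _ => hcomm f, hNA⟩
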